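/- Let $l$ be an odd prime and let $q$ be a prime power that is prime to $l$. Let $G=\mathrm{GL}_2(\mathbb F_q)$, with centre $Z$, group $N$ of upper unipotent matrices and diagonal torus $T$, and let $E\cong\mathbb F_{q^2}^\times$ be the subgroup of $G$ obtained by letting $\mathbb F_{q^2}^\times$ act by multiplication on $\mathbb F_{q^2}\cong\mathbb F_q^2$. Let $k$ be a finite field of characteristic $l$, with algebraic closure $\bar k=\overline{\mathbb F}_l$, let $K$ be an algebraic closure of the fraction field of the ring of Witt vectors $W(k)$, let $\mathcal O$ be its ring of integers, and fix a reduction map $\mathcal O\to\bar k$ compatible with $W(k)\to k$. For a character $\tilde\theta:E\to K^\times$ with $\tilde\theta^q\ne\tilde\theta$ let $\pi_{\tilde\theta}$ be the irreducible cuspidal $K$-representation of $G$ of dimension $q-1$ with character $$z\mapsto (q-1)\tilde\theta(z),\qquad zu\mapsto-\tilde\theta(z),\qquad t\mapsto 0,\qquad y\mapsto-\tilde\theta(y)-\tilde\theta(y)^q$$ for $z\in Z$, $u\in N\setminus\{1\}$, $t\in T\setminus Z$, $y\in E\setminus Z$. Let $\theta:E\to k^\times$ be a character with $\theta^q\neq\theta$,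 let $S_\theta$ be the set of characters $\tilde\theta:E\to K^\times$ with $\tilde\theta^q\ne\tilde\theta$ that reduce to $\theta$, and let $\pi_\theta$ be a representation of $G$ over $k$ such that $\pi_\theta\otimes_k\bar k$ is isomorphic to the reduction of a $G$-stable $\mathcal O$-lattice in $\pi_{\tilde\theta}$ for some $\tilde\theta\in S_\theta$. For a local $W(k)$-algebra $A$ with residue field $k$, an $A$-deformation of $\pi_\theta$ is a homomorphism $G\to\mathrm{GL}_{q-1}(A)$ lifting $\pi_\theta$, up to conjugation by matrices that reduce to the identity, and an $A$-deformation of $\theta$ is a character $E\to A^\times$ lifting $\theta$. A universal deformation is one over a complete Noetherian local $W(k)$-algebra with residue field $k$ from which every deformation over a finite length local $W(k)$-algebra $A$ with residue field $k$ arises by a unique $W(k)$-algebra homomorphism to $A$; its coefficient ring is the universal deformation ring. **Theorem.** The representation $\pi_\theta$ and the character $\theta$ have universal deformations $\pi^{\mathrm{univ}}$, $\theta^{\mathrm{univ}}$, over rings $R^{\mathrm{univ}}_{\pi_\theta}$, $R^{\mathrm{univ}}_{\theta}$. There are unique homomorphisms of $W(k)$-algebras $$\Phi_\pi:R^{\mathrm{univ}}_{\pi_\theta}\to\prod_{\tilde\theta\in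 S_\theta}K,\qquad \Phi_\theta:R^{\mathrm{univ}}_{\theta}\to\prod_{\tilde\theta\in S_\theta}K$$ such that the $\tilde\theta$-component of $\Phi_\pi$ carries the character of $\pi^{\mathrm{univ}}$ to that of $\pi_{\tilde\theta}$, and the $\tilde\theta$-component of $\Phi_\theta$ carries $\theta^{\mathrm{univ}}$ to $\tilde\theta$, for all $\tilde\theta\in S_\theta$. Both are injective; their images are the $W(k)$-subalgebras generated by the elements $x_\sigma=(\mathrm{tr}\,\pi_{\tilde\theta}(\sigma))_{\tilde\theta}$, $\sigma\in G$, and by the elements $y_\sigma=(\tilde\theta(\sigma))_{\tilde\theta}$, $\sigma\in E$, respectively. The first image is contained in the second, and the resulting map $$R^{\mathrm{univ}}_{\pi_\theta}\to R^{\mathrm{univ}}_{\theta}$$ is an isomorphism of $W(k)$-algebras. In particular, for complete Noetherian local $W(k)$-algebras $A$ with residue field $k$ (for instance those of finite length) there is a bijection, natural in $A$ and induced by this isomorphism, between $A$-deformations of $\theta$ and $A$-deformations of $\pi_\theta$. It induces the correspondence $\tilde\theta\mapsto\pi_{\tilde\theta}$ on lifts to $K$: if $\pi_A$ corresponds to $\theta_A$,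 and $j:A\to K$ is a homomorphism of $W(k)$-algebras such that $j\circ\theta_A=\tilde\theta\in S_\theta$, then the base change of $\pi_A$ along $j$ is isomorphic to $\pi_{\tilde\theta}$. -/

import Mathlib

universe u v w x

open IsLocalRing
open scoped MatrixGroups

noncomputable section

namespace CuspidalDeformation

/-! ### Coefficient rings -/

/-- `A` is a local `W(k)`-algebra with residue field `k`. The reduction map `res : A → k` is
compatible with `W(k) → k`; it is automatically surjective with kernel the maximal ideal, and it is
uniquely determined by the `W(k)`-algebra `A`. -/
class LocalCoeff (l : ℕ) [Fact l.Prime] (k : Type u) [Field k] (A : Type u) [CommRing A]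
    [Algebra (WittVector l k) A] extends IsLocalRing A where
  res : A →+* k
  res_algebraMap : ∀ w : WittVector l k,
    res (algebraMap (WittVector l k) A w) = WittVector.constantCoeff w

/-- `A` is a complete Noetherian local `W(k)`-algebra with residue field `k`. -/
class CompleteCoeff (l : ℕ) [Fact l.Prime] (k : Type u) [Field k] (A : Type u) [CommRing A]
    [Algebra (WittVector l k) A] extends LocalCoeff l k A where
  noetherian : IsNoetherianRing A
  complete : IsAdicComplete (maximalIdeal A) A

section Deformations

variable {l : ℕ} [Fact l.Prime] {k : Type u} [Field k]
variable {A : Type u} [CommRing A] [Algebra (WittVector l k) A] [LocalCoeff l k A]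
variable {B : Type u} [CommRing B] [Algebra (WittVector l k) B] [LocalCoeff l k B]

variable (l k A) in
/-- The reduction map of a local `W(k)`-algebra with residue field `k`. -/
def res : A →+* k := LocalCoeff.res l

lemma res_algebraMap (w : WittVector l k) :
    res l k A (algebraMap (WittVector l k) A w) = WittVector.constantCoeff w :=
  LocalCoeff.res_algebraMap w

lemma exists_res_algebraMap (c : k) :
    ∃ w : WittVector l k, res l k A (algebraMap (WittVector l k) A w) = c :=
  ⟨WittVector.teichmuller l c, by
    rw [res_algebraMap]; exact WittVector.teichmuller_coeff_zero l c⟩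

lemma res_surjective : Function.Surjective (res l k A) := fun c =>
  (exists_res_algebraMap (A := A) c).elim fun _ hw => ⟨_, hw⟩

lemma isUnit_of_res_ne_zero {a : A} (h : res l k A a ≠ 0) : IsUnit a := by
  by_contra hu
  have hmax : (RingHom.ker (res l k A)).IsMaximal :=
    RingHom.ker_isMaximal_of_surjective _ res_surjective
  have hker := IsLocalRing.eq_maximalIdeal hmax
  have : a ∈ RingHom.ker (res l k A) := by
    rw [hker]; exact (IsLocalRing.mem_maximalIdeal a).2 hu
  exact h ((RingHom.mem_ker).1 this)

/-- Every homomorphism of `W(k)`-algebras between local `W(k)`-algebras with residue field `k` is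
compatible with the reduction maps (in particular it is local). -/
lemma res_comp (f : A →ₐ[WittVector l k] B) :
    (res l k B).comp (f : A →+* B) = res l k A := by
  ext a
  obtain ⟨w, hw⟩ := exists_res_algebraMap (l := l) (A := A) (res l k B (f a))
  by_contra hne
  have hne' : res l k A (a - algebraMap (WittVector l k) A w) ≠ 0 := by
    rw [map_sub, hw]
    intro h
    exact hne (sub_eq_zero.1 h).symm
  have hu := ((isUnit_of_res_ne_zero hne').map f).map (res l k B)
  rw [map_sub, AlgHom.commutes, map_sub, res_algebraMap, ← res_algebraMap (A := A), hw,
    sub_self] at hu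
  exact not_isUnit_zero hu

/-- The trace of an invertible matrix. -/
def tr {C : Type x} [CommRing C] {n : ℕ} (g : GL (Fin n) C) : C :=
  Matrix.trace (g : Matrix (Fin n) (Fin n) C)

/-! ### Deformations of a representation -/

section Rep

variable {G : Type v} [Group G] {n : ℕ}

/-- A lift to `A` of a representation `π : G → GL_n(k)`. -/
def Lift (l : ℕ) [Fact l.Prime] {k : Type u} [Field k] {G : Type v} [Group G] {n : ℕ}
    (π : G →* GL (Fin n) k) (A : Type u) [CommRing A] [Algebra (WittVector l k) A]
    [LocalCoeff l k A] : Type (max u v) :=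
  {ρ : G →* GL (Fin n) A // (Matrix.GeneralLinearGroup.map (res l k A)).comp ρ = π}

variable {π : G →* GL (Fin n) k}

/-- Push-forward of a lift along a homomorphism of coefficient rings. -/
def Lift.map (f : A →ₐ[WittVector l k] B) (ρ : Lift l π A) : Lift l π B :=
  ⟨(Matrix.GeneralLinearGroup.map (f : A →+* B)).comp ρ.1, by
    rw [← MonoidHom.comp_assoc, ← Matrix.GeneralLinearGroup.map_comp, res_comp, ρ.2]⟩

/-- Two lifts are equivalent if they are conjugate by a matrix that reduces to the identity, that
is, if they are isomorphic compatibly with the identifications of their reductions with `π`. -/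
def liftSetoid (l : ℕ) [Fact l.Prime] {k : Type u} [Field k] {G : Type v} [Group G] {n : ℕ}
    (π : G →* GL (Fin n) k) (A : Type u) [CommRing A] [Algebra (WittVector l k) A]
    [LocalCoeff l k A] : Setoid (Lift l π A) where
  r ρ ρ' := ∃ P : GL (Fin n) A, Matrix.GeneralLinearGroup.map (res l k A) P = 1 ∧
    ∀ g, ρ'.1 g = P * ρ.1 g * P⁻¹
  iseqv :=
    { refl := fun ρ => ⟨1, map_one _, fun g => by simp⟩
      symm := by
        rintro ρ ρ' ⟨P, hP, h⟩
        refine ⟨P⁻¹, by rw [map_inv, hP, inv_one], fun g => ?_⟩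
        rw [h g]; group
      trans := by
        rintro ρ ρ' ρ'' ⟨P, hP, h⟩ ⟨Q, hQ, h'⟩
        refine ⟨Q * P, by rw [map_mul, hP, hQ, one_mul], fun g => ?_⟩
        rw [h' g, h g]; group }

/-- The set of `A`-deformations of `π`. -/
def Deformation (l : ℕ) [Fact l.Prime] {k : Type u} [Field k] {G : Type v} [Group G] {n : ℕ}
    (π : G →* GL (Fin n) k) (A : Type u) [CommRing A] [Algebra (WittVector l k) A]
    [LocalCoeff l k A] : Type (max u v) :=
  Quotient (liftSetoid l π A)

/-- The deformation defined by a lift. -/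
def Lift.toDeformation (ρ : Lift l π A) : Deformation l π A :=
  Quotient.mk (liftSetoid l π A) ρ

/-- Push-forward of deformations along a homomorphism of coefficient rings. -/
def Deformation.map (f : A →ₐ[WittVector l k] B) : Deformation l π A → Deformation l π B :=
  Quotient.map (Lift.map f) (by
    rintro ρ ρ' ⟨P, hP, h⟩
    refine ⟨Matrix.GeneralLinearGroup.map (f : A →+* B) P, ?_, fun g => ?_⟩
    · rw [← MonoidHom.comp_apply, ← Matrix.GeneralLinearGroup.map_comp, res_comp, hP]
    · change Matrix.GeneralLinearGroup.map (f : A →+* B) (ρ'.1 g) = _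
      rw [h g, map_mul, map_mul, map_inv]
      rfl)

/-- A lift to a complete Noetherian local `W(k)`-algebra `R` with residue field `k` is a universal
deformation of `π` (and `R` is the universal deformation ring of `π`) if every deformation of `π`
to a finite length local `W(k)`-algebra `A` with residue field `k` is induced by a unique
`W(k)`-algebra homomorphism `R → A`. -/
def Lift.IsUniversal {R : Type u} [CommRing R] [Algebra (WittVector l k) R] [CompleteCoeff l k R]
    (ρ : Lift l π R) : Prop :=
  ∀ (A : Type u) [CommRing A] [Algebra (WittVector l k) A] [LocalCoeff l k A] [IsArtinianRing A]
    (d : Deformation l π A), ∃! f : R →ₐ[WittVector l k] A, (ρ.map f).toDeformation = d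

end Rep

/-! ### Deformations of a character -/

section Char

variable {E : Type w} [CommGroup E]

/-- An `A`-deformation of a character `θ : E → kˣ`. (For characters, equivalent lifts are equal.) -/
def CharDeformation (l : ℕ) [Fact l.Prime] {k : Type u} [Field k] {E : Type w} [CommGroup E]
    (θ : E →* kˣ) (A : Type u) [CommRing A] [Algebra (WittVector l k) A] [LocalCoeff l k A] :
    Type (max u w) :=
  {χ : E →* Aˣ // (Units.map (res l k A : A →* k)).comp χ = θ}

variable {θ : E →* kˣ}

/-- Push-forward of deformations of a character along a homomorphism of coefficient rings. -/
def CharDeformation.map (f : A →ₐ[WittVector l k] B) (χ : CharDeformation l θ A) :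
    CharDeformation l θ B :=
  ⟨(Units.map ((f : A →+* B) : A →* B)).comp χ.1, by
    ext y
    have h := DFunLike.congr_fun χ.2 y
    have h' := RingHom.congr_fun (res_comp f) (χ.1 y : A)
    rw [← h]
    exact h'⟩

/-- The universal deformation of a character. -/
def CharDeformation.IsUniversal {R : Type u} [CommRing R] [Algebra (WittVector l k) R]
    [CompleteCoeff l k R] (χ : CharDeformation l θ R) : Prop :=
  ∀ (A : Type u) [CommRing A] [Algebra (WittVector l k) A] [LocalCoeff l k A] [IsArtinianRing A]
    (d : CharDeformation l θ A), ∃! f : R →ₐ[WittVector l k] A, χ.map f = d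

end Char

end Deformations

/-! ### The characters of the cuspidal representations of `GL₂(𝔽_q)` -/

section Cuspidal

variable {F : Type v} [Field F] {F₂ : Type w} [Field F₂] [Algebra F F₂]

/-- The embedding of `𝔽_{q²}ˣ` in `GL₂(𝔽_q)` given by multiplication on `𝔽_{q²}`, in terms of a
basis of `𝔽_{q²}` over `𝔽_q`. -/
def torus (b : Module.Basis (Fin 2) F F₂) : F₂ˣ →* GL (Fin 2) F :=
  Units.map (Algebra.leftMulMatrix b : F₂ →* Matrix (Fin 2) (Fin 2) F)

/-- The inclusion of `𝔽_qˣ` in `𝔽_{q²}ˣ`. -/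
def inclUnits (F : Type v) [Field F] (F₂ : Type w) [Field F₂] [Algebra F F₂] : Fˣ →* F₂ˣ :=
  Units.map (algebraMap F F₂ : F →* F₂)

/-- The class function `χ` on `GL₂(𝔽_q)` is the character of the cuspidal (virtual) representation
`Ind_{ZN} θ_ψ - Ind_E θ` attached to the character `θ` of `E = 𝔽_{q²}ˣ`: its value is
`(q - 1) θ(z)` at central elements `z`, `-θ(z)` at `z u` with `u ≠ 1` upper unipotent,
`0` at non-central diagonal matrices, and `-θ(y) - θ(y)^q` at non-central `y ∈ E`. Every element
of the group is conjugate to one of these. -/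
def IsCuspidalCharacter {C : Type x} [CommRing C] (b : Module.Basis (Fin 2) F F₂)
    (θ : F₂ˣ →* Cˣ) (χ : GL (Fin 2) F → C) : Prop :=
  (∀ (g : GL (Fin 2) F) (z : Fˣ), (g : Matrix (Fin 2) (Fin 2) F) = !![(z : F), 0; 0, (z : F)] →
    χ g = ((Nat.card F : C) - 1) * (θ (inclUnits F F₂ z) : C)) ∧
  (∀ (g : GL (Fin 2) F) (z : Fˣ) (u : F), u ≠ 0 →
    (g : Matrix (Fin 2) (Fin 2) F) = (z : F) • !![1, u; 0, 1] →
    χ g = -(θ (inclUnits F F₂ z) : C)) ∧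
  (∀ (g : GL (Fin 2) F) (a d : Fˣ), a ≠ d →
    (g : Matrix (Fin 2) (Fin 2) F) = !![(a : F), 0; 0, (d : F)] → χ g = 0) ∧
  (∀ y : F₂ˣ, y ∉ (inclUnits F F₂).range →
    χ (torus b y) = -(θ y : C) - (θ y : C) ^ Nat.card F)

variable (l : ℕ) [Fact l.Prime] (k : Type u) [Field k] [CharP k l]

/-- An algebraic closure `K` of the field of fractions of `W(k)`. -/
abbrev BigField : Type u := AlgebraicClosure (FractionRing (WittVector l k))

/-- The ring of integers `𝒪` of `K`. -/
abbrev BigInt : Subalgebra (WittVector l k) (BigField l k) :=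
  integralClosure (WittVector l k) (BigField l k)

variable {l k}

/-- The set `S_θ` of characters `θt : 𝔽_{q²}ˣ → Kˣ` with `θt ^ q ≠ θt` whose reduction is `θ`.
Here `red : 𝒪 → k̄` is the reduction map. -/
def CharLifts (F : Type v) {F₂ : Type w} [Field F₂]
    (red : BigInt l k →+* AlgebraicClosure k) (θ : F₂ˣ →* kˣ) :
    Set (F₂ˣ →* (BigField l k)ˣ) :=
  {θt | θt ^ Nat.card F ≠ θt ∧ ∀ y : F₂ˣ, ∃ a : BigInt l k,
    (a : BigField l k) = (θt y : BigField l k) ∧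
      red a = algebraMap k (AlgebraicClosure k) (θ y : k)}

/-- `π` is a model over `k` of the cuspidal representation `π_θ`: for some `θt ∈ S_θ` the
`K`-representation `π_θt` has a stable `𝒪`-lattice whose reduction is isomorphic to `π` over `k̄`.
(A representation over `K` is determined by its character.) -/
def IsCuspidalModel (b : Module.Basis (Fin 2) F F₂)
    (red : BigInt l k →+* AlgebraicClosure k) (θ : F₂ˣ →* kˣ)
    (π : GL (Fin 2) F →* GL (Fin (Nat.card F - 1)) k) : Prop :=
  ∃ θt ∈ CharLifts F red θ, ∃ L : GL (Fin 2) F →* GL (Fin (Nat.card F - 1)) (BigInt l k),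
    IsCuspidalCharacter b θt
      (fun g => ((tr (L g) : BigInt l k) : BigField l k)) ∧
    ∃ P : GL (Fin (Nat.card F - 1)) (AlgebraicClosure k), ∀ g,
      Matrix.GeneralLinearGroup.map red (L g) =
        P * Matrix.GeneralLinearGroup.map (algebraMap k (AlgebraicClosure k)) (π g) * P⁻¹

end Cuspidal

end CuspidalDeformation

end

/-! Let `H` be the largest `l`-quotient of `E = F₂ˣ` and `R = W(k)[H]`. A deformation of `θ` must be
the Teichmüller lift on the prime-to-`l` part of `E`, so `R` carries the universal deformation of
`θ`: the Teichmüller lift twisted by the tautological character `E → H` (`univChar`). The point is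
that the same `R` carries the universal deformation of `π_θ`. The `K`-points of `R` are exactly the
characters in `S_θ`, and orthogonality of characters embeds `R` in the product; both maps of the
theorem become this one embedding.

The representation over `R` is explicit. If `q` is a unit and the sums of `χ` over the norm fibres
vanish, then `G` acts on functions on `F` with sum zero by the matrices `kernel χ g`. Composing two
kernels means counting solutions of a Hermitian equation in one variable (`card_hermitian`). The
count is a function of the norm, killed by the hypothesis on `χ`, plus the two terms that make up
the kernel of the product (`kernel_mul`). Traces give the cuspidal character
(`isCuspidalCharacter_cuspRep`). On the affine group `x ↦ a x + b` the action is the permutation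
action, independent of `χ`. Its commutant consists of scalars and its matrices separate matrices
under the trace pairing (`eq_smul_of_commute_affRep`, `eq_zero_of_trace_affRep`), over any ring in
which `q` is invertible, even if `l` divides `q - 1`.

Let `ϖ` be this representation over `R`, and `ρ` a lift of its reduction to `A`. Averaging a
rank-one map over `G` gives an intertwiner `transfer` from `ϖ` to `ρ`. For `ρ = ϖ` it is
multiplication by `m = |G| / ((q - 1) |H|) = q |ker p|`, a unit of `W(k)` (`transfer_self`). Hence
for every lift the transfer at `1` is invertible; conjugation by it makes `ρ` agree with `ϖ` on the
affine group, and Schur's lemma writes the transfer at `r` as `c r` times the transfer at `1`.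
Equivariance makes `c` multiplicative against matrix entries of `ϖ`. Since the traces of `ϖ`
generate `R` (`eq_top_of_trace_mem`), `c` is a ring homomorphism, and it induces `ρ`
(`exists_algHom_conj`). It is unique because the traces generate.

Two comparisons remain. The representation `π` has the character of the reduction of `ϖ`, so it is
conjugate to it (`exists_conj_of_tr_eq`). A universal deformation is tested on Artinian rings only,
while `R` represents the functor on all local coefficient rings; `bijective_of_forall_artinian`
identifies the two. -/

noncomputable section

namespace CuspidalDeformation

/-! ### Quadratic extensions of finite fields -/

section Quadratic

set_option linter.unusedSectionVars false

variable {F : Type v} [Field F] [Finite F] {F₂ : Type w} [Field F₂] [Finite F₂] [Algebra F F₂]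

variable (F F₂) in
/-- The `q`-power automorphism of an extension of `𝔽_q`. -/
def conj : F₂ ≃ₐ[F] F₂ :=
  letI := Fintype.ofFinite F
  FiniteField.frobeniusAlgEquivOfAlgebraic F F₂

lemma conj_apply (s : F₂) : conj F F₂ s = s ^ Nat.card F := by
  let := Fintype.ofFinite F
  rw [Nat.card_eq_fintype_card]
  rfl

lemma algebraMap_trace (h2 : Module.finrank F F₂ = 2) (s : F₂) :
    algebraMap F F₂ (Algebra.trace F F₂ s) = s + conj F F₂ s := by
  rw [FiniteField.algebraMap_trace_eq_sum_pow, h2, conj_apply]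
  simp [Finset.sum_range_succ]

lemma algebraMap_norm (h2 : Module.finrank F F₂ = 2) (s : F₂) :
    algebraMap F F₂ (Algebra.norm F s) = s * conj F F₂ s := by
  rw [FiniteField.algebraMap_norm_eq_prod_pow, h2, conj_apply]
  simp [Finset.prod_range_succ]

lemma conj_conj (h2 : Module.finrank F F₂ = 2) (s : F₂) : conj F F₂ (conj F F₂ s) = s := by
  have h := (conj F F₂).commutes (Algebra.trace F F₂ s)
  rw [algebraMap_trace h2, map_add, add_comm s] at h
  exact add_left_cancel h

lemma trace_conj (h2 : Module.finrank F F₂ = 2) (s : F₂) :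
    Algebra.trace F F₂ (conj F F₂ s) = Algebra.trace F F₂ s := by
  apply (algebraMap F F₂).injective
  rw [algebraMap_trace h2, algebraMap_trace h2, conj_conj h2, add_comm]

lemma norm_conj (h2 : Module.finrank F F₂ = 2) (s : F₂) :
    Algebra.norm F (conj F F₂ s) = Algebra.norm F s := by
  apply (algebraMap F F₂).injective
  rw [algebraMap_norm h2, algebraMap_norm h2, conj_conj h2, mul_comm]

lemma norm_add (h2 : Module.finrank F F₂ = 2) (s t : F₂) :
    Algebra.norm F (s + t) = Algebra.norm F s + Algebra.trace F F₂ (s * conj F F₂ t) +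
      Algebra.norm F t := by
  apply (algebraMap F F₂).injective
  rw [map_add (algebraMap F F₂), map_add (algebraMap F F₂), algebraMap_norm h2,
    algebraMap_norm h2, algebraMap_norm h2, algebraMap_trace h2, map_add, map_mul, conj_conj h2]
  ring

lemma norm_algebraMap_quadratic (h2 : Module.finrank F F₂ = 2) (a : F) :
    Algebra.norm F (algebraMap F F₂ a) = a ^ 2 := by
  rw [Algebra.norm_algebraMap, h2]

lemma trace_algebraMap_mul (a : F) (s : F₂) :
    Algebra.trace F F₂ (algebraMap F F₂ a * s) = a * Algebra.trace F F₂ s := by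
  rw [← Algebra.smul_def, map_smul, smul_eq_mul]

lemma norm_sub_algebraMap (h2 : Module.finrank F F₂ = 2) (s : F₂) (a : F) :
    Algebra.norm F (s - algebraMap F F₂ a) =
      Algebra.norm F s - a * Algebra.trace F F₂ s + a ^ 2 := by
  rw [sub_eq_add_neg, ← map_neg, norm_add h2, AlgEquiv.commutes, mul_comm s,
    trace_algebraMap_mul, norm_algebraMap_quadratic h2]
  ring

lemma card_quadratic (h2 : Module.finrank F F₂ = 2) : Nat.card F₂ = Nat.card F ^ 2 := by
  rw [Module.natCard_eq_pow_finrank (K := F), h2]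

variable [Fintype F] [Fintype F₂] [DecidableEq F] [DecidableEq F₂]

lemma card_trace_fiber (h2 : Module.finrank F F₂ = 2) (c : F) :
    (Finset.univ.filter fun s : F₂ => Algebra.trace F F₂ s = c).card = Nat.card F := by
  have hsurj := Algebra.trace_surjective F F₂
  have h : ∀ c, (Finset.univ.filter fun s : F₂ => Algebra.trace F F₂ s = c).card =
      (Finset.univ.filter fun s : F₂ => Algebra.trace F F₂ s = 0).card := by
    intro c
    obtain ⟨t, ht⟩ := hsurj c
    refine (Finset.card_bij (fun s _ => s + t) ?_ ?_ ?_).symm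
    · simp +contextual [ht]
    · simp
    · intro s hs
      refine ⟨s - t, ?_, by simp⟩
      simpa [ht, sub_eq_zero] using hs
  have hs := Finset.card_eq_sum_card_fiberwise (f := fun s : F₂ => Algebra.trace F F₂ s)
    (s := Finset.univ) (t := Finset.univ) (by simp [Set.MapsTo])
  simp only [h, Finset.sum_const, Finset.card_univ, smul_eq_mul, ← Nat.card_eq_fintype_card,
    card_quadratic h2] at hs
  rw [h c]
  have hq : 0 < Nat.card F := Nat.card_pos
  nlinarith

lemma card_norm_fiber (h2 : Module.finrank F F₂ = 2) {c : F} (hc : c ≠ 0) :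
    (Finset.univ.filter fun s : F₂ => Algebra.norm F s = c).card = Nat.card F + 1 := by
  have hsurj := FiniteField.norm_surjective F F₂
  have h : ∀ c, c ≠ 0 → (Finset.univ.filter fun s : F₂ => Algebra.norm F s = c).card =
      (Finset.univ.filter fun s : F₂ => Algebra.norm F s = 1).card := by
    intro c hc
    obtain ⟨t, ht⟩ := hsurj c
    have ht0 : t ≠ 0 := by rintro rfl; exact hc (by simpa [Algebra.norm_zero] using ht.symm)
    refine (Finset.card_bij (fun s _ => s * t) ?_ ?_ ?_).symm
    · simp +contextual [ht]
    · simp [ht0]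
    · intro s hs
      have e : s / t * t = s := div_mul_cancel₀ s ht0
      refine ⟨s / t, ?_, e⟩
      simp only [Finset.mem_filter, Finset.mem_univ, true_and] at hs ⊢
      apply mul_right_cancel₀ hc
      rw [one_mul, ← hs]
      conv_lhs => rw [hs, ← ht]
      rw [← map_mul (Algebra.norm F), e]
  have h0 : (Finset.univ.filter fun s : F₂ => Algebra.norm F s = 0).card = 1 := by
    simp [Algebra.norm_eq_zero_iff, Finset.filter_eq']
  have hs := Finset.card_eq_sum_card_fiberwise (f := fun s : F₂ => Algebra.norm F s)
    (s := Finset.univ) (t := Finset.univ) (by simp [Set.MapsTo])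
  rw [← Finset.add_sum_erase _ _ (Finset.mem_univ (0 : F)), h0,
    Finset.sum_congr rfl (fun c hc => h c (Finset.ne_of_mem_erase hc))] at hs
  simp only [Finset.sum_const, Finset.card_univ, smul_eq_mul, Finset.card_erase_of_mem,
    Finset.mem_univ, ← Nat.card_eq_fintype_card, card_quadratic h2] at hs
  rw [h c hc]
  -- With `q = m + 2` the count `1 + (q - 1) n = q ^ 2` is free of truncated subtraction.
  obtain ⟨m, hm⟩ : ∃ m, Nat.card F = m + 2 :=
    ⟨Nat.card F - 2, by have := Finite.one_lt_card (α := F); omega⟩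
  rw [hm] at hs ⊢
  simp only [show m + 2 - 1 = m + 1 by omega] at hs
  nlinarith

/-- The number of solutions of a Hermitian quadratic equation in one variable. -/
lemma card_hermitian (h2 : Module.finrank F F₂ = 2) (α γ : F) (β : F₂) :
    ((Finset.univ.filter fun s : F₂ => α * Algebra.norm F s +
      Algebra.trace F F₂ (s * conj F F₂ β) + γ = 0).card : ℤ) =
    Nat.card F + (if α = 0 then 0 else 1) -
      Nat.card F * (if Algebra.norm F β = α * γ then 1 else 0) +
      Nat.card F ^ 2 * (if α = 0 ∧ β = 0 ∧ γ = 0 then 1 else 0) := by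
  by_cases hα : α = 0
  · subst hα
    simp only [zero_mul, zero_add, if_true, add_zero, Algebra.norm_eq_zero_iff, true_and]
    by_cases hβ : β = 0
    · subst hβ
      by_cases hγ : γ = 0
      · simp [hγ, ← Nat.card_eq_fintype_card, card_quadratic h2]
      · simp [hγ]
    · have hβ' : conj F F₂ β ≠ 0 := by simpa using hβ
      simp only [hβ, if_false, false_and, mul_zero, sub_zero, add_zero, Nat.cast_inj]
      rw [← card_trace_fiber h2 (-γ)]
      refine Finset.card_bij (fun s _ => s * conj F F₂ β) ?_ ?_ ?_
      · simp [eq_neg_iff_add_eq_zero]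
      · simp [hβ]
      · intro s hs
        have e : s / conj F F₂ β * conj F F₂ β = s := div_mul_cancel₀ s hβ'
        refine ⟨s / conj F F₂ β, ?_, e⟩
        simp only [Finset.mem_filter, Finset.mem_univ, true_and] at hs ⊢
        rw [e, hs, neg_add_cancel]
  · have hα' : algebraMap F F₂ α ≠ 0 := by simpa using hα
    -- Complete the square: multiply by `α` and expand the norm of `α s + β`.
    have key : ∀ s : F₂, α * Algebra.norm F s + Algebra.trace F F₂ (s * conj F F₂ β) + γ = 0 ↔
        Algebra.norm F (algebraMap F F₂ α * s + β) = Algebra.norm F β - α * γ := by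
      intro s
      rw [norm_add h2, map_mul (Algebra.norm F), norm_algebraMap_quadratic h2, mul_assoc,
        trace_algebraMap_mul]
      constructor
      · intro h; linear_combination α * h
      · intro h; apply mul_left_cancel₀ hα; linear_combination h
    have hcard : (Finset.univ.filter fun s : F₂ => α * Algebra.norm F s +
        Algebra.trace F F₂ (s * conj F F₂ β) + γ = 0).card =
        (Finset.univ.filter fun s : F₂ => Algebra.norm F s = Algebra.norm F β - α * γ).card := by
      refine Finset.card_bij (fun s _ => algebraMap F F₂ α * s + β) ?_ ?_ ?_
      · intro s hs
        simpa [key] using hs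
      · simp [hα]
      · intro s hs
        have e : algebraMap F F₂ α * ((s - β) / algebraMap F F₂ α) + β = s := by
          rw [mul_div_cancel₀ _ hα']; ring
        refine ⟨(s - β) / algebraMap F F₂ α, ?_, e⟩
        simp only [Finset.mem_filter, Finset.mem_univ, true_and] at hs ⊢
        rw [key, e, hs]
    rw [hcard]
    by_cases hN : Algebra.norm F β = α * γ
    · simp [hN, hα, Algebra.norm_eq_zero_iff, Finset.filter_eq']
    · rw [card_norm_fiber h2 (sub_ne_zero.2 hN)]
      simp [hN, hα]

end Quadratic

/-! ### The kernels of the cuspidal representations -/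

section Kernel

set_option linter.unusedSectionVars false

variable {F : Type v} [Field F] [Fintype F] [DecidableEq F]
variable {F₂ : Type w} [Field F₂] [Fintype F₂] [DecidableEq F₂] [Algebra F F₂]
variable {A : Type x} [CommRing A]

/-- A multiplicative character of a finite extension is in general position if its sums over the
fibres of the norm vanish. -/
def GeneralPosition (F : Type v) [Field F] {F₂ : Type w} [Field F₂] [Fintype F₂] [Algebra F F₂]
    {A : Type x} [CommRing A] (χ : MulChar F₂ A) : Prop :=
  ∀ c : F → A, ∑ s : F₂, c (Algebra.norm F s) * χ s = 0

/-- Multiplication by `s₀` permutes each norm fibre and scales the sum by `χ s₀`, so the unit `χ s₀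
- 1` annihilates it. -/
lemma generalPosition_of_isUnit {χ : MulChar F₂ A} {s₀ : F₂} (h₀ : Algebra.norm F s₀ = 1)
    (hu : IsUnit (χ s₀ - 1)) : GeneralPosition F χ := by
  intro c
  have hs₀ : s₀ ≠ 0 := by rintro rfl; simp [Algebra.norm_zero] at h₀
  have h : ∑ s : F₂, c (Algebra.norm F s) * χ s =
      χ s₀ * ∑ s : F₂, c (Algebra.norm F s) * χ s := by
    rw [Finset.mul_sum]
    refine (Fintype.sum_equiv (Equiv.mulLeft₀ s₀ hs₀) _ _ fun s => ?_).symm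
    rw [show Equiv.mulLeft₀ s₀ hs₀ s = s₀ * s from rfl, map_mul (Algebra.norm F), h₀, one_mul,
      map_mul]
    ring
  rw [← hu.mul_right_eq_zero, sub_mul, one_mul, ← h, sub_self]

/-- The incidence relation between `x`, `y` and `s` that defines the kernel at `g`. -/
def kernelRel (g : Matrix (Fin 2) (Fin 2) F) (x y : F) (s : F₂) : Prop :=
  Algebra.norm F s * (g 0 0 - g 1 0 * x) +
    g.det * (g 1 0 * y + g 1 1 - Algebra.trace F F₂ s) = 0

instance (g : Matrix (Fin 2) (Fin 2) F) (x y : F) (s : F₂) : Decidable (kernelRel g x y s) := by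
  unfold kernelRel; infer_instance

/-- The kernel by which `g` acts on functions on `𝔽_q` with sum zero, in the cuspidal
representation attached to `χ`. -/
def kernel (χ : MulChar F₂ A) (g : Matrix (Fin 2) (Fin 2) F) : Matrix F F A := fun x y =>
  ∑ s : F₂, χ s *
    ((if g 1 0 = 0 ∧ s = algebraMap F F₂ (g 1 1) ∧ g 1 1 * x = g 0 0 * y + g 0 1 then 1 else 0) -
      Ring.inverse (Nat.card F : A) * (if kernelRel g x y s then 1 else 0))

/-- For upper triangular `g` the defining expression is `g 0 0` times the norm of `s - g 1 1`, and
the norm vanishes only at `0`. -/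
lemma kernelRel_of_eq_zero (h2 : Module.finrank F F₂ = 2) {g : Matrix (Fin 2) (Fin 2) F}
    (hg : g.det ≠ 0) (hc : g 1 0 = 0) (x y : F) (s : F₂) :
    kernelRel g x y s ↔ s = algebraMap F F₂ (g 1 1) := by
  have hd : g.det = g 0 0 * g 1 1 := by rw [Matrix.det_fin_two, hc]; ring
  have ha : g 0 0 ≠ 0 := fun h => hg (by rw [hd, h, zero_mul])
  rw [← sub_eq_zero (a := s), ← Algebra.norm_eq_zero_iff (R := F), norm_sub_algebraMap h2,
    kernelRel, hd, hc]
  constructor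
  · intro h
    apply mul_left_cancel₀ ha
    linear_combination h
  · intro h
    linear_combination g 0 0 * h

lemma kernel_of_eq_zero (h2 : Module.finrank F F₂ = 2) (χ : MulChar F₂ A)
    {g : Matrix (Fin 2) (Fin 2) F} (hg : g.det ≠ 0) (hc : g 1 0 = 0) (x y : F) :
    kernel χ g x y = χ (algebraMap F F₂ (g 1 1)) *
      ((if g 1 1 * x = g 0 0 * y + g 0 1 then 1 else 0) - Ring.inverse (Nat.card F : A)) := by
  rw [kernel, Finset.sum_eq_single (algebraMap F F₂ (g 1 1))]
  · simp [kernelRel_of_eq_zero h2 hg hc, hc]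
  · intro s _ hs
    simp [kernelRel_of_eq_zero h2 hg hc, hs]
  · simp

lemma kernel_of_ne_zero (χ : MulChar F₂ A)
    {g : Matrix (Fin 2) (Fin 2) F} (hc : g 1 0 ≠ 0) (x y : F) :
    kernel χ g x y = -Ring.inverse (Nat.card F : A) *
      ∑ s : F₂, if kernelRel g x y s then χ s else 0 := by
  rw [kernel, Finset.mul_sum]
  refine Finset.sum_congr rfl fun s _ => ?_
  simp only [hc, false_and, if_false]
  split_ifs <;> ring

/-- This says that kernels have image in the functions with sum zero. Off the Borel subgroup every
non-zero `s` is related to exactly one `x`, which leaves the full sum of `χ`. -/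
lemma sum_kernel_col (h2 : Module.finrank F F₂ = 2) (hq : IsUnit (Nat.card F : A))
    {χ : MulChar F₂ A} (hχ : GeneralPosition F χ)
    {g : Matrix (Fin 2) (Fin 2) F} (hg : g.det ≠ 0) (y : F) : ∑ x, kernel χ g x y = 0 := by
  by_cases hc : g 1 0 = 0
  · have hd : g 1 1 ≠ 0 := fun h => hg (by rw [Matrix.det_fin_two, hc, h]; ring)
    have : ∀ x, g 1 1 * x = g 0 0 * y + g 0 1 ↔ x = (g 0 0 * y + g 0 1) / g 1 1 := fun x => by
      rw [eq_div_iff hd, mul_comm]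
    simp only [kernel_of_eq_zero h2 χ hg hc, ← Finset.mul_sum, Finset.sum_sub_distrib, this]
    simp [← Nat.card_eq_fintype_card, Ring.mul_inverse_cancel _ hq]
  · simp only [kernel_of_ne_zero χ hc, ← Finset.mul_sum]
    rw [Finset.sum_comm]
    have key : ∀ s : F₂, χ s ≠ 0 → ∀ x, kernelRel g x y s ↔ x = (g 0 0 + g.det *
        (g 1 0 * y + g 1 1 - Algebra.trace F F₂ s) / Algebra.norm F s) / g 1 0 := by
      intro s hs x
      have hn : Algebra.norm F s ≠ 0 := by
        rw [Ne, Algebra.norm_eq_zero_iff]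
        rintro rfl
        exact hs (MulChar.map_zero χ)
      rw [kernelRel, eq_div_iff hc, ← sub_eq_zero (b := _ + _)]
      constructor
      · intro h
        field_simp
        linear_combination -h
      · intro h
        field_simp at h
        linear_combination -h
    have : ∀ s : F₂, (∑ x, if kernelRel g x y s then χ s else 0) = 1 * χ s := by
      intro s
      by_cases hs : χ s = 0
      · simp [hs]
      · simp [key s hs]
    rw [Finset.sum_congr rfl fun s _ => this s, hχ fun _ => 1, mul_zero]

lemma kernelRel_iff_right {g : Matrix (Fin 2) (Fin 2) F} (hg : g.det ≠ 0) (hc : g 1 0 ≠ 0)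
    (x y : F) (s : F₂) :
    kernelRel g x y s ↔ y = (Algebra.trace F F₂ s - g 1 1 -
      Algebra.norm F s * (g 0 0 - g 1 0 * x) / g.det) / g 1 0 := by
  rw [kernelRel, eq_div_iff hc, ← sub_eq_zero (b := _ - _)]
  constructor
  · intro h
    field_simp
    linear_combination h
  · intro h
    field_simp at h
    linear_combination h

/-- Dually, kernels annihilate constant functions: off the Borel subgroup `x` and `s` determine `y`.
-/
lemma sum_kernel_row (h2 : Module.finrank F F₂ = 2) (hq : IsUnit (Nat.card F : A))
    {χ : MulChar F₂ A} (hχ : GeneralPosition F χ)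
    {g : Matrix (Fin 2) (Fin 2) F} (hg : g.det ≠ 0) (x : F) : ∑ y, kernel χ g x y = 0 := by
  by_cases hc : g 1 0 = 0
  · have hd : g 0 0 ≠ 0 := fun h => hg (by rw [Matrix.det_fin_two, hc, h]; ring)
    have : ∀ y, g 1 1 * x = g 0 0 * y + g 0 1 ↔ y = (g 1 1 * x - g 0 1) / g 0 0 := fun x => by
      rw [eq_div_iff hd, eq_sub_iff_add_eq, mul_comm x, eq_comm]
    simp only [kernel_of_eq_zero h2 χ hg hc, ← Finset.mul_sum, Finset.sum_sub_distrib, this]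
    simp [← Nat.card_eq_fintype_card, Ring.mul_inverse_cancel _ hq]
  · simp only [kernel_of_ne_zero χ hc, ← Finset.mul_sum]
    rw [Finset.sum_comm]
    have : ∀ s : F₂, (∑ y, if kernelRel g x y s then χ s else 0) = 1 * χ s := by
      intro s
      simp [kernelRel_iff_right hg hc]
    rw [Finset.sum_congr rfl fun s _ => this s, hχ fun _ => 1, mul_zero]

/-- Traces of the kernels outside the Borel subgroup. -/
lemma trace_kernel (hq : IsUnit (Nat.card F : A))
    {χ : MulChar F₂ A} (hχ : GeneralPosition F χ)
    {g : Matrix (Fin 2) (Fin 2) F} (hg : g.det ≠ 0) (hc : g 1 0 ≠ 0) :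
    (kernel χ g).trace =
      -∑ s : F₂, if Algebra.trace F F₂ s = g.trace ∧ Algebra.norm F s = g.det then χ s else 0 := by
  -- On the diagonal the relation is linear in `x` with leading coefficient `g 1 0 * (det g - N s)`.
  -- If `N s ≠ det g` there is one solution, and these terms die in general position. If `N s = det
  -- g` the variable `x` drops out and the condition is on the trace of `s`.
  have hcount : ∀ s : F₂, (∑ x, if kernelRel g x x s then χ s else 0) =
      (if Algebra.norm F s = g.det then 0 else 1) * χ s + Nat.card F *
        (if Algebra.trace F F₂ s = g.trace ∧ Algebra.norm F s = g.det then χ s else 0) := by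
    intro s
    by_cases hn : Algebra.norm F s = g.det
    · have : ∀ x, kernelRel g x x s ↔ Algebra.trace F F₂ s = g.trace := by
        intro x
        rw [kernelRel, hn, Matrix.trace_fin_two]
        constructor
        · intro h
          apply mul_left_cancel₀ hg
          linear_combination -h
        · intro h
          rw [h]; ring
      simp [this, hn, ← Nat.card_eq_fintype_card]
    · have hn' : g.det - Algebra.norm F s ≠ 0 := sub_ne_zero.2 (Ne.symm hn)
      have : ∀ x, kernelRel g x x s ↔ x = -(Algebra.norm F s * g 0 0 +
          g.det * (g 1 1 - Algebra.trace F F₂ s)) / (g 1 0 * (g.det - Algebra.norm F s)) := by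
        intro x
        rw [kernelRel, eq_div_iff (mul_ne_zero hc hn'), eq_neg_iff_add_eq_zero]
        constructor <;> intro h <;> linear_combination h
      simp [this, hn]
  rw [Matrix.trace]
  simp only [Matrix.diag_apply, kernel_of_ne_zero χ hc, ← Finset.mul_sum]
  rw [Finset.sum_comm, Finset.sum_congr rfl fun s _ => hcount s, Finset.sum_add_distrib,
    hχ fun n => if n = g.det then 0 else 1, zero_add, ← Finset.mul_sum, ← mul_assoc, neg_mul,
    Ring.inverse_mul_cancel _ hq, neg_one_mul]

end Kernel

/-! ### Multiplicativity of the kernels -/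

section KernelMul

set_option linter.unusedSectionVars false

variable {F : Type v} [Field F] [Fintype F] [DecidableEq F]
variable {F₂ : Type w} [Field F₂] [Fintype F₂] [DecidableEq F₂] [Algebra F F₂]
variable {A : Type x} [CommRing A]

lemma kernelRel_mul_of_left_eq_zero (h2 : Module.finrank F F₂ = 2)
    {g h : Matrix (Fin 2) (Fin 2) F} (hg : g.det ≠ 0) (hc : g 1 0 = 0) {x y z : F}
    (hxy : g 1 1 * x = g 0 0 * y + g 0 1) (s : F₂) :
    kernelRel (g * h) x z (algebraMap F F₂ (g 1 1) * s) ↔ kernelRel h y z s := by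
  have hd : g 1 1 ≠ 0 := fun h => hg (by rw [Matrix.det_fin_two, hc, h]; ring)
  rw [kernelRel, kernelRel, map_mul (Algebra.norm F), trace_algebraMap_mul,
    norm_algebraMap_quadratic h2, Matrix.det_mul, Matrix.det_fin_two g]
  simp only [Matrix.mul_apply, Fin.sum_univ_two, hc]
  have ha : g 0 0 ≠ 0 := fun h => hg (by rw [Matrix.det_fin_two, hc, h]; ring)
  constructor
  · intro e
    apply mul_left_cancel₀ (mul_ne_zero ha (pow_ne_zero 2 hd))
    linear_combination e + g 1 1 ^ 2 * Algebra.norm F s * h 1 0 * hxy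
  · intro e
    linear_combination g 0 0 * g 1 1 ^ 2 * e - g 1 1 ^ 2 * Algebra.norm F s * h 1 0 * hxy

lemma kernelRel_mul_of_right_eq_zero (h2 : Module.finrank F F₂ = 2)
    {g h : Matrix (Fin 2) (Fin 2) F} (hh : h.det ≠ 0) (hc : h 1 0 = 0) {x y z : F}
    (hxy : h 1 1 * y = h 0 0 * z + h 0 1) (s : F₂) :
    kernelRel (g * h) x z (algebraMap F F₂ (h 1 1) * s) ↔ kernelRel g x y s := by
  have hd : h 1 1 ≠ 0 := fun e => hh (by rw [Matrix.det_fin_two, hc, e]; ring)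
  rw [kernelRel, kernelRel, map_mul (Algebra.norm F), trace_algebraMap_mul,
    norm_algebraMap_quadratic h2, Matrix.det_mul, Matrix.det_fin_two h]
  simp only [Matrix.mul_apply, Fin.sum_univ_two, hc]
  have ha : h 0 0 ≠ 0 := fun e => hh (by rw [Matrix.det_fin_two, hc, e]; ring)
  constructor
  · intro e
    apply mul_left_cancel₀ (mul_ne_zero ha (pow_ne_zero 2 hd))
    linear_combination e + g.det * h 0 0 * h 1 1 * g 1 0 * hxy
  · intro e
    linear_combination h 0 0 * h 1 1 ^ 2 * e - g.det * h 0 0 * h 1 1 * g 1 0 * hxy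

/-- Kernels are covariant under the Borel subgroup. -/
lemma kernel_mul_apply_of_left_eq_zero (h2 : Module.finrank F F₂ = 2) (χ : MulChar F₂ A)
    {g h : Matrix (Fin 2) (Fin 2) F} (hg : g.det ≠ 0) (hc : g 1 0 = 0) {x y z : F}
    (hxy : g 1 1 * x = g 0 0 * y + g 0 1) :
    kernel χ (g * h) x z = χ (algebraMap F F₂ (g 1 1)) * kernel χ h y z := by
  have hd : g 1 1 ≠ 0 := fun h => hg (by rw [Matrix.det_fin_two, hc, h]; ring)
  have ha : g 0 0 ≠ 0 := fun h => hg (by rw [Matrix.det_fin_two, hc, h]; ring)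
  have hd' : algebraMap F F₂ (g 1 1) ≠ 0 := by simpa using hd
  rw [kernel, kernel, Finset.mul_sum]
  refine (Fintype.sum_equiv (Equiv.mulLeft₀ _ hd') _ _ fun s => ?_).symm
  rw [show Equiv.mulLeft₀ _ hd' s = algebraMap F F₂ (g 1 1) * s from rfl, map_mul, mul_assoc]
  simp only [kernelRel_mul_of_left_eq_zero h2 hg hc hxy]
  congr 3
  refine if_congr ?_ rfl rfl
  simp only [Matrix.mul_apply, Fin.sum_univ_two, hc, zero_mul, zero_add, mul_eq_zero, hd,
    false_or, map_mul, mul_right_inj' hd']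
  refine and_congr_right fun h0 => and_congr_right fun _ => ?_
  constructor
  · intro e
    linear_combination g 0 0 * e + h 1 1 * hxy - g 0 1 * z * h0
  · intro e
    apply mul_left_cancel₀ ha
    linear_combination e - h 1 1 * hxy + g 0 1 * z * h0

lemma kernel_mul_apply_of_right_eq_zero (h2 : Module.finrank F F₂ = 2) (χ : MulChar F₂ A)
    {g h : Matrix (Fin 2) (Fin 2) F} (hh : h.det ≠ 0) (hc : h 1 0 = 0) {x y z : F}
    (hxy : h 1 1 * y = h 0 0 * z + h 0 1) :
    kernel χ (g * h) x z = kernel χ g x y * χ (algebraMap F F₂ (h 1 1)) := by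
  have hd : h 1 1 ≠ 0 := fun e => hh (by rw [Matrix.det_fin_two, hc, e]; ring)
  have ha : h 0 0 ≠ 0 := fun e => hh (by rw [Matrix.det_fin_two, hc, e]; ring)
  have hd' : algebraMap F F₂ (h 1 1) ≠ 0 := by simpa using hd
  rw [kernel, kernel, Finset.sum_mul]
  refine (Fintype.sum_equiv (Equiv.mulLeft₀ _ hd') _ _ fun s => ?_).symm
  rw [show Equiv.mulLeft₀ _ hd' s = algebraMap F F₂ (h 1 1) * s from rfl, map_mul, mul_right_comm,
    mul_comm (χ (algebraMap F F₂ (h 1 1)))]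
  simp only [kernelRel_mul_of_right_eq_zero h2 hh hc hxy]
  congr 2
  refine if_congr ?_ rfl rfl
  simp only [Matrix.mul_apply, Fin.sum_univ_two, hc, mul_zero, add_zero, mul_eq_zero, ha,
    or_false]
  refine and_congr_right fun h0 => ?_
  rw [h0, zero_mul, zero_add, mul_comm (g 1 1) (h 1 1), map_mul, mul_right_inj' hd']
  refine and_congr_right fun _ => ?_
  constructor
  · intro e
    linear_combination h 1 1 * e + g 0 0 * hxy
  · intro e
    apply mul_left_cancel₀ hd
    linear_combination e - g 0 0 * hxy

/-- The composition of two kernel relations in terms of a Hermitian quadratic equation. -/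
lemma kernelRel_comp (h2 : Module.finrank F F₂ = 2) {g h : Matrix (Fin 2) (Fin 2) F}
    (hg : g.det ≠ 0) (hcg : g 1 0 ≠ 0) (x z : F) (r : F₂) {s : F₂} (hs : s ≠ 0) :
    kernelRel h ((Algebra.trace F F₂ s - g 1 1 -
        Algebra.norm F s * (g 0 0 - g 1 0 * x) / g.det) / g 1 0) z (r / s) ↔
      (g.det * h.det * g 1 0 * (h 1 0 * z + h 1 1) +
        Algebra.norm F r * h 1 0 * (g 0 0 - g 1 0 * x)) * Algebra.norm F s +
      Algebra.trace F F₂ (s * conj F F₂ (algebraMap F F₂ (-(g.det * h.det * g 1 0)) * r +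
        algebraMap F F₂ (-(g.det * Algebra.norm F r * h 1 0)))) +
      Algebra.norm F r * g.det * (g * h) 1 0 = 0 := by
  have hn : Algebra.norm F s ≠ 0 := by rwa [Ne, Algebra.norm_eq_zero_iff]
  have e1 : Algebra.norm F (r / s) * Algebra.norm F s = Algebra.norm F r := by
    rw [← map_mul (Algebra.norm F), div_mul_cancel₀ r hs]
  -- Since `N s = s * conj s`, the product `N s * (r / s)` is `conj s * r`, which has the trace of
  -- `s * conj r`.
  have e2 : Algebra.trace F F₂ (r / s) * Algebra.norm F s =
      Algebra.trace F F₂ (s * conj F F₂ r) := by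
    rw [mul_comm, ← trace_algebraMap_mul, algebraMap_norm h2, ← trace_conj h2]
    congr 1
    rw [map_mul, map_mul, conj_conj h2, map_div₀]
    have : conj F F₂ s ≠ 0 := by simpa using hs
    field_simp
  have e3 : Algebra.trace F F₂ (s * conj F F₂ (algebraMap F F₂ (-(g.det * h.det * g 1 0)) * r +
        algebraMap F F₂ (-(g.det * Algebra.norm F r * h 1 0)))) =
      -(g.det * h.det * g 1 0) * Algebra.trace F F₂ (s * conj F F₂ r) -
        (g.det * Algebra.norm F r * h 1 0) * Algebra.trace F F₂ s := by
    rw [map_add (conj F F₂), map_mul (conj F F₂), AlgEquiv.commutes, AlgEquiv.commutes, mul_add,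
      map_add (Algebra.trace F F₂), mul_left_comm, trace_algebraMap_mul, mul_comm s (algebraMap F F₂ _), trace_algebraMap_mul]
    ring
  rw [e3, kernelRel]
  simp only [Matrix.mul_apply, Fin.sum_univ_two]
  rw [← e1, ← e2]
  generalize Algebra.norm F (r / s) = n at *
  generalize Algebra.trace F F₂ (r / s) = t at *
  -- The two equations differ by the non-zero factor `N s * det g * g 1 0`.
  rw [← mul_eq_zero_iff_right (mul_ne_zero (mul_ne_zero hn hg) hcg)]
  refine Eq.congr_left ?_
  field_simp
  ring

/-- The discriminant of the quadratic equation of `kernelRel_comp`. -/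
lemma kernelRel_mul_iff (h2 : Module.finrank F F₂ = 2) {g h : Matrix (Fin 2) (Fin 2) F}
    (hg : g.det ≠ 0) (hcg : g 1 0 ≠ 0) (hch : h 1 0 ≠ 0) (x z : F) {r : F₂} (hr : r ≠ 0) :
    Algebra.norm F (algebraMap F F₂ (-(g.det * h.det * g 1 0)) * r +
        algebraMap F F₂ (-(g.det * Algebra.norm F r * h 1 0))) =
      (g.det * h.det * g 1 0 * (h 1 0 * z + h 1 1) +
        Algebra.norm F r * h 1 0 * (g 0 0 - g 1 0 * x)) *
        (Algebra.norm F r * g.det * (g * h) 1 0) ↔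
      kernelRel (g * h) x z r := by
  have hn : Algebra.norm F r ≠ 0 := by rwa [Ne, Algebra.norm_eq_zero_iff]
  rw [norm_add h2, map_mul (Algebra.norm F), norm_algebraMap_quadratic h2,
    norm_algebraMap_quadratic h2, AlgEquiv.commutes,
    mul_assoc (algebraMap F F₂ _) r, mul_comm r (algebraMap F F₂ _), trace_algebraMap_mul,
    trace_algebraMap_mul, kernelRel, Matrix.det_mul]
  -- The discriminant is minus this factor times the expression defining the relation at `g * h`.
  have ne : Algebra.norm F r * g.det * g 1 0 * h 1 0 ≠ 0 := by
    simp [hn, hg, hcg, hch]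
  have hdg := Matrix.det_fin_two g
  have hdh := Matrix.det_fin_two h
  simp only [Matrix.mul_apply, Fin.sum_univ_two]
  generalize Algebra.norm F r = n at *
  generalize Algebra.trace F F₂ r = t at *
  rw [← sub_eq_zero]
  constructor
  · intro e
    apply mul_left_cancel₀ ne
    rw [mul_zero, ← neg_eq_zero, ← e, hdg, hdh]
    ring
  · intro e
    rw [← mul_eq_zero_iff_left ne, hdg, hdh] at e
    rw [← neg_eq_zero, ← e, hdg, hdh]
    ring

end KernelMul

section KernelMul

set_option linter.unusedSectionVars false

variable {F : Type v} [Field F] [Fintype F] [DecidableEq F]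
variable {F₂ : Type w} [Field F₂] [Fintype F₂] [DecidableEq F₂] [Algebra F F₂]
variable {A : Type x} [CommRing A]

/-- The first relation is solved for `y`, and `r = s * t` collects the product of two character sums
into one. The terms with `s = 0` vanish with `χ 0`. -/
lemma sum_kernelRel_mul (χ : MulChar F₂ A) {g h : Matrix (Fin 2) (Fin 2) F} (hg : g.det ≠ 0)
    (hcg : g 1 0 ≠ 0) (x z : F) :
    ∑ y, (∑ s : F₂, if kernelRel g x y s then χ s else 0) *
      (∑ t : F₂, if kernelRel h y z t then χ t else 0) =
    ∑ r : F₂, ((Finset.univ.filter fun s : F₂ => s ≠ 0 ∧ kernelRel h ((Algebra.trace F F₂ s -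
      g 1 1 - Algebra.norm F s * (g 0 0 - g 1 0 * x) / g.det) / g 1 0) z (r / s)).card : A) *
        χ r := by
  simp only [Finset.sum_mul, kernelRel_iff_right hg hcg x]
  rw [Finset.sum_comm]
  simp only [ite_mul, zero_mul, Finset.sum_ite_eq', Finset.mem_univ, if_true]
  have key : ∀ s : F₂, ∀ f : F₂ → Prop, ∀ _ : DecidablePred f,
      χ s * (∑ t, if f t then χ t else 0) = ∑ r, if s ≠ 0 ∧ f (r / s) then χ r else 0 := by
    intro s f _
    by_cases hs : s = 0
    · subst hs; simp [MulChar.map_zero]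
    · rw [Finset.mul_sum]
      refine Fintype.sum_equiv (Equiv.mulLeft₀ s hs) _ _ fun t => ?_
      rw [show Equiv.mulLeft₀ s hs t = s * t from rfl, mul_div_cancel_left₀ t hs, map_mul]
      simp [hs]
  simp only [key]
  rw [Finset.sum_comm]
  refine Finset.sum_congr rfl fun r _ => ?_
  rw [← Finset.sum_filter, Finset.sum_const, nsmul_eq_mul]

/-- The function `c` of the norm collects everything that general position kills. The remaining
terms are those of the kernel at `g * h`, with weights `q ^ 2` and `-q`. -/
lemma card_kernelRel_mul (h2 : Module.finrank F F₂ = 2) {g h : Matrix (Fin 2) (Fin 2) F}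
    (hg : g.det ≠ 0) (hh : h.det ≠ 0) (hcg : g 1 0 ≠ 0) (hch : h 1 0 ≠ 0) (x z : F) :
    ∃ c : F → ℤ, ∀ r : F₂, r ≠ 0 →
      ((Finset.univ.filter fun s : F₂ => s ≠ 0 ∧ kernelRel h ((Algebra.trace F F₂ s -
        g 1 1 - Algebra.norm F s * (g 0 0 - g 1 0 * x) / g.det) / g 1 0) z (r / s)).card : ℤ) =
      c (Algebra.norm F r) + Nat.card F ^ 2 * (if (g * h) 1 0 = 0 ∧
        r = algebraMap F F₂ ((g * h) 1 1) ∧ (g * h) 1 1 * x = (g * h) 0 0 * z + (g * h) 0 1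
          then 1 else 0) - Nat.card F * (if kernelRel (g * h) x z r then 1 else 0) := by
  -- The coefficients `α` and `γ` of the Hermitian equation depend on `r` only through its norm. The
  -- last correction removes the solution `s = 0`, present exactly when `γ = 0`.
  refine ⟨fun n => Nat.card F + (if g.det * h.det * g 1 0 * (h 1 0 * z + h 1 1) +
      n * h 1 0 * (g 0 0 - g 1 0 * x) = 0 then 0 else 1) -
      (if n * g.det * (g * h) 1 0 = 0 then 1 else 0), fun r hr => ?_⟩
  have hn : Algebra.norm F r ≠ 0 := by rwa [Ne, Algebra.norm_eq_zero_iff]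
  set α := g.det * h.det * g 1 0 * (h 1 0 * z + h 1 1) +
    Algebra.norm F r * h 1 0 * (g 0 0 - g 1 0 * x) with hα
  set β := algebraMap F F₂ (-(g.det * h.det * g 1 0)) * r +
    algebraMap F F₂ (-(g.det * Algebra.norm F r * h 1 0)) with hβ
  set γ := Algebra.norm F r * g.det * (g * h) 1 0 with hγ
  have hcount := card_hermitian h2 α γ β
  have hdisc : Algebra.norm F β = α * γ ↔ kernelRel (g * h) x z r :=
    kernelRel_mul_iff h2 hg hcg hch x z hr
  have hdet : (g * h).det ≠ 0 := by rw [Matrix.det_mul]; exact mul_ne_zero hg hh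
  have hγ0 : γ = 0 ↔ (g * h) 1 0 = 0 := by simp [hγ, hn, hg]
  -- The equation degenerates completely exactly when the delta term of the kernel at `g * h` is
  -- present.
  have hdelta : (α = 0 ∧ β = 0 ∧ γ = 0) ↔ ((g * h) 1 0 = 0 ∧
      r = algebraMap F F₂ ((g * h) 1 1) ∧ (g * h) 1 1 * x = (g * h) 0 0 * z + (g * h) 0 1) := by
    rw [hγ0, ← and_assoc, and_comm]
    refine and_congr_right fun h0 => ?_
    have hβ0 : β = 0 ↔ r = algebraMap F F₂ ((g * h) 1 1) := by
      rw [← kernelRel_of_eq_zero h2 hdet h0 x z, ← hdisc, hγ0.2 h0, mul_zero,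
        Algebra.norm_eq_zero_iff]
    rw [hβ0, and_comm]
    refine and_congr_right fun hr' => ?_
    have hnr : Algebra.norm F r = ((g * h) 1 1) ^ 2 := by
      rw [hr', norm_algebraMap_quadratic h2]
    have hd : (g * h) 1 1 ≠ 0 := fun e => hdet (by rw [Matrix.det_fin_two, h0, e]; ring)
    have hdd : g.det * h.det = (g * h) 0 0 * (g * h) 1 1 := by
      rw [← Matrix.det_mul, Matrix.det_fin_two, h0]; ring
    rw [hα, hnr, hdd]
    have ne : (g * h) 1 1 * (g 1 0 * h 1 0) ≠ 0 := by simp [hd, hcg, hch]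
    have e : (g * h) 0 0 * (g * h) 1 1 * g 1 0 * (h 1 0 * z + h 1 1) +
        (g * h) 1 1 ^ 2 * h 1 0 * (g 0 0 - g 1 0 * x) = (g * h) 1 1 * (g 1 0 * h 1 0) *
          ((g * h) 0 0 * z + (g * h) 0 1 - (g * h) 1 1 * x) := by
      simp only [Matrix.mul_apply, Fin.sum_univ_two] at h0 ⊢
      linear_combination (g 1 0 * h 0 1 + g 1 1 * h 1 1) * (g 0 0 * h 1 1) * h0
    rw [e, mul_eq_zero_iff_left ne, sub_eq_zero, eq_comm]
  simp only [hdisc, hdelta] at hcount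
  have hfilter : (Finset.univ.filter fun s : F₂ => s ≠ 0 ∧ kernelRel h ((Algebra.trace F F₂ s -
        g 1 1 - Algebra.norm F s * (g 0 0 - g 1 0 * x) / g.det) / g 1 0) z (r / s)) =
      (Finset.univ.filter fun s : F₂ => α * Algebra.norm F s +
        Algebra.trace F F₂ (s * conj F F₂ β) + γ = 0).erase 0 := by
    ext s
    simp only [Finset.mem_filter, Finset.mem_univ, true_and, Finset.mem_erase]
    exact and_congr_right fun hs => kernelRel_comp h2 hg hcg x z r hs
  have herase : (((Finset.univ.filter fun s : F₂ => α * Algebra.norm F s +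
        Algebra.trace F F₂ (s * conj F F₂ β) + γ = 0).erase 0).card : ℤ) =
      (Finset.univ.filter fun s : F₂ => α * Algebra.norm F s +
        Algebra.trace F F₂ (s * conj F F₂ β) + γ = 0).card - (if γ = 0 then 1 else 0) := by
    by_cases h0 : γ = 0
    · rw [Finset.cast_card_erase_of_mem (by simp [h0, Algebra.norm_zero])]
      simp [h0]
    · rw [Finset.erase_eq_of_notMem (by simp [h0, Algebra.norm_zero])]
      simp [h0]
  rw [hfilter, herase, hcount]
  ring

/-- The kernels define a representation. -/
theorem kernel_mul (h2 : Module.finrank F F₂ = 2) (hq : IsUnit (Nat.card F : A))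
    {χ : MulChar F₂ A} (hχ : GeneralPosition F χ)
    {g h : Matrix (Fin 2) (Fin 2) F} (hg : g.det ≠ 0) (hh : h.det ≠ 0) :
    kernel χ (g * h) = kernel χ g * kernel χ h := by
  ext x z
  rw [Matrix.mul_apply]
  by_cases hcg : g 1 0 = 0
  · have ha : g 0 0 ≠ 0 := fun h => hg (by rw [Matrix.det_fin_two, hcg, h]; ring)
    have : ∀ y, g 1 1 * x = g 0 0 * y + g 0 1 ↔ y = (g 1 1 * x - g 0 1) / g 0 0 := fun x => by
      rw [eq_div_iff ha, eq_sub_iff_add_eq, mul_comm x, eq_comm]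
    rw [kernel_mul_apply_of_left_eq_zero h2 χ hg hcg ((this _).2 rfl)]
    simp only [kernel_of_eq_zero h2 χ hg hcg, this, mul_assoc, sub_mul, ← Finset.mul_sum,
      Finset.sum_sub_distrib, sum_kernel_col h2 hq hχ hh]
    simp
  by_cases hch : h 1 0 = 0
  · have hd : h 1 1 ≠ 0 := fun e => hh (by rw [Matrix.det_fin_two, hch, e]; ring)
    have : ∀ y, h 1 1 * y = h 0 0 * z + h 0 1 ↔ y = (h 0 0 * z + h 0 1) / h 1 1 := fun x => by
      rw [eq_div_iff hd, mul_comm]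
    rw [kernel_mul_apply_of_right_eq_zero h2 χ hh hch ((this _).2 rfl)]
    simp only [kernel_of_eq_zero h2 χ hh hch, this, mul_left_comm _ (χ _), ← Finset.mul_sum,
      mul_sub, Finset.sum_sub_distrib, ← Finset.sum_mul, sum_kernel_row h2 hq hχ hg]
    simp [mul_comm]
  obtain ⟨c, hc⟩ := card_kernelRel_mul h2 hg hh hcg hch x z
  simp only [kernel_of_ne_zero χ hcg, kernel_of_ne_zero χ hch, 
    mul_mul_mul_comm (-Ring.inverse (Nat.card F : A)),
    ← Finset.mul_sum]
  rw [sum_kernelRel_mul χ hg hcg]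
  have hsum : ∀ r : F₂, ((Finset.univ.filter fun s : F₂ => s ≠ 0 ∧ kernelRel h
      ((Algebra.trace F F₂ s - g 1 1 - Algebra.norm F s * (g 0 0 - g 1 0 * x) / g.det) / g 1 0)
        z (r / s)).card : A) * χ r = (c (Algebra.norm F r) : A) * χ r +
      Nat.card F ^ 2 * (χ r * (if (g * h) 1 0 = 0 ∧
        r = algebraMap F F₂ ((g * h) 1 1) ∧ (g * h) 1 1 * x = (g * h) 0 0 * z + (g * h) 0 1
          then 1 else 0)) - Nat.card F * (χ r * (if kernelRel (g * h) x z r then 1 else 0)) := by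
    intro r
    by_cases hr : r = 0
    · subst hr; simp [MulChar.map_zero]
    · have := congrArg (Int.cast : ℤ → A) (hc r hr)
      push_cast at this
      rw [this]
      ring
  rw [Finset.sum_congr rfl fun r _ => hsum r, Finset.sum_sub_distrib, Finset.sum_add_distrib,
    hχ fun n => (c n : A), zero_add, kernel, ← Finset.mul_sum, ← Finset.mul_sum]
  simp only [mul_sub, Finset.sum_sub_distrib, mul_left_comm (χ _), ← Finset.mul_sum]
  -- The two factors `-1 / q` turn the weights `q ^ 2` and `-q` into the `1` and `-1 / q` of the
  -- kernel at `g * h`.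
  have hi := Ring.inverse_mul_cancel _ hq
  set i := Ring.inverse (Nat.card F : A)
  generalize (∑ r : F₂, χ r * (if (g * h) 1 0 = 0 ∧
        r = algebraMap F F₂ ((g * h) 1 1) ∧ (g * h) 1 1 * x = (g * h) 0 0 * z + (g * h) 0 1
          then 1 else 0)) = S
  generalize (∑ r : F₂, χ r * (if kernelRel (g * h) x z r then 1 else 0)) = T
  linear_combination (-(i * Nat.card F + 1) * S + i * T) * hi

end KernelMul

lemma det_coe_ne_zero {F : Type v} [Field F] (g : GL (Fin 2) F) :
    (g : Matrix (Fin 2) (Fin 2) F).det ≠ 0 :=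
  ((Matrix.isUnit_iff_isUnit_det _).1 g.isUnit).ne_zero

/-! ### Functions with sum zero as a representation of the affine group -/

section Affine

set_option linter.unusedSectionVars false

variable (F : Type v) [Field F] [Fintype F] [DecidableEq F]
variable (A : Type x) [CommRing A]

/-- An enumeration of the non-zero elements of `𝔽_q`. -/
def unitsEquiv : Fin (Nat.card F - 1) ≃ Fˣ :=
  (Finite.equivFinOfCardEq (Nat.card_units F)).symm

/-- The restriction of functions on `𝔽_q` to the non-zero elements. -/
def coordMat : Matrix (Fin (Nat.card F - 1)) F A := fun i x =>
  if x = unitsEquiv F i then 1 else 0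

/-- A basis of the functions with sum zero. -/
def basisMat : Matrix F (Fin (Nat.card F - 1)) A := fun x j =>
  (if x = unitsEquiv F j then 1 else 0) - (if x = 0 then 1 else 0)

variable {F A}

/-- The permutation matrix of the affine transformation `x ↦ a * x + b`. -/
def affMat (A : Type x) [CommRing A] (a : Fˣ) (b : F) : Matrix F F A := fun x y =>
  if x = a * y + b then 1 else 0

variable (A) in
/-- The action of the affine transformation `x ↦ a * x + b` on functions with sum zero. -/
def affRep (a : Fˣ) (b : F) : Matrix (Fin (Nat.card F - 1)) (Fin (Nat.card F - 1)) A :=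
  coordMat F A * affMat A a b * basisMat F A

lemma coordMat_mul_basisMat : coordMat F A * basisMat F A = 1 := by
  ext i j
  simp [Matrix.mul_apply, coordMat, basisMat, Matrix.one_apply, Units.val_inj]

lemma sum_basisMat (j : Fin (Nat.card F - 1)) : ∑ x, basisMat F A x j = 0 := by
  simp [basisMat]

/-- A function with sum zero is recovered from its values off `0`, the value at `0` being minus
their sum. -/
lemma basisMat_mul_coordMat_mul {ι : Type*} {M : Matrix F ι A} (hM : ∀ y, ∑ x, M x y = 0) :
    basisMat F A * (coordMat F A * M) = M := by
  have h : ∀ i y, (coordMat F A * M) i y = M (unitsEquiv F i) y := fun i y => by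
    simp [Matrix.mul_apply, coordMat]
  ext x y
  rw [Matrix.mul_apply]
  simp only [h, basisMat, sub_mul, ite_mul, one_mul, zero_mul, Finset.sum_sub_distrib]
  rw [Equiv.sum_comp (unitsEquiv F) fun u : Fˣ => if x = (u : F) then M u y else 0]
  by_cases hx : x = 0
  · subst hx
    have : ∀ u : Fˣ, (0 : F) ≠ u := fun u => u.ne_zero.symm
    have h0 := hM y
    rw [← Finset.add_sum_erase _ _ (Finset.mem_univ (0 : F))] at h0
    simp only [this, if_false, Finset.sum_const_zero, if_true, zero_sub]
    rw [neg_eq_iff_add_eq_zero, add_comm, ← h0]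
    congr 1
    rw [Equiv.sum_comp (unitsEquiv F) fun u : Fˣ => M u y]
    exact Finset.sum_bij (fun u _ => (u : F)) (by simp) (fun u _ v _ e => Units.ext e)
      (fun b hb => ⟨Units.mk0 b (Finset.ne_of_mem_erase hb), by simp⟩) (by simp)
  · have : ∀ u : Fˣ, x = u ↔ Units.mk0 x hx = u := fun u => by rw [Units.ext_iff]; rfl
    simp [this, hx]

lemma affMat_mul_apply {ι : Type*} (a : Fˣ) (b : F) (M : Matrix F ι A) (x : F) (j : ι) :
    (affMat A a b * M) (a * x + b) j = M x j := by
  simp [Matrix.mul_apply, affMat, Finset.sum_ite_eq]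

lemma mul_affMat_apply {ι : Type*} (a : Fˣ) (b : F) (M : Matrix ι F A) (x : F) (j : ι) :
    (M * affMat A a b) j x = M j (a * x + b) := by
  simp [Matrix.mul_apply, affMat]

lemma affMat_bijective (a : Fˣ) (b : F) : Function.Bijective fun x : F => a * x + b :=
  ((Units.mulLeft a).trans (Equiv.addRight b)).bijective

lemma sum_affMat_mul {ι : Type*} (a : Fˣ) (b : F) {M : Matrix F ι A}
    (hM : ∀ y, ∑ x, M x y = 0) (y : ι) : ∑ x, (affMat A a b * M) x y = 0 := by
  rw [← hM y, ← (affMat_bijective a b).sum_comp fun x => (affMat A a b * M) x y]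
  simp only [affMat_mul_apply]

lemma basisMat_mul_affRep (a : Fˣ) (b : F) :
    basisMat F A * affRep A a b = affMat A a b * basisMat F A := by
  rw [affRep, Matrix.mul_assoc, basisMat_mul_coordMat_mul (sum_affMat_mul a b sum_basisMat)]

variable (F A) in
/-- The projection to the functions with sum zero. -/
def projMat : Matrix F F A := fun x y =>
  (if x = y then 1 else 0) - Ring.inverse (Nat.card F : A)

lemma sum_projMat (hq : IsUnit (Nat.card F : A)) (y : F) : ∑ x, projMat F A x y = 0 := by
  simp [projMat, ← Nat.card_eq_fintype_card, Ring.mul_inverse_cancel _ hq]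

lemma projMat_mul_basisMat : projMat F A * basisMat F A = basisMat F A := by
  ext x j
  have := sum_basisMat (F := F) (A := A) j
  simp [Matrix.mul_apply, projMat, sub_mul, Finset.sum_sub_distrib, ← Finset.mul_sum, this]

lemma affMat_mul_projMat (a : Fˣ) (b : F) :
    affMat A a b * projMat F A = projMat F A * affMat A a b := by
  ext x y
  obtain ⟨x, rfl⟩ := (affMat_bijective a b).2 x
  rw [affMat_mul_apply, mul_affMat_apply]
  simp [projMat]

/-- Schur's lemma for the action of the affine group on functions with sum zero. -/
lemma eq_smul_of_commute_affRep (hq : IsUnit (Nat.card F : A))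
    {Y : Matrix (Fin (Nat.card F - 1)) (Fin (Nat.card F - 1)) A}
    (hY : ∀ a b, affRep A a b * Y = Y * affRep A a b) :
    ∃ c : A, Y = c • (1 : Matrix (Fin (Nat.card F - 1)) (Fin (Nat.card F - 1)) A) := by
  -- `Z` extends `Y` to all functions on `F`, through the projection to those with sum zero.
  set Z := basisMat F A * Y * coordMat F A * projMat F A with hZ
  have hcomm : ∀ a b, affMat A a b * Z = Z * affMat A a b := by
    intro a b
    rw [hZ, ← Matrix.mul_assoc, ← Matrix.mul_assoc, ← Matrix.mul_assoc, ← basisMat_mul_affRep,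
      Matrix.mul_assoc (basisMat F A), hY, Matrix.mul_assoc _ (projMat F A),
      ← affMat_mul_projMat, ← basisMat_mul_coordMat_mul (sum_projMat (F := F) (A := A) hq)]
    simp only [Matrix.mul_assoc]
    rw [← Matrix.mul_assoc (affMat A a b) (basisMat F A), ← basisMat_mul_affRep,
      Matrix.mul_assoc (basisMat F A) (affRep A a b),
      ← Matrix.mul_assoc (coordMat F A) (basisMat F A), coordMat_mul_basisMat, Matrix.one_mul,
      ← Matrix.mul_assoc (coordMat F A) (basisMat F A), coordMat_mul_basisMat,
      Matrix.one_mul]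
  have htrans : ∀ (a : Fˣ) (b x y : F), Z (a * x + b) (a * y + b) = Z x y := by
    intro a b x y
    have h := congrFun (congrFun (hcomm a b) (a * x + b)) y
    rw [affMat_mul_apply, mul_affMat_apply] at h
    exact h.symm
  -- The affine group is 2-transitive on `F`, so `Z` takes one value on the diagonal and one off it.
  obtain ⟨c, d, hval⟩ : ∃ c d : A, Z = c • (1 : Matrix F F A) + d • Matrix.of fun _ _ => 1 := by
    refine ⟨Z 0 0 - Z 1 0, Z 1 0, ?_⟩
    ext x y
    by_cases hxy : x = y
    · subst hxy
      have := htrans 1 x 0 0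
      simp only [Units.val_one, mul_zero, zero_add] at this
      simp [this]
    · have := htrans (Units.mk0 (x - y) (sub_ne_zero.2 hxy)) y 1 0
      simp only [Units.val_mk0, mul_one, mul_zero, zero_add, sub_add_cancel] at this
      simp [this, hxy]
  have hJ : (Matrix.of fun _ _ => 1 : Matrix F F A) * basisMat F A = 0 := by
    ext x j
    simp [Matrix.mul_apply, sum_basisMat]
  have hYZ : Y = coordMat F A * (Z * basisMat F A) := by
    rw [hZ, Matrix.mul_assoc _ (projMat F A), projMat_mul_basisMat, Matrix.mul_assoc _ (coordMat F A),
      coordMat_mul_basisMat, Matrix.mul_one, ← Matrix.mul_assoc, coordMat_mul_basisMat,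
      Matrix.one_mul]
  refine ⟨c, ?_⟩
  rw [hYZ, hval, Matrix.add_mul, Matrix.smul_mul, Matrix.smul_mul, hJ, smul_zero, add_zero,
    Matrix.one_mul,
    Matrix.mul_smul, coordMat_mul_basisMat]

/-- The matrices of the affine group separate matrices under the trace pairing. -/
lemma eq_zero_of_trace_affRep (hq : IsUnit (Nat.card F : A))
    {Z : Matrix (Fin (Nat.card F - 1)) (Fin (Nat.card F - 1)) A}
    (hZ : ∀ a b, (Z * affRep A a b).trace = 0) : Z = 0 := by
  set M := basisMat F A * Z * coordMat F A with hM
  have hcol : ∀ y, ∑ x, M x y = 0 := by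
    intro y
    simp only [hM, Matrix.mul_assoc, Matrix.mul_apply (M := basisMat F A)]
    rw [Finset.sum_comm]
    simp [← Finset.sum_mul, sum_basisMat]
  have htr : ∀ (a : Fˣ) b, ∑ x, M x (a * x + b) = 0 := by
    intro a b
    rw [← hZ a b, affRep, ← Matrix.mul_assoc, ← Matrix.mul_assoc, Matrix.trace_mul_comm,
      ← Matrix.mul_assoc, ← Matrix.mul_assoc, ← hM, Matrix.trace]
    simp only [Matrix.diag_apply, mul_affMat_apply]
  -- Sum over the affine maps sending `y` to `x`. Their graphs cover each `(v, z)` with `v ≠ y`, `z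
  -- ≠ x` once, and `(y, x)` itself `q - 1` times; the vanishing of the column sums leaves this
  -- identity.
  have key : ∀ x y, (Nat.card F : A) * M y x = ∑ z, M y z := by
    intro x y
    have h1 : ∑ a : Fˣ, ∑ v, M v (a * v + (x - a * y)) = 0 :=
      Finset.sum_eq_zero fun a _ => htr a _
    rw [Finset.sum_comm] at h1
    have h2 : ∀ v, ∑ a : Fˣ, M v (a * v + (x - a * y)) =
        (∑ z, M v z) - M v x + if v = y then (Nat.card F : A) * M v x - ∑ z, M v z else 0 := by
      intro v
      by_cases hv : v = y
      · subst hv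
        have hc : (Fintype.card Fˣ : A) = Nat.card F - 1 := by
          rw [← Nat.card_eq_fintype_card, Nat.card_units, Nat.cast_sub Nat.card_pos, Nat.cast_one]
        simp only [add_sub_cancel, Finset.sum_const, Finset.card_univ, nsmul_eq_mul, hc, if_true]
        ring
      · rw [if_neg hv, add_zero, ← Finset.add_sum_erase _ _ (Finset.mem_univ x),
          add_sub_cancel_left]
        have hv' := sub_ne_zero.2 hv
        refine Finset.sum_bij (fun a _ => a * v + (x - a * y)) ?_ ?_ ?_ (by simp)
        · intro a _
          have : (a : F) * v + (x - a * y) - x = a * (v - y) := by ring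
          rw [Finset.mem_erase, ← sub_ne_zero, this]
          simp [hv']
        · intro a _ a' _ h
          have : ((a : F) - a') * (v - y) = 0 := by linear_combination h
          rw [mul_eq_zero, or_iff_left hv', sub_eq_zero] at this
          exact Units.ext this
        · intro z hz
          have hz' := sub_ne_zero.2 (Finset.ne_of_mem_erase hz)
          refine ⟨Units.mk0 ((z - x) / (v - y)) (div_ne_zero hz' hv'), Finset.mem_univ _, ?_⟩
          simp only [Units.val_mk0]
          field_simp
          ring
    have hall : ∑ v, ∑ z, M v z = 0 := by
      exact Finset.sum_comm.trans (Finset.sum_eq_zero fun z _ => hcol z)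
    simp only [h2, Finset.sum_add_distrib, Finset.sum_sub_distrib, hall, hcol,
      Finset.sum_ite_eq', Finset.mem_univ, if_true] at h1
    linear_combination h1
  have hM0 : M = 0 := by
    ext y x
    -- By `key`, `q * M y x` does not depend on `x`; the column at `0` vanishes because `coordMat`
    -- omits the point `0`.
    have h0 : M y 0 = 0 := by
      rw [hM, Matrix.mul_apply]
      refine Finset.sum_eq_zero fun i _ => ?_
      rw [coordMat, if_neg (unitsEquiv F i).ne_zero.symm, mul_zero]
    rw [Matrix.zero_apply, ← hq.mul_right_eq_zero, key x y, ← key 0 y, h0, mul_zero]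
  have : Z = coordMat F A * M * basisMat F A := by
    rw [hM, Matrix.mul_assoc, Matrix.mul_assoc _ (coordMat F A), coordMat_mul_basisMat,
      Matrix.mul_one, ← Matrix.mul_assoc, coordMat_mul_basisMat, Matrix.one_mul]
  rw [this, hM0, Matrix.mul_zero, Matrix.zero_mul]

lemma map_affRep {B : Type*} [CommRing B] (f : A →+* B) (a : Fˣ) (b : F) :
    (affRep A a b).map f = affRep B a b := by
  have h1 : (coordMat F A).map f = coordMat F B := by
    ext i j
    simp only [Matrix.map_apply, coordMat]
    split_ifs <;> simp
  have h2 : (affMat A a b).map f = affMat B a b := by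
    ext i j
    simp only [Matrix.map_apply, affMat]
    split_ifs <;> simp
  have h3 : (basisMat F A).map f = basisMat F B := by
    ext i j
    simp only [Matrix.map_apply, basisMat, map_sub]
    split_ifs <;> simp
  rw [affRep, Matrix.map_mul, Matrix.map_mul, h1, h2, h3, affRep]

/-- The affine group as a subgroup of `GL₂`. -/
def affine (a : Fˣ) (b : F) : GL (Fin 2) F :=
  Matrix.GeneralLinearGroup.mkOfDetNeZero !![(a : F), b; 0, 1] (by simp [Matrix.det_fin_two])

lemma coe_affine (a : Fˣ) (b : F) :
    (affine a b : Matrix (Fin 2) (Fin 2) F) = !![(a : F), b; 0, 1] := rfl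

end Affine

/-! ### The cuspidal representations -/

section Rep

set_option linter.unusedSectionVars false

variable {F : Type v} [Field F] [Fintype F] [DecidableEq F]
variable {F₂ : Type w} [Field F₂] [Fintype F₂] [DecidableEq F₂] [Algebra F F₂]
variable {A : Type x} [CommRing A]

/-- The cuspidal representation of `GL₂(𝔽_q)` attached to a character of `𝔽_{q²}ˣ`. -/
def cuspRep (h2 : Module.finrank F F₂ = 2) (hq : IsUnit (Nat.card F : A))
    (χ : MulChar F₂ A) (hχ : GeneralPosition F χ) :
    GL (Fin 2) F →* GL (Fin (Nat.card F - 1)) A :=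
  MonoidHom.toHomUnits
    { toFun g := coordMat F A * kernel χ (g : Matrix (Fin 2) (Fin 2) F) * basisMat F A
      map_one' := by
        have h1 : kernel χ (1 : Matrix (Fin 2) (Fin 2) F) = projMat F A := by
          ext x y
          rw [kernel_of_eq_zero h2 χ (by simp) (by simp)]
          simp [projMat]
        rw [Units.val_one, h1, Matrix.mul_assoc, projMat_mul_basisMat, coordMat_mul_basisMat]
      map_mul' g h := by
        rw [Units.val_mul, kernel_mul h2 hq hχ (det_coe_ne_zero g) (det_coe_ne_zero h)]
        simp only [Matrix.mul_assoc]
        rw [← Matrix.mul_assoc (coordMat F A) (kernel χ h),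
          ← Matrix.mul_assoc (basisMat F A) (_ * _) _,
          basisMat_mul_coordMat_mul fun y => sum_kernel_col h2 hq hχ (det_coe_ne_zero h) y] }

variable (h2 : Module.finrank F F₂ = 2) (hq : IsUnit (Nat.card F : A))
  (χ : MulChar F₂ A) (hχ : GeneralPosition F χ)

lemma coe_cuspRep (g : GL (Fin 2) F) :
    (cuspRep h2 hq χ hχ g : Matrix (Fin (Nat.card F - 1)) (Fin (Nat.card F - 1)) A) =
      coordMat F A * kernel χ (g : Matrix (Fin 2) (Fin 2) F) * basisMat F A := rfl

/-- The lower right entry is `1`, so `χ` drops out. All the cuspidal representations share this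
restriction, and it is compatible with every change of ring. -/
lemma cuspRep_affine (a : Fˣ) (b : F) :
    (cuspRep h2 hq χ hχ (affine a b) : Matrix (Fin (Nat.card F - 1)) (Fin (Nat.card F - 1)) A) =
      affRep A a b := by
  have h1 : kernel χ (affine a b : Matrix (Fin 2) (Fin 2) F) = affMat A a b * projMat F A := by
    ext x y
    rw [kernel_of_eq_zero h2 χ (det_coe_ne_zero _) (by simp [coe_affine]), affMat_mul_projMat,
      mul_affMat_apply]
    simp [projMat, coe_affine]
  rw [coe_cuspRep, h1, affRep, Matrix.mul_assoc, Matrix.mul_assoc, projMat_mul_basisMat,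
    Matrix.mul_assoc]

lemma tr_cuspRep (g : GL (Fin 2) F) :
    tr (cuspRep h2 hq χ hχ g) = (kernel χ (g : Matrix (Fin 2) (Fin 2) F)).trace := by
  rw [tr, coe_cuspRep, Matrix.trace_mul_comm,
    basisMat_mul_coordMat_mul fun y => sum_kernel_col h2 hq hχ (det_coe_ne_zero g) y]

end Rep

/-! ### Conjugacy classes of `GL₂(𝔽_q)` -/

section Classes

set_option linter.unusedSectionVars false

variable {F : Type v} [Field F]

/-- A non-scalar matrix has a non-eigenvector among `e₁`, `e₂`, `e₁ + e₂`; this vector and its image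
form the required basis. -/
lemma exists_conj_companion {g : Matrix (Fin 2) (Fin 2) F} (hg : ∀ a : F, g ≠ !![a, 0; 0, a]) :
    ∃ Q : GL (Fin 2) F, g * Q = Q * !![0, -g.det; 1, g.trace] := by
  obtain ⟨x, y, hxy⟩ : ∃ x y : F,
      x * (g 1 0 * x + g 1 1 * y) - (g 0 0 * x + g 0 1 * y) * y ≠ 0 := by
    by_contra! h
    have h1 := h 1 0
    have h2 := h 0 1
    have h3 := h 1 1
    simp only [mul_one, mul_zero, add_zero, sub_zero, one_mul, zero_mul, zero_add, zero_sub,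
      neg_eq_zero] at h1 h2 h3
    apply hg (g 0 0)
    ext i j
    fin_cases i <;> fin_cases j <;> simp [h1, h2]
    linear_combination h3 - h1 + h2
  refine ⟨Matrix.GeneralLinearGroup.mkOfDetNeZero
    !![x, g 0 0 * x + g 0 1 * y; y, g 1 0 * x + g 1 1 * y]
    (by rw [Matrix.det_fin_two]; simpa using hxy), ?_⟩
  change g * !![x, g 0 0 * x + g 0 1 * y; y, g 1 0 * x + g 1 1 * y] =
    !![x, g 0 0 * x + g 0 1 * y; y, g 1 0 * x + g 1 1 * y] * _
  rw [Matrix.det_fin_two, Matrix.trace_fin_two]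
  ext i j
  fin_cases i <;> fin_cases j <;> simp [Matrix.mul_apply, Fin.sum_univ_two] <;> ring

lemma exists_conj_of_trace_eq {g : GL (Fin 2) F} {h : Matrix (Fin 2) (Fin 2) F}
    (hg : ∀ a : F, (g : Matrix (Fin 2) (Fin 2) F) ≠ !![a, 0; 0, a])
    (hh : ∀ a : F, h ≠ !![a, 0; 0, a])
    (htr : (g : Matrix (Fin 2) (Fin 2) F).trace = h.trace)
    (hdet : (g : Matrix (Fin 2) (Fin 2) F).det = h.det) :
    ∃ P : GL (Fin 2) F, ((P * g * P⁻¹ : GL (Fin 2) F) : Matrix (Fin 2) (Fin 2) F) = h := by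
  obtain ⟨Q, hQ⟩ := exists_conj_companion hg
  obtain ⟨R, hR⟩ := exists_conj_companion hh
  rw [htr, hdet] at hQ
  refine ⟨R * Q⁻¹, ?_⟩
  rw [show R * Q⁻¹ * g * (R * Q⁻¹)⁻¹ = R * (Q⁻¹ * (g * Q)) * R⁻¹ by group]
  simp only [Units.val_mul]
  rw [hQ, Units.inv_mul_cancel_left, ← hR, Units.mul_inv_cancel_right]

variable [Finite F] {F₂ : Type w} [Field F₂] [Algebra F F₂]

lemma finrank_eq_two (b : Module.Basis (Fin 2) F F₂) : Module.finrank F F₂ = 2 := by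
  rw [Module.finrank_eq_card_basis b, Fintype.card_fin]

/-- A zero in the lower left makes `b 0` an eigenvector of multiplication by `y`, and cancelling `b
0` shows that `y` equals the eigenvalue. -/
lemma mem_range_of_torus_apply_eq_zero (b : Module.Basis (Fin 2) F F₂) {y : F₂ˣ}
    (hy : (torus b y : Matrix (Fin 2) (Fin 2) F) 1 0 = 0) : y ∈ (inclUnits F F₂).range := by
  have h1 : (y : F₂) * b 0 = (torus b y : Matrix (Fin 2) (Fin 2) F) 0 0 • b 0 := by
    rw [← b.sum_repr ((y : F₂) * b 0), Fin.sum_univ_two]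
    have : ∀ i, b.repr ((y : F₂) * b 0) i = (torus b y : Matrix (Fin 2) (Fin 2) F) i 0 :=
      fun i => (Algebra.leftMulMatrix_eq_repr_mul b (y : F₂) i 0).symm
    rw [this, this, hy, zero_smul, add_zero]
  rw [Algebra.smul_def] at h1
  have h2 := mul_right_cancel₀ (b.ne_zero 0) h1
  have h3 : (torus b y : Matrix (Fin 2) (Fin 2) F) 0 0 ≠ 0 := by
    intro h
    rw [h, map_zero] at h2
    exact y.ne_zero h2
  exact ⟨Units.mk0 _ h3, Units.ext h2.symm⟩

variable [Finite F₂]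

lemma mem_range_of_conj_eq {y : F₂} (hy : conj F F₂ y = y) : y ∈ (algebraMap F F₂).range := by
  let := Fintype.ofFinite F
  refine (IsGalois.mem_range_algebraMap_iff_fixed (F := F) y).2 fun φ => ?_
  obtain ⟨n, rfl⟩ := (FiniteField.bijective_frobeniusAlgEquivOfAlgebraic_pow F F₂).2 φ
  have h1 : FiniteField.frobeniusAlgEquivOfAlgebraic F F₂ y = y := hy
  rw [AlgEquiv.coe_pow]
  exact Function.iterate_fixed h1 n

lemma quadratic_self (h2 : Module.finrank F F₂ = 2) (y : F₂) :
    y ^ 2 - algebraMap F F₂ (Algebra.trace F F₂ y) * y + algebraMap F F₂ (Algebra.norm F y) = 0 := by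
  rw [algebraMap_trace h2, algebraMap_norm h2]
  ring

/-- Irreducible quadratic polynomials over `𝔽_q` have roots in `𝔽_{q²}`. -/
lemma exists_trace_norm (h2 : Module.finrank F F₂ = 2) {t n : F}
    (h : ∀ a : F, a ^ 2 - t * a + n ≠ 0) :
    ∃ y : F₂, y ∉ (algebraMap F F₂).range ∧ Algebra.trace F F₂ y = t ∧ Algebra.norm F y = n := by
  open Polynomial in
  set p : F[X] := C 1 * X ^ 2 + C (-t) * X + C n with hp
  have hdeg : p.natDegree = 2 := natDegree_quadratic one_ne_zero
  have hirr : Irreducible p := by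
    rw [irreducible_iff_roots_eq_zero_of_degree_le_three (by omega) (by omega)]
    rw [Multiset.eq_zero_iff_forall_notMem]
    intro a ha
    have := (mem_roots'.1 ha).2
    apply h a
    simpa [hp, sub_eq_add_neg] using this
  have : Fact (Irreducible p) := ⟨hirr⟩
  have hfin : Module.finrank F (AdjoinRoot p) = 2 := by
    rw [(AdjoinRoot.powerBasis hirr.ne_zero).finrank, AdjoinRoot.powerBasis_dim, hdeg]
  obtain ⟨f⟩ : Nonempty (AdjoinRoot p →ₐ[F] F₂) :=
    FiniteField.nonempty_algHom_of_finrank_dvd (by rw [hfin, h2])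
  set y := f (AdjoinRoot.root p) with hy
  have hroot : y ^ 2 - algebraMap F F₂ t * y + algebraMap F F₂ n = 0 := by
    have h1 : aeval y p = 0 := by
      rw [hy, aeval_algHom_apply, AdjoinRoot.aeval_eq, AdjoinRoot.mk_self, map_zero]
    simpa [hp, sub_eq_add_neg] using h1
  have hmem : y ∉ (algebraMap F F₂).range := by
    rintro ⟨a, ha⟩
    apply h a
    apply (algebraMap F F₂).injective
    rw [← ha] at hroot
    simpa using hroot
  have hself := quadratic_self h2 y
  -- Were the trace different from `t`, subtracting the two quadratic equations of `y` would place
  -- `y` in `F`.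
  have ht : Algebra.trace F F₂ y = t := by
    by_contra hne
    have hne' : Algebra.trace F F₂ y - t ≠ 0 := sub_ne_zero.2 hne
    refine hmem ⟨(Algebra.norm F y - n) / (Algebra.trace F F₂ y - t), ?_⟩
    have hne'' : algebraMap F F₂ (Algebra.trace F F₂ y) - algebraMap F F₂ t ≠ 0 := by
      rw [← map_sub]
      exact (_root_.map_ne_zero _).2 hne'
    rw [map_div₀, map_sub, map_sub, div_eq_iff hne'']
    linear_combination hself - hroot
  refine ⟨y, hmem, ht, ?_⟩
  apply (algebraMap F F₂).injective
  rw [ht] at hself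
  linear_combination hself - hroot

lemma coe_torus (b : Module.Basis (Fin 2) F F₂) (y : F₂ˣ) :
    (torus b y : Matrix (Fin 2) (Fin 2) F) = Algebra.leftMulMatrix b (y : F₂) := rfl

lemma trace_torus (b : Module.Basis (Fin 2) F F₂) (y : F₂ˣ) :
    (torus b y : Matrix (Fin 2) (Fin 2) F).trace = Algebra.trace F F₂ (y : F₂) := by
  rw [coe_torus, Algebra.trace_eq_matrix_trace b]

lemma det_torus (b : Module.Basis (Fin 2) F F₂) (y : F₂ˣ) :
    (torus b y : Matrix (Fin 2) (Fin 2) F).det = Algebra.norm F (y : F₂) := by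
  rw [coe_torus, Algebra.norm_eq_matrix_det b]

/-- Representatives for the conjugacy classes of `GL₂(𝔽_q)`. -/
lemma exists_conj_representative (b : Module.Basis (Fin 2) F F₂) (g : GL (Fin 2) F) :
    (∃ z : Fˣ, (g : Matrix (Fin 2) (Fin 2) F) = !![(z : F), 0; 0, (z : F)]) ∨
    (∃ (P : GL (Fin 2) F) (z : Fˣ),
      ((P * g * P⁻¹ : GL (Fin 2) F) : Matrix (Fin 2) (Fin 2) F) = (z : F) • !![1, 1; 0, 1]) ∨
    (∃ (P : GL (Fin 2) F) (a d : Fˣ), a ≠ d ∧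
      ((P * g * P⁻¹ : GL (Fin 2) F) : Matrix (Fin 2) (Fin 2) F) = !![(a : F), 0; 0, (d : F)]) ∨
    (∃ (P : GL (Fin 2) F) (y : F₂ˣ), y ∉ (inclUnits F F₂).range ∧ P * g * P⁻¹ = torus b y) := by
  have hdet : (g : Matrix (Fin 2) (Fin 2) F).det ≠ 0 := det_coe_ne_zero g
  by_cases hs : ∃ a : F, (g : Matrix (Fin 2) (Fin 2) F) = !![a, 0; 0, a]
  · obtain ⟨a, ha⟩ := hs
    have : a ≠ 0 := by
      rintro rfl
      apply hdet
      rw [ha, Matrix.det_fin_two]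
      simp
    exact Or.inl ⟨Units.mk0 a this, ha⟩
  push Not at hs
  by_cases hroot : ∃ a : F, a ^ 2 - (g : Matrix (Fin 2) (Fin 2) F).trace * a +
      (g : Matrix (Fin 2) (Fin 2) F).det = 0
  · obtain ⟨a, ha⟩ := hroot
    set d := (g : Matrix (Fin 2) (Fin 2) F).trace - a with hd
    have had : (g : Matrix (Fin 2) (Fin 2) F).det = a * d := by linear_combination ha
    have ha0 : a ≠ 0 := by rintro h; rw [had, h, zero_mul] at hdet; exact hdet rfl
    have hd0 : d ≠ 0 := by rintro h; rw [had, h, mul_zero] at hdet; exact hdet rfl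
    by_cases hne : a = d
    · obtain ⟨P, hP⟩ := exists_conj_of_trace_eq (g := g) (h := a • !![1, 1; 0, 1]) hs
        (fun c h => by simpa [ha0] using congrFun (congrFun h 0) 1)
        (by
          rw [Matrix.trace_fin_two (a • _)]
          simp
          linear_combination -hd - hne)
        (by
          rw [had, Matrix.det_fin_two, ← hne]
          simp)
      exact Or.inr (Or.inl ⟨P, Units.mk0 a ha0, hP⟩)
    · obtain ⟨P, hP⟩ := exists_conj_of_trace_eq (g := g) (h := !![a, 0; 0, d]) hs
        (fun c h => hne (by
          have h1 := congrFun (congrFun h 0) 0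
          have h2 := congrFun (congrFun h 1) 1
          simp only [Matrix.of_apply, Matrix.cons_val', Matrix.cons_val_zero, Matrix.cons_val_one,
            Matrix.cons_val_fin_one] at h1 h2
          rw [h1, h2]))
        (by rw [Matrix.trace_fin_two !![a, 0; 0, d]]; simp [hd])
        (by rw [had, Matrix.det_fin_two]; simp)
      exact Or.inr (Or.inr (Or.inl ⟨P, Units.mk0 a ha0, Units.mk0 d hd0, by
        rwa [Ne, Units.ext_iff], hP⟩))
  · push Not at hroot
    obtain ⟨y, hy, ht, hn⟩ := exists_trace_norm (finrank_eq_two b) hroot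
    have hy0 : y ≠ 0 := by rintro rfl; exact hy ⟨0, map_zero _⟩
    obtain ⟨P, hP⟩ := exists_conj_of_trace_eq (g := g) (h := torus b (Units.mk0 y hy0)) hs
      (fun c h => by
        obtain ⟨z, hz⟩ := mem_range_of_torus_apply_eq_zero b (y := Units.mk0 y hy0)
          (by rw [h]; rfl)
        exact hy ⟨z, congrArg Units.val hz⟩)
      (by rw [trace_torus, Units.val_mk0, ht]) (by rw [det_torus, Units.val_mk0, hn])
    refine Or.inr (Or.inr (Or.inr ⟨P, Units.mk0 y hy0, ?_, Units.ext hP⟩))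
    rintro ⟨z, hz⟩
    exact hy ⟨z, congrArg Units.val hz⟩

/-- A class function on `GL₂(𝔽_q)` is determined by its values on representatives. -/
lemma IsCuspidalCharacter.ext {C : Type x} [CommRing C] {b : Module.Basis (Fin 2) F F₂}
    {θ : F₂ˣ →* Cˣ} {χ χ' : GL (Fin 2) F → C} (hχ : IsCuspidalCharacter b θ χ)
    (hχ' : IsCuspidalCharacter b θ χ') (hc : ∀ P g, χ (P * g * P⁻¹) = χ g)
    (hc' : ∀ P g, χ' (P * g * P⁻¹) = χ' g) : χ = χ' := by
  ext g
  obtain ⟨h1, h2, h3, h4⟩ := hχ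
  obtain ⟨h1', h2', h3', h4'⟩ := hχ'
  obtain ⟨z, hz⟩ | ⟨P, z, hz⟩ | ⟨P, a, d, had, h⟩ | ⟨P, y, hy, h⟩ := exists_conj_representative b g
  · rw [h1 g z hz, h1' g z hz]
  · rw [← hc P, ← hc' P, h2 _ z 1 one_ne_zero hz, h2' _ z 1 one_ne_zero hz]
  · rw [← hc P, ← hc' P, h3 _ a d had h, h3' _ a d had h]
  · rw [← hc P, ← hc' P, h, h4 y hy, h4' y hy]

lemma tr_conj {C : Type x} [CommRing C] {n : ℕ} (P g : GL (Fin n) C) : tr (P * g * P⁻¹) = tr g := by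
  rw [tr, Units.val_mul, Matrix.trace_mul_comm, ← Units.val_mul, ← mul_assoc, inv_mul_cancel,
    one_mul, tr]

lemma IsCuspidalCharacter.map {C : Type x} [CommRing C] {D : Type*} [CommRing D]
    {b : Module.Basis (Fin 2) F F₂} {θ : F₂ˣ →* Cˣ} {χ : GL (Fin 2) F → C}
    (hχ : IsCuspidalCharacter b θ χ) (f : C →+* D) {θ' : F₂ˣ →* Dˣ}
    (hθ' : ∀ y, f (θ y : C) = (θ' y : D)) : IsCuspidalCharacter b θ' fun g => f (χ g) := by
  obtain ⟨h1, h2, h3, h4⟩ := hχ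
  refine ⟨fun g z hz => ?_, fun g z u hu hz => ?_, fun g a d had hg => ?_, fun y hy => ?_⟩ <;>
    beta_reduce
  · rw [h1 g z hz, map_mul, hθ', map_sub, map_natCast, map_one]
  · rw [h2 g z u hu hz, map_neg, hθ']
  · rw [h3 g a d had hg, map_zero]
  · rw [h4 y hy, map_sub, map_neg, map_pow, hθ']

end Classes

/-! ### The character of the explicit representations -/

section Character

set_option linter.unusedSectionVars false

variable {F : Type v} [Field F] [Fintype F] [DecidableEq F]
variable {F₂ : Type w} [Field F₂] [Fintype F₂] [DecidableEq F₂] [Algebra F F₂]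
variable {A : Type x} [CommRing A]

/-- The character of the cuspidal representation attached to `θ`. -/
lemma isCuspidalCharacter_cuspRep (b : Module.Basis (Fin 2) F F₂) (hq : IsUnit (Nat.card F : A))
    (θ : F₂ˣ →* Aˣ) (hθ : GeneralPosition F (MulChar.ofUnitHom θ)) :
    IsCuspidalCharacter b θ fun g =>
      tr (cuspRep (finrank_eq_two b) hq (MulChar.ofUnitHom θ) hθ g) := by
  have h2 := finrank_eq_two b
  have hincl : ∀ z : Fˣ, MulChar.ofUnitHom θ (algebraMap F F₂ z) = (θ (inclUnits F F₂ z) : A) :=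
    fun z => MulChar.ofUnitHom_coe θ (inclUnits F F₂ z)
  -- On the Borel subgroup the trace is `χ` of the lower right entry times the number of fixed
  -- points of the affine map minus one.
  have hborel : ∀ g : GL (Fin 2) F, (g : Matrix (Fin 2) (Fin 2) F) 1 0 = 0 →
      tr (cuspRep h2 hq (MulChar.ofUnitHom θ) hθ g) =
        MulChar.ofUnitHom θ (algebraMap F F₂ ((g : Matrix (Fin 2) (Fin 2) F) 1 1)) *
          ((∑ x : F, if (g : Matrix (Fin 2) (Fin 2) F) 1 1 * x =
            (g : Matrix (Fin 2) (Fin 2) F) 0 0 * x + (g : Matrix (Fin 2) (Fin 2) F) 0 1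
              then 1 else 0) - 1) := by
    intro g hc
    rw [tr_cuspRep, Matrix.trace]
    simp only [Matrix.diag_apply, kernel_of_eq_zero h2 _ (det_coe_ne_zero g) hc,
      ← Finset.mul_sum, Finset.sum_sub_distrib, Finset.sum_const, Finset.card_univ, nsmul_eq_mul,
      ← Nat.card_eq_fintype_card, Ring.mul_inverse_cancel _ hq]
  refine ⟨fun g z hz => ?_, fun g z u hu hz => ?_, fun g a d had hg => ?_, fun y hy => ?_⟩ <;>
    beta_reduce
  · have e : ∀ x : F, (z : F) * x = z * x + 0 := fun x => (add_zero _).symm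
    rw [hborel g (by simp [hz]), hz]
    simp only [Matrix.of_apply, Matrix.cons_val', Matrix.cons_val_zero, Matrix.cons_val_one,
      Matrix.cons_val_fin_one, hincl, ← e, if_true, Finset.sum_const, Finset.card_univ,
      nsmul_eq_mul, ← Nat.card_eq_fintype_card]
    ring
  · have e : ∀ x : F, ¬ ((z : F) * x = z * x + z * u) := fun x => by simp [hu]
    rw [hborel g (by simp [hz]), hz]
    simp only [Matrix.smul_apply, Matrix.of_apply, Matrix.cons_val', Matrix.cons_val_zero,
      Matrix.cons_val_one, Matrix.cons_val_fin_one, smul_eq_mul, mul_one, hincl, e, if_false,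
      Finset.sum_const_zero]
    ring
  · have e : ∀ x : F, (d : F) * x = a * x + 0 ↔ x = 0 := by
      intro x
      rw [add_zero, ← sub_eq_zero, ← sub_mul, mul_eq_zero, sub_eq_zero, ← Units.ext_iff,
        or_iff_right (Ne.symm had)]
    rw [hborel g (by simp [hg]), hg]
    simp only [Matrix.of_apply, Matrix.cons_val', Matrix.cons_val_zero, Matrix.cons_val_one,
      Matrix.cons_val_fin_one, e, Finset.sum_ite_eq', Finset.mem_univ, if_true, sub_self, mul_zero]
  · rw [tr_cuspRep, trace_kernel hq hθ (det_coe_ne_zero _)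
      (fun h => hy (mem_range_of_torus_apply_eq_zero b h))]
    have hne : (y : F₂) ≠ conj F F₂ y := by
      intro h
      obtain ⟨a, ha⟩ := mem_range_of_conj_eq h.symm
      have ha0 : a ≠ 0 := by rintro rfl; exact y.ne_zero (by rw [← ha, map_zero])
      exact hy ⟨Units.mk0 a ha0, Units.ext ha⟩
    -- The elements with the trace and norm of `y` are the roots `y` and `conj y` of its
    -- characteristic polynomial.
    have : ∀ s : F₂, (Algebra.trace F F₂ s = (torus b y : Matrix (Fin 2) (Fin 2) F).trace ∧
        Algebra.norm F s = (torus b y : Matrix (Fin 2) (Fin 2) F).det) ↔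
        s ∈ ({(y : F₂), conj F F₂ y} : Finset F₂) := by
      intro s
      rw [trace_torus, det_torus, Finset.mem_insert, Finset.mem_singleton]
      constructor
      · rintro ⟨ht, hn⟩
        have := quadratic_self h2 s
        rw [ht, hn, algebraMap_trace h2, algebraMap_norm h2] at this
        have : (s - y) * (s - conj F F₂ y) = 0 := by rw [← this]; ring
        simpa [sub_eq_zero] using this
      · rintro (rfl | rfl)
        · simp
        · exact ⟨trace_conj h2 _, norm_conj h2 _⟩
    simp only [this]
    rw [← Finset.sum_filter, Finset.filter_mem_eq_inter, Finset.univ_inter,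
      Finset.sum_pair hne, conj_apply, map_pow, MulChar.ofUnitHom_coe]
    ring

end Character

/-! ### The group ring of a finite abelian `l`-group over the Witt vectors -/

section GroupRing

set_option linter.unusedSectionVars false

variable (l : ℕ) [Fact l.Prime] (k : Type u) [Field k] [Finite k] [CharP k l]

lemma charZero_witt : CharZero (WittVector l k) := by
  obtain ⟨c, hc⟩ := CharP.exists (WittVector l k)
  rcases CharP.char_is_prime_or_zero (WittVector l k) c with hp | rfl
  · exfalso
    have h1 : ((c : ℕ) : k) = 0 := by
      have := congrArg (WittVector.constantCoeff (p := l) (R := k))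
        (CharP.cast_eq_zero (WittVector l k) c)
      rwa [map_natCast, map_zero] at this
    have h2 : l = c := (Nat.prime_dvd_prime_iff_eq (Fact.out : l.Prime) hp).1
      ((CharP.cast_eq_zero_iff k l c).1 h1)
    subst h2
    exact WittVector.p_nonzero l k (CharP.cast_eq_zero _ _)
  · exact CharP.charP_to_charZero _

lemma charZero_bigField : CharZero (BigField l k) := by
  have := charZero_witt l k
  have : CharZero (FractionRing (WittVector l k)) :=
    charZero_of_injective_algebraMap
      (IsFractionRing.injective (WittVector l k) (FractionRing (WittVector l k)))
  exact charZero_of_injective_algebraMap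
    (FaithfulSMul.algebraMap_injective (FractionRing (WittVector l k)) (BigField l k))

variable {l k}

lemma isUnit_witt_of_constantCoeff {w : WittVector l k} (h : WittVector.constantCoeff w ≠ 0) :
    IsUnit w :=
  WittVector.isUnit_of_coeff_zero_ne_zero w h

lemma isUnit_natCast_witt {m : ℕ} (h : l.Coprime m) : IsUnit (m : WittVector l k) := by
  apply isUnit_witt_of_constantCoeff
  rw [map_natCast, Ne, CharP.cast_eq_zero_iff k l]
  exact fun hd => (Fact.out : l.Prime).one_lt.ne' (Nat.eq_one_of_dvd_coprimes h dvd_rfl hd)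

variable {H : Type} [CommGroup H] [Finite H]

variable (l k H) in
/-- The augmentation of the group ring. -/
def aug : MonoidAlgebra (WittVector l k) H →ₐ[WittVector l k] WittVector l k :=
  MonoidAlgebra.lift (WittVector l k) (WittVector l k) H 1

@[simp] lemma aug_single (h : H) (w : WittVector l k) :
    aug l k H (MonoidAlgebra.single h w) = w := by
  simp [aug]

/-- Take `l ^ n = |H|`. Modulo `l` the `l ^ n`-power map is additive, and it sends every element of
`H` to `1`. -/
lemma exists_pow_sub_aug_pow (hH : IsPGroup l H) :
    ∃ n : ℕ, ∀ x : MonoidAlgebra (WittVector l k) H,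
      ∃ y, x ^ l ^ n = algebraMap _ _ (aug l k H x ^ l ^ n) + (l : MonoidAlgebra _ H) * y := by
  obtain ⟨n, hn⟩ := (IsPGroup.iff_card (p := l) (G := H)).1 hH
  have hpow : ∀ h : H, h ^ l ^ n = 1 := fun h => by rw [← hn]; exact pow_card_eq_one'
  refine ⟨n, fun x => ?_⟩
  induction x using MonoidAlgebra.induction_on with
  | of h =>
    refine ⟨0, ?_⟩
    simp [MonoidAlgebra.single_pow, hpow]
  | add x y hx hy =>
    obtain ⟨a, ha⟩ := hx
    obtain ⟨b, hb⟩ := hy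
    obtain ⟨r, hr⟩ := exists_add_pow_prime_pow_eq (Fact.out : l.Prime) x y n
    obtain ⟨s, hs⟩ := exists_add_pow_prime_pow_eq (Fact.out : l.Prime)
      (aug l k H x) (aug l k H y) n
    refine ⟨a + b + x * y * r - algebraMap _ _ (aug l k H x * aug l k H y * s), ?_⟩
    rw [hr, ha, hb, map_add, hs, map_add, map_add]
    simp only [map_mul, map_natCast]
    ring
  | smul w x hx =>
    obtain ⟨a, ha⟩ := hx
    refine ⟨w ^ l ^ n • a, ?_⟩
    rw [smul_pow, ha, map_smul, smul_eq_mul, mul_pow, map_mul, smul_add, mul_smul_comm,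
      Algebra.smul_def]

variable (l k H) in
/-- The reduction map of the group ring. -/
def groupRingRes : MonoidAlgebra (WittVector l k) H →+* k :=
  (WittVector.constantCoeff (p := l) (R := k)).comp (aug l k H : _ →+* WittVector l k)

lemma groupRingRes_algebraMap (w : WittVector l k) :
    groupRingRes l k H (algebraMap _ _ w) = WittVector.constantCoeff w := by
  rw [groupRingRes, RingHom.comp_apply, AlgHom.coe_toRingHom, AlgHom.commutes]
  rfl

/-- By integrality every maximal ideal contains `l`. If it contains `a`, it also contains a power of
the augmentation of `a`, which is a unit as soon as `a` has non-zero reduction. -/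
lemma isLocalHom_groupRingRes (hH : IsPGroup l H) : IsLocalHom (groupRingRes l k H) := by
  refine ⟨fun a ha => ?_⟩
  by_contra hna
  obtain ⟨M, hM, haM⟩ := exists_max_ideal_of_mem_nonunits hna
  have hcomap := Ideal.isMaximal_comap_of_isIntegral_of_isMaximal (R := WittVector l k) M
  have hl : (l : MonoidAlgebra (WittVector l k) H) ∈ M := by
    have : (l : WittVector l k) ∈ M.comap (algebraMap _ _) := by
      rw [IsLocalRing.eq_maximalIdeal hcomap, IsLocalRing.mem_maximalIdeal]
      exact (WittVector.irreducible l).not_isUnit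
    simpa using this
  obtain ⟨n, hn⟩ := exists_pow_sub_aug_pow (k := k) hH
  obtain ⟨y, hy⟩ := hn a
  have hu : IsUnit (aug l k H a) := isUnit_witt_of_constantCoeff ha.ne_zero
  have h1 : algebraMap _ _ (aug l k H a ^ l ^ n) ∈ M := by
    rw [← Ideal.add_mem_iff_left M (M.mul_mem_right y hl), ← hy]
    exact M.pow_mem_of_mem haM _ (pow_pos (Fact.out : l.Prime).pos n)
  exact hM.ne_top (M.eq_top_of_isUnit_mem h1 ((hu.pow _).map _))

lemma isLocalRing_groupRing (hH : IsPGroup l H) :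
    IsLocalRing (MonoidAlgebra (WittVector l k) H) :=
  have := isLocalHom_groupRingRes (k := k) hH
  RingHom.domain_isLocalRing (groupRingRes l k H)

instance [hH : Fact (IsPGroup l H)] : LocalCoeff l k (MonoidAlgebra (WittVector l k) H) :=
  { isLocalRing_groupRing hH.out with
    res := groupRingRes l k H
    res_algebraMap := groupRingRes_algebraMap }

lemma res_groupRing_apply [Fact (IsPGroup l H)] (x : MonoidAlgebra (WittVector l k) H) :
    res l k (MonoidAlgebra (WittVector l k) H) x = WittVector.constantCoeff (aug l k H x) := rfl

lemma mem_maximalIdeal_groupRing [hH : Fact (IsPGroup l H)] {x : MonoidAlgebra (WittVector l k) H} :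
    x ∈ maximalIdeal (MonoidAlgebra (WittVector l k) H) ↔ groupRingRes l k H x = 0 := by
  have := isLocalHom_groupRingRes (k := k) hH.out
  rw [IsLocalRing.mem_maximalIdeal, mem_nonunits_iff, ← isUnit_map_iff (groupRingRes l k H),
    isUnit_iff_ne_zero, not_not]

lemma mem_span_pow_iff (n : ℕ) (x : MonoidAlgebra (WittVector l k) H) :
    x ∈ Ideal.span {(l : MonoidAlgebra (WittVector l k) H)} ^ n ↔
      ∀ h, x.coeff h ∈ Ideal.span {(l : WittVector l k)} ^ n := by
  have e : ∀ (y : MonoidAlgebra (WittVector l k) H) h,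
      ((l : MonoidAlgebra (WittVector l k) H) ^ n * y).coeff h =
        (l : WittVector l k) ^ n * y.coeff h := fun y h => by
    rw [← Nat.cast_pow, ← nsmul_eq_mul, MonoidAlgebra.coeff_smul_apply, nsmul_eq_mul, Nat.cast_pow]
  simp only [Ideal.span_singleton_pow, Ideal.mem_span_singleton]
  constructor
  · rintro ⟨y, rfl⟩ h
    exact ⟨y.coeff h, e y h⟩
  · intro h
    choose c hc using h
    refine ⟨MonoidAlgebra.ofCoeff (Finsupp.ofSupportFinite c (Set.toFinite _)), ?_⟩
    ext1
    refine Finsupp.ext fun h => ?_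
    rw [hc h, e]
    rfl

/-- From `m ^ N ≤ (l) ≤ m` the `m`-adic and `l`-adic topologies agree, and `l`-adic completeness is
inherited coefficientwise from `W(k)`. -/
lemma isAdicComplete_groupRing [hH : Fact (IsPGroup l H)] :
    IsAdicComplete (maximalIdeal (MonoidAlgebra (WittVector l k) H))
      (MonoidAlgebra (WittVector l k) H) := by
  have hnoeth : IsNoetherianRing (MonoidAlgebra (WittVector l k) H) :=
    IsNoetherianRing.of_finite (WittVector l k) _
  set m := maximalIdeal (MonoidAlgebra (WittVector l k) H) with hm
  set p := Ideal.span {(l : MonoidAlgebra (WittVector l k) H)} with hp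
  have hpm : p ≤ m := by
    rw [hp, Ideal.span_singleton_le_iff_mem, mem_maximalIdeal_groupRing, map_natCast,
      CharP.cast_eq_zero]
  obtain ⟨N, hN⟩ : ∃ N, m ^ N ≤ p := by
    refine Ideal.exists_pow_le_of_le_radical_of_fg (fun x hx => ?_) (IsNoetherian.noetherian m)
    obtain ⟨n, hn⟩ := exists_pow_sub_aug_pow (k := k) hH.out
    obtain ⟨y, hy⟩ := hn x
    refine ⟨l ^ n, ?_⟩
    have h1 : aug l k H x ∈ Ideal.span {(l : WittVector l k)} :=
      (WittVector.mem_span_p_iff_coeff_zero_eq_zero _).2 (mem_maximalIdeal_groupRing.1 hx)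
    obtain ⟨z, hz⟩ := Ideal.mem_span_singleton.1
      ((Ideal.span _).pow_mem_of_mem h1 (l ^ n) (pow_pos (Fact.out : l.Prime).pos n))
    rw [hy, hp, Ideal.mem_span_singleton, hz, map_mul, map_natCast, ← mul_add]
    exact dvd_mul_right _ _
  have hN' : ∀ n, m ^ (N * n) ≤ p ^ n := fun n => by
    rw [pow_mul]; exact Ideal.pow_right_mono hN n
  have hle : ∀ n, p ^ n ≤ m ^ n := fun n => Ideal.pow_right_mono hpm n
  have hmod : ∀ (I : Ideal (MonoidAlgebra (WittVector l k) H)) x y,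
      x ≡ y [SMOD I • (⊤ : Submodule (MonoidAlgebra (WittVector l k) H) _)] ↔ x - y ∈ I := by
    intro I x y
    rw [SModEq.sub_mem, smul_eq_mul, Ideal.mul_top]
  have hmodW : ∀ (I : Ideal (WittVector l k)) x y,
      x ≡ y [SMOD I • (⊤ : Submodule (WittVector l k) _)] ↔ x - y ∈ I := by
    intro I x y
    rw [SModEq.sub_mem, smul_eq_mul, Ideal.mul_top]
  have hW : IsAdicComplete (Ideal.span {(l : WittVector l k)}) (WittVector l k) := inferInstance
  refine { haus' := fun x hx => ?_, prec' := fun f hf => ?_ }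
  · ext1
    refine Finsupp.ext fun h => ?_
    refine hW.haus _ fun n => ?_
    have h1 := hN' n ((hmod _ _ _).1 (hx (N * n)))
    rw [sub_zero] at h1
    rw [hmodW, sub_zero]
    exact (mem_span_pow_iff n x).1 h1 h
  · have hcoeff : ∀ h : H, ∃ L : WittVector l k, ∀ n,
        (f (N * n)).coeff h ≡ L [SMOD (Ideal.span {(l : WittVector l k)}) ^ n •
          (⊤ : Submodule (WittVector l k) _)] := by
      intro h
      refine hW.prec fun {a b} hab => ?_
      have h1 := hN' a ((hmod _ _ _).1 (hf (Nat.mul_le_mul_left N hab)))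
      rw [hmodW]
      exact (mem_span_pow_iff a _).1 h1 h
    choose L hL using hcoeff
    refine ⟨MonoidAlgebra.ofCoeff (Finsupp.ofSupportFinite L (Set.toFinite _)), fun n => ?_⟩
    rw [hmod]
    have h1 : f (N * n) - MonoidAlgebra.ofCoeff (Finsupp.ofSupportFinite L (Set.toFinite _)) ∈
        m ^ n := hle n ((mem_span_pow_iff n _).2 fun h => (hmodW _ _ _).1 (hL h n))
    rcases Nat.eq_zero_or_pos N with rfl | hpos
    · have htop : p = ⊤ := top_le_iff.1 (by simpa using hN)
      exact absurd (htop ▸ hpm) (fun h => (IsLocalRing.maximalIdeal.isMaximal _).ne_top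
        (top_le_iff.1 h))
    · have h2 := (hmod _ _ _).1 (hf (Nat.le_mul_of_pos_left n hpos))
      simpa using (m ^ n).add_mem h2 h1

instance [Fact (IsPGroup l H)] : CompleteCoeff l k (MonoidAlgebra (WittVector l k) H) where
  noetherian := IsNoetherianRing.of_finite (WittVector l k) _
  complete := isAdicComplete_groupRing

end GroupRing

/-! ### The universal deformation of a character -/

section UniversalCharacter

set_option linter.unusedSectionVars false

/-- Roots of unity of order prime to the residue characteristic are determined by their
reduction. -/
lemma eq_one_of_pow_eq_one {l m : ℕ} (hm : l.Coprime m) (hl : l ≠ 1) {B : Type*} [CommRing B]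
    {κ : Type*} [Field κ] [CharP κ l] (f : B →+* κ) (hf : ∀ s, f s ≠ 0 → ∀ t, s * t = 0 → t = 0)
    {x : B} (hx : f x = 1) (hxm : x ^ m = 1) : x = 1 := by
  -- The geometric sum reduces to `m`, which is non-zero in `κ`; by `hf` it can be cancelled.
  have h1 : (∑ i ∈ Finset.range m, x ^ i) * (x - 1) = 0 := by
    rw [geom_sum_mul, hxm, sub_self]
  refine sub_eq_zero.1 (hf _ ?_ _ h1)
  rw [map_sum]
  simp only [map_pow, hx, one_pow, Finset.sum_const, Finset.card_range, nsmul_eq_mul, mul_one]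
  rw [Ne, CharP.cast_eq_zero_iff κ l]
  exact fun hd => hl (Nat.eq_one_of_dvd_coprimes hm dvd_rfl hd)

variable {l : ℕ} [Fact l.Prime] {k : Type u} [Field k] [Finite k] [CharP k l]
variable {E : Type w} [CommGroup E] [Finite E]
variable {H : Type} [CommGroup H] [Finite H]

variable (l) in
/-- The Teichmüller lift of a character. -/
def teichChar (θ : E →* kˣ) : E →* (WittVector l k)ˣ :=
  (Units.map (WittVector.teichmuller l)).comp θ

lemma constantCoeff_teichChar (θ : E →* kˣ) (y : E) :
    WittVector.constantCoeff (teichChar l θ y : WittVector l k) = θ y :=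
  WittVector.teichmuller_coeff_zero l (θ y : k)

variable (l) in
/-- The twist of the Teichmüller lift of `θ` by the tautological character of `E → H`. -/
def univChar (θ : E →* kˣ) (p : E →* H) : E →* (MonoidAlgebra (WittVector l k) H)ˣ :=
  (Units.map (algebraMap (WittVector l k) (MonoidAlgebra (WittVector l k) H) : _ →* _)).comp
    (teichChar l θ) * ((MonoidAlgebra.of (WittVector l k) H).comp p).toHomUnits

lemma coe_univChar (θ : E →* kˣ) (p : E →* H) (y : E) :
    (univChar l θ p y : MonoidAlgebra (WittVector l k) H) =
      algebraMap _ _ (teichChar l θ y : WittVector l k) * MonoidAlgebra.single (p y) 1 := rfl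

lemma single_eq_univChar (θ : E →* kˣ) (p : E →* H) (y : E) :
    (MonoidAlgebra.single (p y) 1 : MonoidAlgebra (WittVector l k) H) =
      ((teichChar l θ y)⁻¹ : (WittVector l k)ˣ).1 • (univChar l θ p y).1 := by
  rw [coe_univChar, Algebra.smul_def, ← mul_assoc, ← map_mul, Units.inv_mul, map_one, one_mul]

lemma aug_univChar (θ : E →* kˣ) (p : E →* H) (y : E) :
    aug l k H (univChar l θ p y).1 = teichChar l θ y := by
  rw [coe_univChar, map_mul, aug_single, AlgHom.commutes, mul_one]
  rfl

/-- The universal property of the group ring. -/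
lemma existsUnique_algHom_univChar {θ : E →* kˣ} {p : E →* H} (hp : Function.Surjective p)
    {B : Type*} [CommRing B] [Algebra (WittVector l k) B] (χ : E →* Bˣ)
    (hχ : ∀ y ∈ p.ker, (χ y : B) = algebraMap _ _ (teichChar l θ y : WittVector l k)) :
    ∃! f : MonoidAlgebra (WittVector l k) H →ₐ[WittVector l k] B,
      ∀ y, f (univChar l θ p y).1 = χ y := by
  set τ : E →* Bˣ := (Units.map (algebraMap (WittVector l k) B : _ →* _)).comp (teichChar l θ)
    with hτ
  have hle : p.ker ≤ (χ * τ⁻¹).ker := by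
    intro y hy
    rw [MonoidHom.mem_ker, MonoidHom.mul_apply, MonoidHom.inv_apply, mul_inv_eq_one]
    exact Units.ext (hχ y hy)
  set ψ : H →* Bˣ := MonoidHom.liftOfSurjective p hp ⟨χ * τ⁻¹, hle⟩ with hψ
  have hψp : ∀ y, ψ (p y) = χ y * (τ y)⁻¹ := fun y =>
    MonoidHom.liftOfRightInverse_comp_apply p _ (Function.rightInverse_surjInv hp)
      ⟨χ * τ⁻¹, hle⟩ y
  refine ⟨MonoidAlgebra.lift _ _ _ ((Units.coeHom B).comp ψ), fun y => ?_, fun f hf => ?_⟩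
  · rw [coe_univChar, map_mul, AlgHom.commutes, MonoidAlgebra.lift_single, one_smul,
      MonoidHom.comp_apply, hψp]
    change algebraMap _ _ (teichChar l θ y).1 * ((χ y * (τ y)⁻¹ : Bˣ) : B) = χ y
    rw [show algebraMap (WittVector l k) B (teichChar l θ y).1 = (τ y : B) from rfl, ← Units.val_mul,
      mul_comm, inv_mul_cancel_right]
  · refine MonoidAlgebra.algHom_ext (fun h => ?_) (AlgHom.ext fun w => (f.commutes w).trans
      (AlgHom.commutes _ w).symm)
    obtain ⟨y, rfl⟩ := hp h
    rw [MonoidAlgebra.lift_single, one_smul, MonoidHom.comp_apply, hψp,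
      single_eq_univChar θ, map_smul, hf, Algebra.smul_def, mul_comm]
    change _ = (χ y : B) * ((τ y)⁻¹ : Bˣ)
    rfl

lemma adjoin_univChar {θ : E →* kˣ} {p : E →* H} (hp : Function.Surjective p)
    {S : Subalgebra (WittVector l k) (MonoidAlgebra (WittVector l k) H)}
    (hS : ∀ y, (univChar l θ p y).1 ∈ S) : S = ⊤ := by
  refine top_le_iff.1 fun x _ => ?_
  induction x using MonoidAlgebra.induction_on with
  | of h =>
    obtain ⟨y, rfl⟩ := hp h
    rw [MonoidAlgebra.of_apply, single_eq_univChar θ]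
    exact S.smul_mem (hS y) _
  | add x y hx hy => exact S.add_mem (hx trivial) (hy trivial)
  | smul w x hx => exact S.smul_mem (hx trivial) _

lemma pow_card_ker {p : E →* H} {y : E} (hy : y ∈ p.ker) : y ^ Nat.card p.ker = 1 := by
  have := pow_card_eq_one' (x := (⟨y, hy⟩ : p.ker))
  exact congrArg Subtype.val this

/-- The group ring represents the deformations of a character on all local algebras. -/
lemma existsUnique_map_univChar [Fact (IsPGroup l H)] {θ : E →* kˣ} {p : E →* H}
    (hp : Function.Surjective p) (hcop : l.Coprime (Nat.card p.ker))
    {A : Type u} [CommRing A] [Algebra (WittVector l k) A] [LocalCoeff l k A]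
    (d : CharDeformation l θ A) :
    ∃! f : MonoidAlgebra (WittVector l k) H →ₐ[WittVector l k] A,
      ∀ y, f (univChar l θ p y).1 = d.1 y := by
  refine existsUnique_algHom_univChar hp d.1 fun y hy => ?_
  set t := Units.map (algebraMap (WittVector l k) A : _ →* A) (teichChar l θ y) with ht
  have hres : res l k A (d.1 y : A) = θ y :=
    congrArg Units.val (DFunLike.congr_fun d.2 y)
  -- The quotient reduces to `1` and its order divides `|ker p|`, which is prime to `l`.
  have h1 : d.1 y * t⁻¹ = 1 := by
    apply Units.ext
    refine eq_one_of_pow_eq_one hcop (Fact.out : l.Prime).one_lt.ne' (res l k A)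
      (fun s hs t h => (isUnit_of_res_ne_zero hs).mul_right_eq_zero.1 h) ?_ ?_
    · rw [Units.val_mul, map_mul, hres, ht, ← map_inv]
      change _ * res l k A (algebraMap _ _ ((teichChar l θ y)⁻¹ : (WittVector l k)ˣ).1) = 1
      rw [res_algebraMap, ← map_inv, constantCoeff_teichChar, map_inv, Units.mul_inv]
    · rw [← Units.val_pow_eq_pow_val, mul_pow, inv_pow, ht, ← map_pow, ← map_pow, ← map_pow,
        pow_card_ker hy, map_one, map_one, map_one, inv_one, mul_one, Units.val_one]
  exact congrArg Units.val (mul_inv_eq_one.1 h1)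

/-- The universal deformation of a character. -/
def univCharDeformation [Fact (IsPGroup l H)] (θ : E →* kˣ) (p : E →* H) :
    CharDeformation l θ (MonoidAlgebra (WittVector l k) H) :=
  ⟨univChar l θ p, by
    ext y
    change res l k _ (univChar l θ p y).1 = (θ y : k)
    rw [res_groupRing_apply, aug_univChar, constantCoeff_teichChar]⟩

lemma charDeformation_map_eq_iff {A B : Type u} [CommRing A] [Algebra (WittVector l k) A]
    [LocalCoeff l k A] [CommRing B] [Algebra (WittVector l k) B] [LocalCoeff l k B]
    {θ : E →* kˣ} (χ : CharDeformation l θ A) (f : A →ₐ[WittVector l k] B)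
    (d : CharDeformation l θ B) : χ.map f = d ↔ ∀ y, f (χ.1 y : A) = d.1 y := by
  constructor
  · rintro rfl y
    rfl
  · exact fun h => Subtype.ext (MonoidHom.ext fun y => Units.ext (h y))

end UniversalCharacter

/-! ### Points of the group ring over `K` -/

section Points

set_option linter.unusedSectionVars false

variable {l : ℕ} [Fact l.Prime] {k : Type u} [Field k] [Finite k] [CharP k l]
variable {H : Type} [CommGroup H] [Finite H]

lemma algebraMap_bigField_injective :
    Function.Injective (algebraMap (WittVector l k) (BigField l k)) := by
  rw [IsScalarTower.algebraMap_eq (WittVector l k) (FractionRing (WittVector l k))]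
  exact (FaithfulSMul.algebraMap_injective (FractionRing (WittVector l k)) (BigField l k)).comp
    (IsFractionRing.injective (WittVector l k) (FractionRing (WittVector l k)))

/-- Characters separate the elements of the group ring. -/
lemma eq_zero_of_forall_lift (x : MonoidAlgebra (WittVector l k) H)
    (hx : ∀ ψ : H →* (BigField l k)ˣ,
      MonoidAlgebra.lift (WittVector l k) (BigField l k) H ((Units.coeHom _).comp ψ) x = 0) :
    x = 0 := by
  have := charZero_bigField l k
  have : Fintype H := Fintype.ofFinite H
  have : NeZero (Monoid.exponent H) := ⟨Monoid.exponent_ne_zero_of_finite⟩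
  have hcard := CommGroup.card_monoidHom_of_hasEnoughRootsOfUnity H (BigField l k)
  have : Finite (H →* (BigField l k)ˣ) :=
    Nat.finite_of_card_ne_zero (by rw [hcard]; exact Nat.card_pos.ne')
  have : Fintype (H →* (BigField l k)ˣ) := Fintype.ofFinite _
  have hsum : ∀ h : H, h ≠ 1 → ∑ ψ : H →* (BigField l k)ˣ, (ψ h : BigField l k) = 0 := by
    intro h hh
    obtain ⟨φ, hφ⟩ := CommGroup.exists_apply_ne_one_of_hasEnoughRootsOfUnity H (BigField l k) hh
    have h1 : (φ h : BigField l k) * ∑ ψ : H →* (BigField l k)ˣ, (ψ h : BigField l k) =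
        ∑ ψ : H →* (BigField l k)ˣ, (ψ h : BigField l k) := by
      rw [Finset.mul_sum]
      exact Fintype.sum_equiv (Equiv.mulLeft φ) _ _ fun ψ => by simp
    have h2 : (φ h : BigField l k) - 1 ≠ 0 := by
      rw [sub_ne_zero]
      exact fun e => hφ (Units.ext e)
    have h3 : ((φ h : BigField l k) - 1) * ∑ ψ : H →* (BigField l k)ˣ, (ψ h : BigField l k) = 0 := by
      rw [sub_mul, h1, one_mul, sub_self]
    exact (mul_eq_zero.1 h3).resolve_left h2
  have hlift : ∀ ψ : H →* (BigField l k)ˣ, ∑ h, algebraMap _ (BigField l k) (x.coeff h) *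
      (ψ h : BigField l k) = 0 := by
    intro ψ
    rw [← hx ψ, MonoidAlgebra.lift_apply', Finsupp.sum_fintype _ _ (by simp)]
    rfl
  ext1
  refine Finsupp.ext fun g => ?_
  -- Fourier inversion: weighting by `ψ g⁻¹` and summing over `ψ` isolates `|H|` times the
  -- coefficient at `g`.
  have h1 : ∑ ψ : H →* (BigField l k)ˣ, (ψ g⁻¹ : BigField l k) * ∑ h, algebraMap _ (BigField l k)
      (x.coeff h) * (ψ h : BigField l k) = 0 := by
    simp [hlift]
  simp only [Finset.mul_sum, mul_left_comm _ (algebraMap _ _ _)] at h1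
  rw [Finset.sum_comm] at h1
  simp only [← Finset.mul_sum, ← Units.val_mul, ← map_mul] at h1
  rw [Finset.sum_eq_single g (fun h _ hg => by rw [hsum _ (by
    rwa [Ne, inv_mul_eq_one, eq_comm]), mul_zero]) (by simp)] at h1
  simp only [inv_mul_cancel, map_one, Units.val_one, Finset.sum_const, Finset.card_univ,
    nsmul_eq_mul, mul_one, ← Nat.card_eq_fintype_card, hcard] at h1
  have h2 : ((Nat.card H : ℕ) : BigField l k) ≠ 0 := Nat.cast_ne_zero.2 Nat.card_pos.ne'
  exact algebraMap_bigField_injective (by simpa [h2] using h1)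

/-- The reduction of a point of the group ring over `𝒪`. -/
lemma red_comp_eq [Fact (IsPGroup l H)] {κ : Type*} [Field κ] [CharP κ l]
    (f : MonoidAlgebra (WittVector l k) H →+* κ) (i : k →+* κ)
    (hf : ∀ w, f (algebraMap (WittVector l k) (MonoidAlgebra (WittVector l k) H) w) = i (WittVector.constantCoeff w)) :
    f = i.comp (res l k _) := by
  refine MonoidAlgebra.ringHom_ext (fun w => ?_) fun h => ?_
  · have := hf w
    rw [MonoidAlgebra.coe_algebraMap] at this
    simpa [res_groupRing_apply] using this
  · rw [RingHom.comp_apply, res_groupRing_apply, aug_single, map_one, map_one]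
    -- In characteristic `l` the only root of unity of `l`-power order is `1`.
    obtain ⟨n, hn⟩ := (Fact.out : IsPGroup l H) h
    have h1 : f (MonoidAlgebra.single h 1) ^ l ^ n = 1 := by
      rw [← map_pow, MonoidAlgebra.single_pow, hn, one_pow, ← MonoidAlgebra.one_def, map_one]
    have : ExpChar κ l := ExpChar.prime Fact.out
    exact iterateFrobenius_inj κ l n (by simpa [iterateFrobenius_def] using h1)

end Points

/-- `H` is the image of `y ↦ y ^ m`, with `m` the prime-to-`l` part of `|E|`; the kernel is killed
by `m`, so Cauchy's theorem excludes `l` from its order. Shrinking `H` to the lowest universe keeps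
`W(k)[H]` in the universe of `k`. -/
lemma exists_pGroup_quotient (l : ℕ) [Fact l.Prime] (E : Type w) [CommGroup E] [Finite E] :
    ∃ (H : Type) (_ : CommGroup H) (_ : Finite H) (p : E →* H), IsPGroup l H ∧
      Function.Surjective p ∧ l.Coprime (Nat.card p.ker) := by
  set m := ordCompl[l] (Nat.card E) with hm
  set f : E →* E := powMonoidHom m
  have : Small.{0} f.range := inferInstance
  set e := (Shrink.mulEquiv (α := f.range)).symm with he
  have hker : (e.toMonoidHom.comp f.rangeRestrict).ker = f.ker := by
    ext y
    simp [MonoidHom.mem_ker]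
  refine ⟨Shrink.{0} f.range, inferInstance, inferInstance, e.toMonoidHom.comp f.rangeRestrict,
    ?_, e.surjective.comp f.rangeRestrict_surjective, ?_⟩
  · intro h
    obtain ⟨⟨_, y, rfl⟩, rfl⟩ := e.surjective h
    refine ⟨(Nat.card E).factorization l, ?_⟩
    rw [← map_pow, map_eq_one_iff e e.injective, ← Subtype.val_inj]
    change (y ^ m) ^ _ = (1 : E)
    rw [← pow_mul, mul_comm, hm, Nat.ordProj_mul_ordCompl_eq_self, pow_card_eq_one']
  · rw [hker, Nat.Prime.coprime_iff_not_dvd Fact.out]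
    intro hd
    obtain ⟨y, hy⟩ := exists_prime_orderOf_dvd_card' l hd
    refine Nat.not_dvd_ordCompl (n := Nat.card E) (Fact.out : l.Prime) Nat.card_pos.ne' ?_
    have h : y ^ m = 1 := Subtype.ext (MonoidHom.mem_ker.1 y.2)
    have h' := orderOf_dvd_of_pow_eq_one h
    rwa [hy] at h'

/-! ### The `K`-points of the group ring are the characters in `S_θ` -/

section Points

set_option linter.unusedSectionVars false

variable {l : ℕ} [Fact l.Prime] {k : Type u} [Field k] [Finite k] [CharP k l]
variable {H : Type} [CommGroup H] [Finite H]
variable {F : Type v} [Field F] {F₂ : Type w} [Field F₂] [Finite F₂]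
variable {red : BigInt l k →+* AlgebraicClosure k} {θ : F₂ˣ →* kˣ} {p : F₂ˣ →* H}

/-- The quotient of the two sides is integral, an `m`-th root of unity, and reduces to `1`. -/
lemma coe_eq_of_mem_charLifts
    (hred : ∀ a : WittVector l k, red (algebraMap (WittVector l k) (BigInt l k) a) =
      algebraMap k (AlgebraicClosure k) (WittVector.constantCoeff a))
    {θt : F₂ˣ →* (BigField l k)ˣ} (hθt : θt ∈ CharLifts F red θ) {y : F₂ˣ} {m : ℕ}
    (hm : l.Coprime m) (hy : y ^ m = 1) :
    (θt y : BigField l k) = algebraMap _ _ (teichChar l θ y : WittVector l k) := by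
  have : CharP (AlgebraicClosure k) l :=
    charP_of_injective_algebraMap (algebraMap k (AlgebraicClosure k)).injective l
  obtain ⟨a, ha, hra⟩ := hθt.2 y
  set t := Units.map (algebraMap (WittVector l k) (BigField l k) : _ →* BigField l k)
    (teichChar l θ y) with ht
  set x : BigInt l k := a * algebraMap _ _ ((teichChar l θ y)⁻¹ : (WittVector l k)ˣ).1 with hx
  have hxt : (x : BigField l k) = ((θt y * t⁻¹ : (BigField l k)ˣ) : BigField l k) := by
    rw [Units.val_mul, ← ha]
    rfl
  have hx1 : x = 1 := by
    refine eq_one_of_pow_eq_one hm (Fact.out : l.Prime).one_lt.ne' red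
      (fun s hs t h => (mul_eq_zero.1 h).resolve_left fun h0 => hs (by rw [h0, map_zero])) ?_ ?_
    · rw [hx, map_mul, hra, hred, ← map_inv, constantCoeff_teichChar, ← map_mul, ← Units.val_mul,
        map_inv, mul_inv_cancel, Units.val_one, map_one]
    · apply Subtype.val_injective
      change (x : BigField l k) ^ m = 1
      rw [hxt, ← Units.val_pow_eq_pow_val, mul_pow, inv_pow, ht, ← map_pow, ← map_pow, ← map_pow,
        hy, map_one, map_one, map_one, inv_one, mul_one, Units.val_one]
  have h1 : θt y * t⁻¹ = 1 := by
    apply Units.ext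
    rw [← hxt, hx1]
    rfl
  exact congrArg Units.val (mul_inv_eq_one.1 h1)

lemma existsUnique_algHom_of_mem_charLifts (hp : Function.Surjective p)
    (hcop : l.Coprime (Nat.card p.ker))
    (hred : ∀ a : WittVector l k, red (algebraMap (WittVector l k) (BigInt l k) a) =
      algebraMap k (AlgebraicClosure k) (WittVector.constantCoeff a))
    {θt : F₂ˣ →* (BigField l k)ˣ} (hθt : θt ∈ CharLifts F red θ) :
    ∃! f : MonoidAlgebra (WittVector l k) H →ₐ[WittVector l k] BigField l k,
      ∀ y, f (univChar l θ p y).1 = θt y :=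
  existsUnique_algHom_univChar hp θt fun _ hy =>
    coe_eq_of_mem_charLifts hred hθt hcop (pow_card_ker hy)

/-- A point has integral values because the group ring is finite over `W(k)`. Its reduction is
forced, as `H` becomes trivial in characteristic `l`, and `θt ^ q ≠ θt` can be checked after
reduction. -/
lemma mem_charLifts_of_algHom [Fact (IsPGroup l H)]
    (hred : ∀ a : WittVector l k, red (algebraMap (WittVector l k) (BigInt l k) a) =
      algebraMap k (AlgebraicClosure k) (WittVector.constantCoeff a))
    (hθ : θ ^ Nat.card F ≠ θ)
    (f : MonoidAlgebra (WittVector l k) H →ₐ[WittVector l k] BigField l k) :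
    (Units.map (f : _ →* BigField l k)).comp (univChar l θ p) ∈ CharLifts F red θ := by
  have : CharP (AlgebraicClosure k) l :=
    charP_of_injective_algebraMap (algebraMap k (AlgebraicClosure k)).injective l
  set g : MonoidAlgebra (WittVector l k) H →ₐ[WittVector l k] BigInt l k :=
    f.codRestrict (BigInt l k) fun x => (Algebra.IsIntegral.isIntegral x).map f with hg
  have hgx : ∀ x, red (g x) = algebraMap k (AlgebraicClosure k) (res l k _ x) := fun x =>
    RingHom.congr_fun (red_comp_eq (red.comp (g : _ →+* BigInt l k)) (algebraMap k _) fun w => by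
      rw [RingHom.comp_apply, AlgHom.coe_toRingHom, AlgHom.commutes, hred]) x
  have hgy : ∀ y, red (g (univChar l θ p y).1) = algebraMap k (AlgebraicClosure k) (θ y : k) :=
    fun y => by rw [hgx, res_groupRing_apply, aug_univChar, constantCoeff_teichChar]
  refine ⟨fun h => hθ ?_, fun y => ⟨g (univChar l θ p y).1, rfl, hgy y⟩⟩
  ext y
  have h1 := congrArg Units.val (DFunLike.congr_fun h y)
  have h2 : g (univChar l θ p y).1 ^ Nat.card F = g (univChar l θ p y).1 :=
    Subtype.val_injective h1
  apply (algebraMap k (AlgebraicClosure k)).injective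
  rw [MonoidHom.pow_apply, Units.val_pow_eq_pow_val, map_pow, ← hgy, ← map_pow, h2]

lemma eq_zero_of_forall_charLifts [Fact (IsPGroup l H)]
    (hred : ∀ a : WittVector l k, red (algebraMap (WittVector l k) (BigInt l k) a) =
      algebraMap k (AlgebraicClosure k) (WittVector.constantCoeff a))
    (hθ : θ ^ Nat.card F ≠ θ) (x : MonoidAlgebra (WittVector l k) H)
    (hx : ∀ θt ∈ CharLifts F red θ,
      ∀ f : MonoidAlgebra (WittVector l k) H →ₐ[WittVector l k] BigField l k,
        (∀ y, f (univChar l θ p y).1 = (θt y : BigField l k)) → f x = 0) : x = 0 :=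
  eq_zero_of_forall_lift x fun _ =>
    hx _ (mem_charLifts_of_algHom (p := p) hred hθ (MonoidAlgebra.lift _ _ _ _)) _ fun _ => rfl

end Points

/-! ### The universal cuspidal representation -/

section UniversalRep

set_option linter.unusedSectionVars false

variable {l : ℕ} [Fact l.Prime] {k : Type u} [Field k] [Finite k] [CharP k l]
variable {H : Type} [CommGroup H] [Finite H]
variable {F : Type v} [Field F] {F₂ : Type w} [Field F₂] [Finite F₂] [Algebra F F₂]
variable {θ : F₂ˣ →* kˣ} {p : F₂ˣ →* H}

lemma isUnit_natCast_of_coprime (k : Type u) [Field k] [Finite k] [CharP k l] {m : ℕ} (hm : l.Coprime m)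
    (A : Type*) [CommRing A] [Algebra (WittVector l k) A] : IsUnit (m : A) := by
  rw [← map_natCast (algebraMap (WittVector l k) A)]
  exact (isUnit_natCast_witt (k := k) hm).map _

/-- Raising to the power `|H| = l ^ n` moves any element into `ker p`, and the iterated Frobenius of
`k` is injective, so the inequality survives. -/
lemma exists_mem_ker_pow_ne (hH : IsPGroup l H) (hθ : θ ^ Nat.card F ≠ θ) :
    ∃ s ∈ p.ker, (θ s : k) ^ Nat.card F ≠ θ s := by
  obtain ⟨y, hy⟩ : ∃ y, (θ y : k) ^ Nat.card F ≠ θ y := by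
    by_contra! h
    exact hθ (MonoidHom.ext fun y => Units.ext (h y))
  obtain ⟨n, hn⟩ := (IsPGroup.iff_card (p := l) (G := H)).1 hH
  refine ⟨y ^ l ^ n, ?_, fun h => hy ?_⟩
  · rw [MonoidHom.mem_ker, map_pow, ← hn, pow_card_eq_one']
  · have : ExpChar k l := ExpChar.prime Fact.out
    apply iterateFrobenius_inj k l n
    rw [map_pow, iterateFrobenius_def, ← Units.val_pow_eq_pow_val, ← map_pow, h]

/-- Write `u` for `univChar`. Central values are read off at `z u₀`, `u₀` unipotent. The trace at a
non-central `y` mixes `u y` with `(u y) ^ q`; passing to `y * s` scales these by `c` and `c ^ q`,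
and since `c - c ^ q` is a unit the two traces can be solved for `u y`. -/
lemma univChar_mem_of_trace_mem [Finite F] {b : Module.Basis (Fin 2) F F₂}
    {t : GL (Fin 2) F → MonoidAlgebra (WittVector l k) H}
    (ht : IsCuspidalCharacter b (univChar l θ p) t)
    {S : Subalgebra (WittVector l k) (MonoidAlgebra (WittVector l k) H)} (hS : ∀ g, t g ∈ S)
    {s : F₂ˣ} (hs : s ∈ p.ker) (hθs : (θ s : k) ^ Nat.card F ≠ θ s) (y : F₂ˣ) :
    (univChar l θ p y).1 ∈ S := by
  set c : WittVector l k := (teichChar l θ s).1 with hc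
  have hmul : ∀ y, (univChar l θ p (y * s)).1 = c • (univChar l θ p y).1 := fun y => by
    rw [map_mul, Units.val_mul, coe_univChar θ p s, MonoidHom.mem_ker.1 hs, mul_comm,
      Algebra.smul_def, ← MonoidAlgebra.one_def, mul_one]
  have hcu : IsUnit (c - c ^ Nat.card F) := by
    apply isUnit_witt_of_constantCoeff
    rw [map_sub, map_pow, hc, constantCoeff_teichChar, sub_ne_zero]
    exact hθs.symm
  obtain ⟨-, h2, -, h4⟩ := ht
  have hcentral : ∀ y ∈ (inclUnits F F₂).range, (univChar l θ p y).1 ∈ S := by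
    rintro _ ⟨z, rfl⟩
    have h := h2 (Matrix.GeneralLinearGroup.mkOfDetNeZero ((z : F) • !![1, 1; 0, 1])
      (by simp [Matrix.det_fin_two])) z 1 one_ne_zero rfl
    rw [← neg_neg (univChar l θ p (inclUnits F F₂ z)).1, ← h]
    exact S.neg_mem (hS _)
  by_cases hy : y ∈ (inclUnits F F₂).range
  · exact hcentral y hy
  by_cases hys : y * s ∈ (inclUnits F F₂).range
  · have h : (univChar l θ p y).1 =
        ((teichChar l θ s)⁻¹ : (WittVector l k)ˣ).1 • (univChar l θ p (y * s)).1 := by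
      rw [hmul, smul_smul, hc, Units.inv_mul, one_smul]
    rw [h]
    exact S.smul_mem (hcentral _ hys) _
  · have h : (univChar l θ p y).1 =
        hcu.unit⁻¹.1 • (c ^ Nat.card F • t (torus b y) - t (torus b (y * s))) := by
      have h5 : c ^ Nat.card F • t (torus b y) - t (torus b (y * s)) =
          (c - c ^ Nat.card F) • (univChar l θ p y).1 := by
        rw [h4 y hy, h4 _ hys, hmul, smul_pow, sub_smul, smul_sub, smul_neg]
        abel
      rw [h5, smul_smul, IsUnit.val_inv_mul, one_smul]
    rw [h]
    exact S.smul_mem (S.sub_mem (S.smul_mem (hS _) _) (hS _)) _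

/-- The character of a representation with the universal cuspidal character generates the group
ring. -/
lemma eq_top_of_trace_mem [Finite F] (hH : IsPGroup l H) (hp : Function.Surjective p)
    (hθ : θ ^ Nat.card F ≠ θ) {b : Module.Basis (Fin 2) F F₂}
    {t : GL (Fin 2) F → MonoidAlgebra (WittVector l k) H}
    (ht : IsCuspidalCharacter b (univChar l θ p) t)
    {S : Subalgebra (WittVector l k) (MonoidAlgebra (WittVector l k) H)} (hS : ∀ g, t g ∈ S) :
    S = ⊤ := by
  obtain ⟨s, hs, hθs⟩ := exists_mem_ker_pow_ne (F := F) (p := p) hH hθ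
  exact adjoin_univChar hp (univChar_mem_of_trace_mem ht hS hs hθs)

variable [Fintype F] [Fintype F₂] [DecidableEq F] [DecidableEq F₂]

/-- The element `s ^ (q - 1)` has norm `1`, and `χ s ^ q - χ s = χ s * (χ (s ^ (q - 1)) - 1)`. -/
lemma generalPosition_of_isUnit_sub {A : Type x} [CommRing A]
    {χ : F₂ˣ →* Aˣ} {s : F₂ˣ} (h : IsUnit ((χ s : A) ^ Nat.card F - χ s)) :
    GeneralPosition F (MulChar.ofUnitHom χ) := by
  have hq : 1 ≤ Nat.card F := Nat.card_pos
  refine generalPosition_of_isUnit (s₀ := ((s ^ (Nat.card F - 1) : F₂ˣ) : F₂)) ?_ ?_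
  · have : Algebra.norm F (s : F₂) ≠ 0 := by
      rw [Algebra.norm_ne_zero_iff]
      exact s.ne_zero
    rw [Units.val_pow_eq_pow_val, map_pow, Nat.card_eq_fintype_card, FiniteField.pow_card_sub_one_eq_one _ this]
  · rw [MulChar.ofUnitHom_coe, map_pow]
    have h1 : (χ s : A) ^ Nat.card F - χ s = χ s * ((χ s ^ (Nat.card F - 1) : Aˣ) - 1) := by
      rw [mul_sub, mul_one, ← Units.val_mul, ← pow_succ', Nat.sub_add_cancel hq,
        Units.val_pow_eq_pow_val]
    rw [h1] at h
    exact isUnit_of_mul_isUnit_right h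

lemma generalPosition_univChar [Fact (IsPGroup l H)] (hθ : θ ^ Nat.card F ≠ θ) : GeneralPosition F (MulChar.ofUnitHom (univChar l θ p)) := by
  obtain ⟨y, hy⟩ : ∃ y, (θ y : k) ^ Nat.card F ≠ θ y := by
    by_contra! h
    exact hθ (MonoidHom.ext fun y => Units.ext (h y))
  refine generalPosition_of_isUnit_sub (s := y) (isUnit_of_res_ne_zero (l := l) (k := k) ?_)
  rw [map_sub, map_pow, res_groupRing_apply, aug_univChar, constantCoeff_teichChar, sub_ne_zero]
  exact hy

end UniversalRep

/-! ### Lifts are induced by the universal representation -/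

section Transfer

set_option linter.unusedSectionVars false

variable {W : Type u} [CommRing W] {H : Type} [CommGroup H]
variable {G : Type v} [Group G] [Fintype G] {n : ℕ}
variable {A : Type x} [CommRing A] [Algebra W A]

/-- The coefficient of the identity in a group ring. -/
def coeffOne (W : Type u) [CommRing W] (H : Type) [CommGroup H] : MonoidAlgebra W H →ₗ[W] W :=
  Finsupp.lapply 1 ∘ₗ (MonoidAlgebra.coeffLinearEquiv W).toLinearMap

lemma coeffOne_apply (a : MonoidAlgebra W H) : coeffOne W H a = a.coeff 1 := rfl

/-- `coeffOne` is a symmetrizing form on the group ring, with dual bases `h` and `h⁻¹`. -/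
lemma sum_coeffOne_single [Fintype H] (a : MonoidAlgebra W H) :
    ∑ h : H, MonoidAlgebra.single h⁻¹ (coeffOne W H (a * MonoidAlgebra.single h 1)) = a := by
  ext1
  refine Finsupp.ext fun g => ?_
  rw [MonoidAlgebra.coeff_sum, Finsupp.finsetSum_apply, Finset.sum_eq_single g⁻¹]
  · rw [MonoidAlgebra.coeff_single, inv_inv, Finsupp.single_eq_same, coeffOne_apply, mul_comm,
      MonoidAlgebra.coeff_single_mul_apply, one_mul, inv_inv, mul_one]
  · intro h _ hg
    rw [MonoidAlgebra.coeff_single, Finsupp.single_eq_of_ne]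
    rintro rfl
    exact hg (inv_inv h).symm
  · simp

/-- The map attaching to the vector `r • e_i` of the representation `ϖ` the sum of the
`ρ g • e_{i₀}` weighted by the coefficient of the identity in the `i₀`-th coordinate of
`ϖ g⁻¹ (r • e_i)`. It intertwines `ϖ` and `ρ`. -/
def transfer (i₀ : Fin n) (ϖ : G →* GL (Fin n) (MonoidAlgebra W H)) (ρ : G →* GL (Fin n) A) :
    MonoidAlgebra W H →ₗ[W] Matrix (Fin n) (Fin n) A where
  toFun r := Matrix.of fun j i => ∑ g, coeffOne W H ((ϖ g⁻¹).1 i₀ i * r) • (ρ g).1 j i₀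
  map_add' r s := by
    ext j i
    simp [mul_add, add_smul, Finset.sum_add_distrib]
  map_smul' c r := by
    ext j i
    simp [mul_smul, Finset.smul_sum]

lemma transfer_apply (i₀ : Fin n) (ϖ : G →* GL (Fin n) (MonoidAlgebra W H))
    (ρ : G →* GL (Fin n) A) (r : MonoidAlgebra W H) (j i : Fin n) :
    transfer i₀ ϖ ρ r j i = ∑ g, coeffOne W H ((ϖ g⁻¹).1 i₀ i * r) • (ρ g).1 j i₀ := rfl

/-- Reindex the average by `g ↦ h * g`. The entries of `ϖ h` stay inside `transfer`, which is only
`W`-linear. -/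
lemma transfer_equivariant (i₀ : Fin n) (ϖ : G →* GL (Fin n) (MonoidAlgebra W H))
    (ρ : G →* GL (Fin n) A) (h : G) (r : MonoidAlgebra W H) (j i : Fin n) :
    ∑ i', transfer i₀ ϖ ρ ((ϖ h).1 i' i * r) j i' =
      ((ρ h).1 * transfer i₀ ϖ ρ r) j i := by
  have h1 : ∀ g, ∑ i', coeffOne W H ((ϖ g⁻¹).1 i₀ i' * ((ϖ h).1 i' i * r)) =
      coeffOne W H ((ϖ (g⁻¹ * h)).1 i₀ i * r) := fun g => by
    rw [map_mul ϖ, Units.val_mul, Matrix.mul_apply, Finset.sum_mul, map_sum]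
    simp only [mul_assoc]
  simp only [transfer_apply, Matrix.mul_apply]
  rw [Finset.sum_comm]
  simp only [← Finset.sum_smul, h1, Finset.mul_sum]
  rw [Finset.sum_comm, ← Equiv.sum_comp (Equiv.mulLeft h)]
  refine Finset.sum_congr rfl fun g _ => ?_
  simp only [Equiv.coe_mulLeft, map_mul ρ, Units.val_mul, Matrix.mul_apply, mul_inv_rev,
    inv_mul_cancel_right, Finset.smul_sum, mul_smul_comm]

/-- Summing over dual bases undoes `coeffOne` and leaves the average with values in the group ring.
-/
lemma sum_single_mul_transfer [Fintype H] (i₀ : Fin n) (ϖ : G →* GL (Fin n) (MonoidAlgebra W H))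
    (j i : Fin n) :
    ∑ h : H, MonoidAlgebra.single h⁻¹ (1 : W) * transfer i₀ ϖ ϖ (MonoidAlgebra.single h 1) j i =
      ∑ g, (ϖ g⁻¹).1 i₀ i * (ϖ g).1 j i₀ := by
  simp only [transfer_apply, Finset.mul_sum]
  rw [Finset.sum_comm]
  refine Finset.sum_congr rfl fun g _ => ?_
  conv_rhs => rw [← sum_coeffOne_single ((ϖ g⁻¹).1 i₀ i)]
  rw [Finset.sum_mul]
  refine Finset.sum_congr rfl fun h _ => ?_
  rw [mul_smul_comm, ← smul_mul_assoc, MonoidAlgebra.smul_single, smul_eq_mul, mul_one]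

/-- This is Schur's orthogonality relation: the entries assemble to `ϖ g⁻¹ * ϖ g = 1`, once for each
`g`. -/
lemma sum_sum_single_mul_transfer [Fintype H] (i₀ : Fin n)
    (ϖ : G →* GL (Fin n) (MonoidAlgebra W H)) :
    ∑ i, ∑ h : H, MonoidAlgebra.single h⁻¹ (1 : W) *
      transfer i₀ ϖ ϖ (MonoidAlgebra.single h 1) i i = (Fintype.card G : MonoidAlgebra W H) := by
  simp only [sum_single_mul_transfer]
  rw [Finset.sum_comm]
  simp only [← Matrix.mul_apply, ← Units.val_mul, ← map_mul, inv_mul_cancel, map_one,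
    Units.val_one, Matrix.one_apply_eq, Finset.sum_const, Finset.card_univ, nsmul_eq_mul, mul_one]

end Transfer

section Universality

set_option linter.unusedSectionVars false

variable {l : ℕ} [Fact l.Prime] {k : Type u} [Field k] [Finite k] [CharP k l]
variable {H : Type} [CommGroup H] [Finite H]
variable {F : Type v} [Field F] [Fintype F] [DecidableEq F]
variable {ϖ : GL (Fin 2) F →* GL (Fin (Nat.card F - 1)) (MonoidAlgebra (WittVector l k) H)}

/-- On the affine group the entries of `ϖ` come from `W(k)`, so they pass through `transfer`; for
each fixed `r` it then intertwines the affine actions. -/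
lemma transfer_mul_affRep {A : Type x} [CommRing A] [Algebra (WittVector l k) A]
    (h_aff : ∀ a b, (ϖ (affine a b)).1 = affRep _ a b) (i₀ : Fin (Nat.card F - 1))
    (ρ : GL (Fin 2) F →* GL (Fin (Nat.card F - 1)) A) (a : Fˣ) (b : F)
    (r : MonoidAlgebra (WittVector l k) H) :
    transfer i₀ ϖ ρ r * affRep A a b = (ρ (affine a b)).1 * transfer i₀ ϖ ρ r := by
  ext j i
  rw [← transfer_equivariant, Matrix.mul_apply]
  refine Finset.sum_congr rfl fun i' _ => ?_
  rw [h_aff, ← map_affRep (algebraMap (WittVector l k) (MonoidAlgebra (WittVector l k) H)),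
    Matrix.map_apply, ← Algebra.smul_def, map_smul, Matrix.smul_apply, Algebra.smul_def, mul_comm,
    ← map_affRep (algebraMap (WittVector l k) A), Matrix.map_apply]

lemma natCast_mul_cancel {m : ℕ} (hm : m ≠ 0) {y z : MonoidAlgebra (WittVector l k) H}
    (h : (m : MonoidAlgebra (WittVector l k) H) * y = m * z) : y = z := by
  have := charZero_witt l k
  ext1
  refine Finsupp.ext fun g => ?_
  have h1 := congrArg (fun x => x.coeff g) h
  simp only [← nsmul_eq_mul, MonoidAlgebra.coeff_smul_apply] at h1
  rw [nsmul_eq_mul, nsmul_eq_mul] at h1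
  exact mul_left_cancel₀ (Nat.cast_ne_zero.2 hm) h1

/-- The transfer from the universal representation to itself. -/
lemma transfer_self (hq : l.Coprime (Nat.card F))
    (h_aff : ∀ a b, (ϖ (affine a b)).1 = affRep _ a b)
    (hgen : ∀ S : Subalgebra (WittVector l k) (MonoidAlgebra (WittVector l k) H),
      (∀ g, tr (ϖ g) ∈ S) → S = ⊤)
    {m : ℕ} (hcard : Nat.card (GL (Fin 2) F) = (Nat.card F - 1) * Nat.card H * m)
    (i₀ : Fin (Nat.card F - 1)) (r : MonoidAlgebra (WittVector l k) H) :
    transfer i₀ ϖ ϖ r =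
      (r * m) • (1 : Matrix (Fin (Nat.card F - 1)) (Fin (Nat.card F - 1)) _) := by
  have : Fintype H := Fintype.ofFinite H
  have hsc : ∀ r, ∃ c, transfer i₀ ϖ ϖ r =
      c • (1 : Matrix (Fin (Nat.card F - 1)) (Fin (Nat.card F - 1)) _) := fun r =>
    eq_smul_of_commute_affRep (isUnit_natCast_of_coprime k hq _) fun a b => by
      rw [transfer_mul_affRep h_aff, h_aff]
  choose c hc using hsc
  have hcapp : ∀ r j, transfer i₀ ϖ ϖ r j j = c r := fun r j => by simp [hc]
  have hadd : ∀ r s, c (r + s) = c r + c s := fun r s => by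
    rw [← hcapp _ i₀, map_add, Matrix.add_apply, hcapp, hcapp]
  have hsmul : ∀ (t : WittVector l k) r, c (t • r) = t • c r := fun t r => by
    rw [← hcapp _ i₀, map_smul, Matrix.smul_apply, hcapp]
  have hmat : ∀ g j i r, c ((ϖ g).1 j i * r) = (ϖ g).1 j i * c r := fun g j i r => by
    have h1 := transfer_equivariant i₀ ϖ ϖ g r j i
    simp only [hc, Matrix.smul_apply, Matrix.one_apply, smul_eq_mul, mul_ite, mul_one, mul_zero,
      Finset.sum_ite_eq, Finset.mem_univ, if_true, Matrix.mul_smul] at h1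
    rw [h1, mul_comm]
  -- The `r` over which `c` is linear form a subalgebra. It contains the matrix entries of `ϖ`,
  -- hence the traces, hence everything.
  have hlin : ∀ r s, c (r * s) = r * c s := by
    intro r
    let S : Subalgebra (WittVector l k) (MonoidAlgebra (WittVector l k) H) :=
      { carrier := {r | ∀ s, c (r * s) = r * c s}
        mul_mem' := fun {a b} ha hb s => by rw [mul_assoc, ha, hb, mul_assoc]
        add_mem' := fun {a b} ha hb s => by rw [add_mul, hadd, ha, hb, add_mul]
        algebraMap_mem' := fun t s => by rw [← Algebra.smul_def, hsmul, Algebra.smul_def] }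
    have hS : S = ⊤ := hgen S fun g => S.sum_mem fun i _ => hmat g i i
    exact (hS ▸ Algebra.mem_top : r ∈ S)
  -- The orthogonality relation reads `(q - 1) * |H| * c 1 = |G|`, and the group ring is
  -- torsion-free.
  have hc1 : c 1 = m := by
    have h1 := sum_sum_single_mul_transfer i₀ ϖ
    have h2 : ∀ h : H, MonoidAlgebra.single h⁻¹ (1 : WittVector l k) *
        c (MonoidAlgebra.single h 1) = c 1 := fun h => by
      rw [← hlin, MonoidAlgebra.single_mul_single, inv_mul_cancel, one_mul, MonoidAlgebra.one_def]
    simp only [hcapp, h2, Finset.sum_const, Finset.card_univ, Fintype.card_fin, nsmul_eq_mul] at h1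
    rw [← Nat.card_eq_fintype_card (α := GL (Fin 2) F), hcard, Nat.cast_mul, Nat.cast_mul,
      ← Nat.card_eq_fintype_card, ← mul_assoc, ← Nat.cast_mul] at h1
    refine natCast_mul_cancel (mul_ne_zero ?_ Nat.card_pos.ne') h1
    rintro h0
    exact (Fin.cast h0 i₀).elim0
  rw [hc, ← hc1, ← hlin, mul_one]

/-- Every lift of the reduction of the universal representation to a local algebra is induced by
the universal representation. -/
theorem exists_algHom_conj [Fact (IsPGroup l H)] (hq : l.Coprime (Nat.card F))
    (h_aff : ∀ a b, (ϖ (affine a b)).1 = affRep _ a b)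
    (hgen : ∀ S : Subalgebra (WittVector l k) (MonoidAlgebra (WittVector l k) H),
      (∀ g, tr (ϖ g) ∈ S) → S = ⊤)
    {m : ℕ} (hcard : Nat.card (GL (Fin 2) F) = (Nat.card F - 1) * Nat.card H * m)
    (hm : l.Coprime m)
    {A : Type u} [CommRing A] [Algebra (WittVector l k) A] [LocalCoeff l k A]
    (ρ : GL (Fin 2) F →* GL (Fin (Nat.card F - 1)) A)
    (hρ : (Matrix.GeneralLinearGroup.map (res l k A)).comp ρ =
      (Matrix.GeneralLinearGroup.map (res l k _)).comp ϖ) :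
    ∃ (f : MonoidAlgebra (WittVector l k) H →ₐ[WittVector l k] A)
      (P : GL (Fin (Nat.card F - 1)) A), Matrix.GeneralLinearGroup.map (res l k A) P = 1 ∧
      ∀ g, ρ g = P * Matrix.GeneralLinearGroup.map (f : _ →+* A) (ϖ g) * P⁻¹ := by
  have hq0 : 0 < Nat.card F - 1 := Nat.sub_pos_of_lt (Finite.one_lt_card)
  set i₀ : Fin (Nat.card F - 1) := ⟨0, hq0⟩
  have hmu : IsUnit (m : A) := isUnit_natCast_of_coprime k hm A
  have hmk : (m : k) ≠ 0 := by
    have := hmu.map (res l k A)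
    rw [map_natCast] at this
    exact this.ne_zero
  -- Since `ρ` and `ϖ` have the same reduction, so do their transfers at `1`; the one for `ϖ` is the
  -- scalar `m`.
  have hres1 : (transfer i₀ ϖ ρ 1).map (res l k A) = (m : k) • 1 := by
    have h1 := congrArg (fun M => M.map (res l k (MonoidAlgebra (WittVector l k) H)))
      (transfer_self hq h_aff hgen hcard i₀ 1)
    rw [one_mul] at h1
    have h2 : ((m : MonoidAlgebra (WittVector l k) H) •
        (1 : Matrix (Fin (Nat.card F - 1)) (Fin (Nat.card F - 1)) _)).map
        (res l k (MonoidAlgebra (WittVector l k) H)) = (m : k) • 1 := by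
      ext i j
      simp only [Matrix.map_apply, Matrix.smul_apply, Matrix.one_apply, smul_eq_mul]
      split_ifs <;> simp
    rw [← h2, ← h1]
    ext j i
    simp only [Matrix.map_apply, transfer_apply, map_sum, Algebra.smul_def, map_mul, res_algebraMap]
    refine Finset.sum_congr rfl fun g _ => ?_
    congr 1
    exact congrArg (fun X : GL (Fin (Nat.card F - 1)) k => X.1 j i₀) (DFunLike.congr_fun hρ g)
  have hdet : IsUnit (transfer i₀ ϖ ρ 1).det := by
    apply isUnit_of_res_ne_zero (l := l) (k := k)
    rw [RingHom.map_det, RingHom.mapMatrix_apply, hres1, Matrix.det_smul, Matrix.det_one, mul_one]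
    exact pow_ne_zero _ hmk
  set S : GL (Fin (Nat.card F - 1)) A := Matrix.GeneralLinearGroup.mk'' _ hdet with hS
  have hSaff : ∀ a b, (S⁻¹).1 * (ρ (affine a b)).1 = affRep A a b * (S⁻¹).1 := by
    intro a b
    have h1 : S.1 * affRep A a b = (ρ (affine a b)).1 * S.1 := transfer_mul_affRep h_aff i₀ ρ a b 1
    rw [← Units.inv_mul_cancel_left S (affRep A a b), h1, ← mul_assoc, mul_assoc, Units.mul_inv,
      mul_one]
  -- After composition with `S⁻¹` the transfer commutes with the affine group, so Schur's lemma
  -- makes it a scalar `c r`; this `c` will be the classifying homomorphism.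
  have hsc : ∀ r, ∃ c, (S⁻¹).1 * transfer i₀ ϖ ρ r =
      c • (1 : Matrix (Fin (Nat.card F - 1)) (Fin (Nat.card F - 1)) _) := fun r =>
    eq_smul_of_commute_affRep (isUnit_natCast_of_coprime k hq _) fun a b => by
      rw [Matrix.mul_assoc, transfer_mul_affRep h_aff, ← Matrix.mul_assoc, ← Matrix.mul_assoc, hSaff]
  choose c hc using hsc
  have hcS : ∀ r, transfer i₀ ϖ ρ r = c r • S.1 := fun r => by
    rw [← mul_one S.1, ← Matrix.mul_smul, ← hc, ← Matrix.mul_assoc, Units.mul_inv, one_mul]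
  have hcapp : ∀ r, c r = ((S⁻¹).1 * transfer i₀ ϖ ρ r) i₀ i₀ := fun r => by
    rw [hc, Matrix.smul_apply, Matrix.one_apply_eq, smul_eq_mul, mul_one]
  have hadd : ∀ r s, c (r + s) = c r + c s := fun r s => by
    rw [hcapp, map_add, Matrix.mul_add, Matrix.add_apply, ← hcapp, ← hcapp]
  have hsmul : ∀ (t : WittVector l k) r, c (t • r) = t • c r := fun t r => by
    rw [hcapp, map_smul, Matrix.mul_smul, Matrix.smul_apply, ← hcapp]
  have hc1 : c 1 = 1 := by
    rw [hcapp]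
    change ((S⁻¹).1 * S.1) i₀ i₀ = 1
    rw [Units.inv_mul, Matrix.one_apply_eq]
  -- Equivariance with `r = 1` identifies `c` of the entries of `ϖ g` with the entries of `S⁻¹ * ρ g
  -- * S`; for general `r` it then says that `c` is multiplicative against such entries.
  have hmat : ∀ g j i r, c ((ϖ g).1 j i * r) = (S⁻¹ * ρ g * S).1 j i * c r := fun g j i r => by
    have h1 : S.1 * Matrix.of (fun j i => c ((ϖ g).1 j i * r)) = (ρ g).1 * S.1 * c r • 1 := by
      ext j i
      have h2 := transfer_equivariant i₀ ϖ ρ g r j i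
      rw [hcS r] at h2
      rw [Matrix.mul_smul, mul_one, ← Matrix.mul_smul, ← h2, Matrix.mul_apply]
      simp [hcS, mul_comm]
    have h3 : Matrix.of (fun j i => c ((ϖ g).1 j i * r)) = (S⁻¹ * ρ g * S).1 * c r • 1 := by
      rw [Units.val_mul, Units.val_mul, mul_assoc, mul_assoc, ← mul_assoc (ρ g).1, ← h1,
        ← mul_assoc, Units.inv_mul, one_mul]
    have h4 := congrFun (congrFun h3 j) i
    rw [Matrix.mul_smul, mul_one, Matrix.smul_apply, smul_eq_mul, mul_comm] at h4
    exact h4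
  have hmat1 : ∀ g j i, c ((ϖ g).1 j i) = (S⁻¹ * ρ g * S).1 j i := fun g j i => by
    rw [← mul_one ((ϖ g).1 j i), hmat, hc1, mul_one]
  have hmul : ∀ r s, c (r * s) = c r * c s := by
    intro r
    let T : Subalgebra (WittVector l k) (MonoidAlgebra (WittVector l k) H) :=
      { carrier := {r | ∀ s, c (r * s) = c r * c s}
        mul_mem' := fun {a b} ha hb s => by rw [mul_assoc, ha, hb, ha, mul_assoc]
        add_mem' := fun {a b} ha hb s => by rw [add_mul, hadd, ha, hb, hadd, add_mul]
        algebraMap_mem' := fun t s => by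
          rw [← Algebra.smul_def, hsmul, Algebra.algebraMap_eq_smul_one, hsmul, hc1, smul_mul_assoc,
            one_mul] }
    have hT : T = ⊤ := hgen T fun g => T.sum_mem fun i _ s => by
      rw [Matrix.diag_apply, hmat, hmat1]
    exact (hT ▸ Algebra.mem_top : r ∈ T)
  let f : MonoidAlgebra (WittVector l k) H →ₐ[WittVector l k] A :=
    { toFun := c
      map_one' := hc1
      map_mul' := hmul
      map_zero' := by rw [← zero_smul (WittVector l k) (1 : MonoidAlgebra _ H), hsmul, zero_smul]
      map_add' := hadd
      commutes' := fun t => by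
        rw [Algebra.algebraMap_eq_smul_one, hsmul, hc1, Algebra.algebraMap_eq_smul_one] }
  have hf : ∀ g, Matrix.GeneralLinearGroup.map (f : _ →+* A) (ϖ g) = S⁻¹ * ρ g * S := fun g => by
    ext j i
    exact hmat1 g j i
  -- `S` reduces to the scalar `m`; dividing by the central unit `m` gives a conjugating matrix that
  -- reduces to the identity.
  set μ : GL (Fin (Nat.card F - 1)) A :=
    Units.map ((Matrix.scalar (Fin (Nat.card F - 1)) : A →+* _) : A →* _) hmu.unit with hμ
  have hμ' : ∀ X : GL (Fin (Nat.card F - 1)) A, μ * X = X * μ := fun X =>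
    Units.ext (Matrix.scalar_commute (m : A) (fun _ => Commute.all _ _) X.1)
  refine ⟨f, S * μ⁻¹, ?_, fun g => ?_⟩
  · rw [map_mul, map_inv, mul_inv_eq_one]
    have h1 : (Matrix.GeneralLinearGroup.map (res l k A) μ).1 = (m : k) • 1 := by
      ext i j
      change res l k A (Matrix.scalar (Fin (Nat.card F - 1)) (hmu.unit : A) i j) = _
      rw [Matrix.scalar_apply, Matrix.diagonal_apply, Matrix.smul_apply, Matrix.one_apply,
        IsUnit.unit_spec]
      split_ifs <;> simp
    exact Units.ext (hres1.trans h1.symm)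
  · rw [hf, mul_inv_rev, inv_inv]
    have h1 : μ⁻¹ * (S⁻¹ * ρ g * S) = (S⁻¹ * ρ g * S) * μ⁻¹ := by
      rw [inv_mul_eq_iff_eq_mul, ← mul_assoc, hμ', mul_inv_cancel_right]
    calc ρ g = S * (S⁻¹ * ρ g * S) * S⁻¹ := by group
      _ = S * ((S⁻¹ * ρ g * S) * μ⁻¹) * (μ * S⁻¹) := by group
      _ = _ := by rw [← h1]; simp only [mul_assoc]

end Universality

/-! ### Representations with a cuspidal character over a field -/

section Field

set_option linter.unusedSectionVars false

variable {F : Type v} [Field F] [Fintype F] [DecidableEq F]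

lemma affine_mul (a a' : Fˣ) (b b' : F) :
    affine a b * affine a' b' = affine (a * a') (a * b' + b) := by
  apply Units.ext
  rw [Units.val_mul, coe_affine, coe_affine, coe_affine]
  ext i j
  fin_cases i <;> fin_cases j <;> simp [Matrix.mul_apply, Fin.sum_univ_two]

lemma affine_one_zero : affine (1 : Fˣ) (0 : F) = 1 := by
  apply Units.ext
  rw [coe_affine, Units.val_one]
  ext i j
  fin_cases i <;> fin_cases j <;> simp

lemma sum_unitsEquiv {A : Type*} [AddCommGroup A] (g : F → A) :
    ∑ i, g (unitsEquiv F i) = ∑ x, g x - g 0 := by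
  rw [Equiv.sum_comp (unitsEquiv F) fun u : Fˣ => g u, eq_sub_iff_add_eq',
    ← Finset.add_sum_erase _ _ (Finset.mem_univ (0 : F))]
  congr 1
  exact Finset.sum_bij (fun u _ => (u : F)) (by simp) (fun u _ v _ e => Units.ext e)
    (fun b hb => ⟨Units.mk0 b (Finset.ne_of_mem_erase hb), by simp⟩) (by simp)

lemma affRep_apply {A : Type x} [CommRing A] (a : Fˣ) (b : F) (i j : Fin (Nat.card F - 1)) :
    affRep A a b i j =
      affMat A a b (unitsEquiv F i) (unitsEquiv F j) - affMat A a b (unitsEquiv F i) 0 := by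
  have h : ∀ M : Matrix F (Fin (Nat.card F - 1)) A,
      (coordMat F A * M) i j = M (unitsEquiv F i) j := fun M => by
    simp [Matrix.mul_apply, coordMat]
  rw [affRep, Matrix.mul_assoc, h, Matrix.mul_apply]
  simp [basisMat, mul_sub, Finset.sum_sub_distrib]

lemma trace_affRep {A : Type x} [CommRing A] (a : Fˣ) (b : F) :
    (affRep A a b).trace = if a = 1 then (if b = 0 then (Nat.card F : A) else 0) - 1 else 0 := by
  have h1 : (affRep A a b).trace = ∑ x, affMat A a b x x - 1 := by
    have h := sum_unitsEquiv fun x : F => affMat A a b x x - affMat A a b x 0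
    have h0 : ∑ x, affMat A a b x 0 = 1 := by simp [affMat]
    rw [sub_self, sub_zero] at h
    rw [← h0, ← Finset.sum_sub_distrib, ← h]
    exact Finset.sum_congr rfl fun i _ => affRep_apply a b i i
  rw [h1]
  split_ifs with ha hb
  · subst ha hb
    simp [affMat]
  · subst ha
    simp [affMat, hb]
  · have ha' : (1 : F) - a ≠ 0 := by
      rw [sub_ne_zero]
      exact fun h => ha (Units.ext h.symm)
    have h2 : ∀ x : F, x = a * x + b ↔ x = b / (1 - a) := fun x => by
      rw [eq_div_iff ha']
      constructor <;> intro h <;> linear_combination h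
    simp [affMat, h2]

variable {κ : Type x} [Field κ]

/-- If all averages vanished, matrix units `X` would give `∑ tr (affRep p) • π(p)⁻¹ = 0`. The values
of the trace turn this into `q = ∑ π(u)⁻¹` over the translations `u`, so `π` would be trivial at the
translation by `1`, with trace `q - 1` instead of `-1`. No semisimplicity is needed, so the
characteristic may divide `q - 1`. -/
lemma exists_sum_affRep_ne_zero (hq : IsUnit (Nat.card F : κ))
    {π : GL (Fin 2) F →* GL (Fin (Nat.card F - 1)) κ}
    (hπ : tr (π (affine 1 1)) = (affRep κ (1 : Fˣ) (1 : F)).trace) :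
    ∃ X : Matrix (Fin (Nat.card F - 1)) (Fin (Nat.card F - 1)) κ,
      ∑ p : Fˣ × F, affRep κ p.1 p.2 * X * ((π (affine p.1 p.2))⁻¹).1 ≠ 0 := by
  by_contra! h
  have h1 : ∑ p : Fˣ × F, (affRep κ p.1 p.2).trace • ((π (affine p.1 p.2))⁻¹).1 = 0 := by
    ext m j
    rw [Matrix.sum_apply, Matrix.zero_apply]
    have h2 : ∀ i, ∑ p : Fˣ × F, affRep κ p.1 p.2 i i * ((π (affine p.1 p.2))⁻¹).1 m j = 0 := by
      intro i
      have h3 := congrFun (congrFun (h (Matrix.single i m 1)) i) j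
      rw [Matrix.sum_apply, Matrix.zero_apply] at h3
      rw [← h3]
      refine Finset.sum_congr rfl fun p _ => ?_
      rw [Matrix.mul_apply, Finset.sum_eq_single m]
      · simp
      · intro t _ ht
        rw [Matrix.mul_single_apply_of_ne _ _ _ _ _ ht, zero_mul]
      · simp
    simp only [Matrix.smul_apply, Matrix.trace, Matrix.diag_apply, smul_eq_mul, Finset.sum_mul]
    rw [Finset.sum_comm]
    exact Finset.sum_eq_zero fun i _ => h2 i
  have h2 : (Nat.card F : κ) • (1 : Matrix (Fin (Nat.card F - 1)) (Fin (Nat.card F - 1)) κ) =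
      ∑ b : F, ((π (affine 1 b))⁻¹).1 := by
    rw [Fintype.sum_prod_type, Finset.sum_eq_single 1] at h1
    · simp only [trace_affRep, if_true, sub_smul, one_smul, Finset.sum_sub_distrib, ite_smul,
        zero_smul, Finset.sum_ite_eq', Finset.mem_univ, affine_one_zero, map_one, inv_one,
        Units.val_one] at h1
      exact sub_eq_zero.1 h1
    · intro a _ ha
      simp [trace_affRep, ha]
    · simp
  have h3 : (∑ b : F, ((π (affine 1 b))⁻¹).1) * (π (affine 1 1)).1 =
      ∑ b : F, ((π (affine 1 b))⁻¹).1 := by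
    rw [Finset.sum_mul, ← Equiv.sum_comp (Equiv.addRight (1 : F))]
    refine Finset.sum_congr rfl fun b _ => ?_
    have : affine (1 : Fˣ) (b + 1) = affine 1 1 * affine 1 b := by
      rw [affine_mul, mul_one, Units.val_one, one_mul]
    rw [Equiv.coe_addRight, this, map_mul, mul_inv_rev, Units.val_mul, mul_assoc, Units.inv_mul,
      mul_one]
  rw [← h2, Matrix.smul_mul, Matrix.one_mul] at h3
  have h4 := smul_right_injective _ hq.ne_zero h3
  rw [tr, h4, Matrix.trace_one, Fintype.card_fin, trace_affRep, if_pos rfl, if_neg one_ne_zero,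
    Nat.cast_sub Nat.card_pos, Nat.cast_one] at hπ
  exact hq.ne_zero (by linear_combination hπ)

/-- A representation with the same character as a cuspidal representation is conjugate to it. -/
theorem exists_conj_of_tr_eq (hq : IsUnit (Nat.card F : κ))
    {ϖ π : GL (Fin 2) F →* GL (Fin (Nat.card F - 1)) κ}
    (h_aff : ∀ a b, (ϖ (affine a b)).1 = affRep κ a b) (htr : ∀ g, tr (π g) = tr (ϖ g)) :
    ∃ Q : GL (Fin (Nat.card F - 1)) κ, ∀ g, ϖ g = Q * π g * Q⁻¹ := by
  obtain ⟨X, hX⟩ := exists_sum_affRep_ne_zero hq (π := π) (by rw [htr, tr, h_aff])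
  set Q := ∑ p : Fˣ × F, affRep κ p.1 p.2 * X * ((π (affine p.1 p.2))⁻¹).1 with hQ
  have hcomm : ∀ c d, affRep κ c d * Q = Q * (π (affine c d)).1 := by
    intro c d
    rw [hQ, Finset.mul_sum, Finset.sum_mul]
    refine Fintype.sum_equiv ((Equiv.mulLeft c).prodCongr
      ((Units.mulLeft c).trans (Equiv.addRight d))) _ _ fun p => ?_
    change _ = affRep κ (c * p.1) (c * p.2 + d) * X *
      ((π (affine (c * p.1) (c * p.2 + d)))⁻¹).1 * (π (affine c d)).1
    rw [← affine_mul, map_mul, mul_inv_rev, Units.val_mul, ← h_aff (c * p.1), ← affine_mul, map_mul,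
      Units.val_mul, h_aff, h_aff]
    simp only [mul_assoc, Units.inv_mul, mul_one]
  -- If `v Q = 0` and `Q e ≠ 0`, the rank-one matrix built from `Q e` and `v` pairs to zero with
  -- every `affRep`, because `Q` intertwines; this contradicts separation.
  have hdet : IsUnit Q.det := by
    by_contra hd
    rw [isUnit_iff_ne_zero, not_not] at hd
    obtain ⟨v, hv, hvQ⟩ := Matrix.exists_vecMul_eq_zero_iff.2 hd
    obtain ⟨e, he⟩ : ∃ e, Q.mulVec e ≠ 0 := by
      by_contra! h
      exact hX (Matrix.ext_of_mulVec_single fun i => by rw [h, Matrix.zero_mulVec])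
    have h0 : Matrix.vecMulVec (Q.mulVec e) v = 0 := by
      refine eq_zero_of_trace_affRep hq fun a b => ?_
      rw [Matrix.trace_mul_comm, Matrix.mul_vecMulVec, Matrix.trace_vecMulVec,
        Matrix.mulVec_mulVec, hcomm, ← Matrix.mulVec_mulVec, dotProduct_comm,
        Matrix.dotProduct_mulVec, hvQ, zero_dotProduct]
    rw [Matrix.vecMulVec_eq_zero] at h0
    exact h0.elim he hv
  set P : GL (Fin (Nat.card F - 1)) κ := Matrix.GeneralLinearGroup.mk'' Q hdet with hP
  refine ⟨P, fun g => ?_⟩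
  have hPaff : ∀ a b, P * π (affine a b) * P⁻¹ = ϖ (affine a b) := fun a b => by
    rw [mul_inv_eq_iff_eq_mul]
    apply Units.ext
    rw [Units.val_mul, Units.val_mul, h_aff]
    exact (hcomm a b).symm
  apply Units.ext
  rw [← sub_eq_zero]
  -- Against affine elements the traces of both sides are values of the two characters, which agree.
  refine eq_zero_of_trace_affRep hq fun a b => ?_
  rw [Matrix.sub_mul, Matrix.trace_sub, sub_eq_zero, ← h_aff, ← Units.val_mul, ← Units.val_mul,
    ← map_mul]
  change tr _ = tr _
  rw [← hPaff, ← htr, ← tr_conj P, map_mul]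
  congr 1
  group

end Field

/-! ### The character of a cuspidal model -/

section Model

set_option linter.unusedSectionVars false

variable {F : Type v} [Field F] [Finite F] {F₂ : Type w} [Field F₂] [Finite F₂] [Algebra F F₂]

lemma IsCuspidalCharacter.of_map {C : Type x} [CommRing C] {D : Type*} [CommRing D]
    {b : Module.Basis (Fin 2) F F₂} {θ : F₂ˣ →* Cˣ} {χ : GL (Fin 2) F → C} (f : C →+* D)
    (hf : Function.Injective f) {θ' : F₂ˣ →* Dˣ}
    (hχ : IsCuspidalCharacter b θ' fun g => f (χ g))
    (hθ' : ∀ y, f (θ y : C) = (θ' y : D)) : IsCuspidalCharacter b θ χ := by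
  obtain ⟨h1, h2, h3, h4⟩ := hχ
  beta_reduce at h1 h2 h3 h4
  refine ⟨fun g z hz => hf ?_, fun g z u hu hz => hf ?_, fun g a d had hg => hf ?_,
    fun y hy => hf ?_⟩
  · rw [h1 g z hz, map_mul, hθ', map_sub, map_natCast, map_one]
  · rw [h2 g z u hu hz, map_neg, hθ']
  · rw [h3 g a d had hg, map_zero]
  · rw [h4 y hy, map_sub, map_neg, map_pow, hθ']

lemma tr_map {C : Type x} [CommRing C] {D : Type*} [CommRing D] {n : ℕ} (f : C →+* D)
    (g : GL (Fin n) C) : tr (Matrix.GeneralLinearGroup.map f g) = f (tr g) := by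
  simp [tr, Matrix.trace]

variable {l : ℕ} [Fact l.Prime] {k : Type u} [Field k] [CharP k l]

/-- The character identities hold in `𝒪`, since `𝒪` injects into `K`; they are then reduced and
descended along the injection of `k` in its algebraic closure. -/
lemma IsCuspidalModel.isCuspidalCharacter {b : Module.Basis (Fin 2) F F₂}
    {red : BigInt l k →+* AlgebraicClosure k} {θ : F₂ˣ →* kˣ}
    {π : GL (Fin 2) F →* GL (Fin (Nat.card F - 1)) k} (hπ : IsCuspidalModel b red θ π) :
    IsCuspidalCharacter b θ fun g => tr (π g) := by
  obtain ⟨θt, hθt, L, hL, P, hP⟩ := hπ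
  choose a ha hra using hθt.2
  let θO : F₂ˣ →* (BigInt l k)ˣ := MonoidHom.toHomUnits
    { toFun := a
      map_one' := Subtype.val_injective (by rw [ha, map_one]; rfl)
      map_mul' := fun y z => Subtype.val_injective (by
        rw [ha, map_mul, Units.val_mul, ← ha, ← ha]; rfl) }
  have h1 : IsCuspidalCharacter b θO fun g => tr (L g) :=
    IsCuspidalCharacter.of_map (BigInt l k).val.toRingHom Subtype.val_injective hL ha
  set θ' := (Units.map (algebraMap k (AlgebraicClosure k) : k →* AlgebraicClosure k)).comp θ
  have h2 := h1.map red (θ' := θ') hra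
  refine IsCuspidalCharacter.of_map (algebraMap k (AlgebraicClosure k))
    (algebraMap k (AlgebraicClosure k)).injective (θ' := θ') ?_ fun _ => rfl
  convert h2 using 2 with g
  rw [← tr_map, ← tr_map, hP, tr_conj]

end Model

/-! ### Comparison of complete local algebras by their Artinian points -/

section Complete

set_option linter.unusedSectionVars false

variable {l : ℕ} [Fact l.Prime] {k : Type u} [Field k]
variable {R : Type u} [CommRing R] [Algebra (WittVector l k) R] [CompleteCoeff l k R]

lemma res_eq_zero_of_mem {A : Type u} [CommRing A] [Algebra (WittVector l k) A] [LocalCoeff l k A]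
    {a : A} (ha : a ∈ maximalIdeal A) : res l k A a = 0 := by
  have hmax : (RingHom.ker (res l k A)).IsMaximal :=
    RingHom.ker_isMaximal_of_surjective _ res_surjective
  rwa [← IsLocalRing.eq_maximalIdeal hmax] at ha

instance (n : ℕ) : LocalCoeff l k (R ⧸ maximalIdeal R ^ (n + 1)) :=
  have : Nontrivial (R ⧸ maximalIdeal R ^ (n + 1)) := Ideal.Quotient.nontrivial_iff.2 fun h =>
    (IsLocalRing.maximalIdeal.isMaximal R).ne_top
      (top_le_iff.1 (h ▸ Ideal.pow_le_self n.succ_ne_zero))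
  { IsLocalRing.of_surjective' (Ideal.Quotient.mk (maximalIdeal R ^ (n + 1)))
      Ideal.Quotient.mk_surjective with
    res := Ideal.Quotient.lift _ (res l k R) fun _ ha =>
      res_eq_zero_of_mem (Ideal.pow_le_self n.succ_ne_zero ha)
    res_algebraMap := fun t => by
      rw [← Ideal.Quotient.mk_algebraMap, Ideal.Quotient.lift_mk, res_algebraMap] }

lemma isArtinianRing_quotient (n : ℕ) : IsArtinianRing (R ⧸ maximalIdeal R ^ (n + 1)) := by
  have : IsNoetherianRing R := CompleteCoeff.noetherian (l := l) (k := k)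
  rw [isArtinianRing_iff_isNilpotent_maximalIdeal]
  refine ⟨n + 1, ?_⟩
  have h : maximalIdeal (R ⧸ maximalIdeal R ^ (n + 1)) =
      (maximalIdeal R).map (Ideal.Quotient.mk (maximalIdeal R ^ (n + 1))) :=
    (IsLocalRing.map_maximalIdeal_of_surjective _ Ideal.Quotient.mk_surjective).symm
  rw [h, ← Ideal.map_pow, Ideal.map_quotient_self, Ideal.zero_eq_bot]

variable {R' : Type u} [CommRing R'] [Algebra (WittVector l k) R'] [CompleteCoeff l k R']

/-- A homomorphism of complete Noetherian local algebras is bijective if it induces bijections on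
the points with values in Artinian algebras. -/
theorem bijective_of_forall_artinian (f : R →ₐ[WittVector l k] R')
    (h : ∀ (A : Type u) [CommRing A] [Algebra (WittVector l k) A] [LocalCoeff l k A]
      [IsArtinianRing A], Function.Bijective fun g : R' →ₐ[WittVector l k] A => g.comp f) :
    Function.Bijective f := by
  have := CompleteCoeff.complete (l := l) (k := k) (A := R)
  have := CompleteCoeff.complete (l := l) (k := k) (A := R')
  have hbij : ∀ n, Function.Bijective
      fun g : R' →ₐ[WittVector l k] (R ⧸ maximalIdeal R ^ (n + 1)) => g.comp f := fun n =>
    have := isArtinianRing_quotient (l := l) (k := k) (R := R) n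
    h _
  have hbij' : ∀ n, Function.Bijective
      fun g : R' →ₐ[WittVector l k] (R' ⧸ maximalIdeal R' ^ (n + 1)) => g.comp f := fun n =>
    have := isArtinianRing_quotient (l := l) (k := k) (R := R') n
    h _
  have hex : ∀ n, ∃ g : R' →ₐ[WittVector l k] (R ⧸ maximalIdeal R ^ n),
      g.comp f = Ideal.Quotient.mkₐ (WittVector l k) (maximalIdeal R ^ n) := by
    intro n
    -- The exponent `n + 1` avoids the zero ring `R ⧸ m ^ 0`, which is not a coefficient ring.
    obtain ⟨g, hg⟩ := (hbij n).2 (Ideal.Quotient.mkₐ _ _)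
    refine ⟨(Ideal.Quotient.factorₐ (WittVector l k) (Ideal.pow_le_pow_right n.le_succ)).comp g, ?_⟩
    beta_reduce at hg
    rw [AlgHom.comp_assoc, hg]
    exact AlgHom.ext fun _ => rfl
  choose g hg using hex
  have hcompat : ∀ {m n : ℕ} (hle : m ≤ n),
      (Ideal.Quotient.factorₐ (WittVector l k) (Ideal.pow_le_pow_right hle)).comp (g n) = g m := by
    intro m n hle
    obtain _ | m := m
    · have : Subsingleton (R ⧸ maximalIdeal R ^ 0) :=
        Ideal.Quotient.subsingleton_iff.2 (by rw [pow_zero, Ideal.one_eq_top])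
      exact AlgHom.ext fun _ => Subsingleton.elim _ _
    · apply (hbij m).1
      beta_reduce
      rw [AlgHom.comp_assoc, hg, hg]
      exact AlgHom.ext fun _ => rfl
  -- The inverse of `f` is the limit of the `g n`.
  set G := IsAdicComplete.liftAlgHom (maximalIdeal R) g hcompat
  have hGf : G.comp f = AlgHom.id _ _ := by
    refine IsAdicComplete.algHom_ext (maximalIdeal R) fun n => ?_
    rw [← AlgHom.comp_assoc, IsAdicComplete.mkₐ_comp_liftAlgHom, hg, AlgHom.comp_id]
  have hfG : f.comp G = AlgHom.id _ _ := by
    refine IsAdicComplete.algHom_ext (maximalIdeal R') fun n => ?_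
    obtain _ | n := n
    · have : Subsingleton (R' ⧸ maximalIdeal R' ^ 0) :=
        Ideal.Quotient.subsingleton_iff.2 (by rw [pow_zero, Ideal.one_eq_top])
      exact AlgHom.ext fun _ => Subsingleton.elim _ _
    · apply (hbij' n).1
      beta_reduce
      rw [AlgHom.comp_assoc, AlgHom.comp_assoc, hGf, AlgHom.comp_id, AlgHom.comp_id]
  exact Function.bijective_iff_has_inverse.2
    ⟨G, fun x => AlgHom.congr_fun hGf x, fun x => AlgHom.congr_fun hfG x⟩

end Complete

/-! ### Universal deformations -/

section LiftGL

variable {l : ℕ} [Fact l.Prime] {k : Type u} [Field k]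
variable {A : Type u} [CommRing A] [Algebra (WittVector l k) A] [LocalCoeff l k A]

lemma exists_GL_lift {n : ℕ} (Q : GL (Fin n) k) :
    ∃ P : GL (Fin n) A, Matrix.GeneralLinearGroup.map (res l k A) P = Q := by
  choose s hs using res_surjective (l := l) (k := k) (A := A)
  have hmap : (Q.1.map s).map (res l k A) = Q.1 := by
    ext i j
    simp [hs]
  have hdet : IsUnit (Q.1.map s).det := by
    apply isUnit_of_res_ne_zero (l := l) (k := k)
    rw [RingHom.map_det, RingHom.mapMatrix_apply, hmap]
    exact ((Matrix.isUnit_iff_isUnit_det _).1 Q.isUnit).ne_zero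
  exact ⟨Matrix.GeneralLinearGroup.mk'' _ hdet, Units.ext hmap⟩

variable {G : Type v} [Group G] {n : ℕ} {π : G →* GL (Fin n) k}

lemma Lift.tr_eq_of_toDeformation_eq {ρ ρ' : Lift l π A} (h : ρ.toDeformation = ρ'.toDeformation)
    (g : G) : tr (ρ.1 g) = tr (ρ'.1 g) := by
  obtain ⟨P, -, hP⟩ := Quotient.exact h
  rw [hP, tr_conj]

variable {B : Type u} [CommRing B] [Algebra (WittVector l k) B] [LocalCoeff l k B]

lemma Lift.tr_map (f : A →ₐ[WittVector l k] B) (ρ : Lift l π A) (g : G) :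
    tr ((ρ.map f).1 g) = f (tr (ρ.1 g)) :=
  CuspidalDeformation.tr_map (f : A →+* B) (ρ.1 g)

variable {R R' : Type u} [CommRing R] [Algebra (WittVector l k) R] [CompleteCoeff l k R]
  [CommRing R'] [Algebra (WittVector l k) R'] [CompleteCoeff l k R']

/-- A lift which represents the deformations on all local algebras is isomorphic to every universal
deformation. -/
lemma Lift.IsUniversal.exists_algEquiv {ρ' : Lift l π R'} (hρ' : ρ'.IsUniversal) (ρ : Lift l π R)
    (hρ : ∀ (A : Type u) [CommRing A] [Algebra (WittVector l k) A] [LocalCoeff l k A]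
      (d : Deformation l π A), ∃! f : R →ₐ[WittVector l k] A, (ρ.map f).toDeformation = d) :
    ∃ α : R ≃ₐ[WittVector l k] R',
      (ρ.map (α : R →ₐ[WittVector l k] R')).toDeformation = ρ'.toDeformation := by
  -- `R'` need not be Artinian, so this uses that `ρ` represents deformations to all local algebras.
  obtain ⟨f, hf, -⟩ := hρ R' ρ'.toDeformation
  have hcomp : ∀ (A : Type u) [CommRing A] [Algebra (WittVector l k) A] [LocalCoeff l k A]
      (g : R' →ₐ[WittVector l k] A),
      (ρ.map (g.comp f)).toDeformation = (ρ'.map g).toDeformation :=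
    fun A _ _ _ g => congrArg (Deformation.map g) hf
  refine ⟨AlgEquiv.ofBijective f (bijective_of_forall_artinian f fun A _ _ _ _ => ⟨?_, ?_⟩), hf⟩
  · intro g g' hg
    refine (hρ' A (ρ'.map g).toDeformation).unique rfl ?_
    rw [← hcomp, ← hcomp]
    exact congrArg (fun g => (ρ.map g).toDeformation) hg.symm
  · intro g
    obtain ⟨g', hg', -⟩ := hρ' A (ρ.map g).toDeformation
    exact ⟨g', (hρ A _).unique ((hcomp A g').trans hg') rfl⟩

variable {E : Type w} [CommGroup E] {θ : E →* kˣ}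

lemma CharDeformation.IsUniversal.exists_algEquiv {χ' : CharDeformation l θ R'}
    (hχ' : χ'.IsUniversal) (χ : CharDeformation l θ R)
    (hχ : ∀ (A : Type u) [CommRing A] [Algebra (WittVector l k) A] [LocalCoeff l k A]
      (d : CharDeformation l θ A), ∃! f : R →ₐ[WittVector l k] A, χ.map f = d) :
    ∃ α : R ≃ₐ[WittVector l k] R', χ.map (α : R →ₐ[WittVector l k] R') = χ' := by
  obtain ⟨f, hf, -⟩ := hχ R' χ'
  have hcomp : ∀ (A : Type u) [CommRing A] [Algebra (WittVector l k) A] [LocalCoeff l k A]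
      (g : R' →ₐ[WittVector l k] A), χ.map (g.comp f) = χ'.map g :=
    fun A _ _ _ g => congrArg (CharDeformation.map g) hf
  refine ⟨AlgEquiv.ofBijective f (bijective_of_forall_artinian f fun A _ _ _ _ => ⟨?_, ?_⟩), hf⟩
  · intro g g' hg
    refine (hχ' A (χ'.map g)).unique rfl ?_
    rw [← hcomp, ← hcomp]
    exact congrArg (fun g => χ.map g) hg.symm
  · intro g
    obtain ⟨g', hg', -⟩ := hχ' A (χ.map g)
    exact ⟨g', (hχ A _).unique ((hcomp A g').trans hg') rfl⟩

end LiftGL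

/-! ### The universal deformation of the cuspidal representation -/

section Universal

set_option linter.unusedSectionVars false

variable {l : ℕ} [Fact l.Prime] {k : Type u} [Field k] [Finite k] [CharP k l]
variable {H : Type} [CommGroup H] [Finite H] [Fact (IsPGroup l H)]
variable {F : Type v} [Field F] [Finite F] {F₂ : Type w} [Field F₂] [Finite F₂] [Algebra F F₂]
variable {θ : F₂ˣ →* kˣ} {p : F₂ˣ →* H}

/-- From `|G| = (q ^ 2 - 1) * (q ^ 2 - q)`. The last factor is the scalar `m` of `transfer_self`,
which is prime to `l` when `q` and `|ker p|` are. -/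
lemma card_GL_two_eq (h2 : Module.finrank F F₂ = 2) (hp : Function.Surjective p) :
    Nat.card (GL (Fin 2) F) =
      (Nat.card F - 1) * Nat.card H * (Nat.card F * Nat.card p.ker) := by
  have : Fintype F := Fintype.ofFinite F
  have h1 : Nat.card H * Nat.card p.ker = Nat.card F ^ 2 - 1 := by
    rw [← card_quadratic h2, ← Nat.card_units, Subgroup.card_eq_card_quotient_mul_card_subgroup
      p.ker, Nat.card_congr (QuotientGroup.quotientKerEquivOfSurjective p hp).toEquiv]
  have h3 : Nat.card F ^ 2 - Nat.card F = Nat.card F * (Nat.card F - 1) := by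
    rw [Nat.mul_sub, mul_one, sq]
  rw [Matrix.card_GL_field, Fin.prod_univ_two, ← Nat.card_eq_fintype_card]
  simp only [Fin.val_zero, Fin.val_one, pow_zero, pow_one]
  rw [← h1, h3]
  ring

/-- The group ring carries the universal deformation of a representation with cuspidal
character. -/
theorem exists_universal_lift (hq : l.Coprime (Nat.card F)) (b : Module.Basis (Fin 2) F F₂)
    (hθ : θ ^ Nat.card F ≠ θ) (hp : Function.Surjective p) (hcop : l.Coprime (Nat.card p.ker))
    {π : GL (Fin 2) F →* GL (Fin (Nat.card F - 1)) k}
    (hπ : IsCuspidalCharacter b θ fun g => tr (π g)) :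
    ∃ ρ : Lift l π (MonoidAlgebra (WittVector l k) H),
      IsCuspidalCharacter b (univChar l θ p) (fun g => tr (ρ.1 g)) ∧
      ∀ (A : Type u) [CommRing A] [Algebra (WittVector l k) A] [LocalCoeff l k A]
        (d : Deformation l π A),
        ∃! f : MonoidAlgebra (WittVector l k) H →ₐ[WittVector l k] A,
          (ρ.map f).toDeformation = d := by
  classical
  have : Fintype F := Fintype.ofFinite F
  have : Fintype F₂ := Fintype.ofFinite F₂
  have hqR := isUnit_natCast_of_coprime k hq (MonoidAlgebra (WittVector l k) H)
  have hgen := generalPosition_univChar (l := l) (p := p) hθ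
  set ϖ := cuspRep (finrank_eq_two b) hqR _ hgen with hϖ
  have h_aff : ∀ a b, (ϖ (affine a b)).1 = affRep _ a b := cuspRep_affine _ _ _ _
  have hcusp : IsCuspidalCharacter b (univChar l θ p) fun g => tr (ϖ g) :=
    isCuspidalCharacter_cuspRep b hqR _ hgen
  have hres : ∀ y, res l k _ (univChar l θ p y).1 = (θ y : k) := fun y => by
    rw [res_groupRing_apply, aug_univChar, constantCoeff_teichChar]
  set ϖ₀ := (Matrix.GeneralLinearGroup.map (res l k (MonoidAlgebra (WittVector l k) H))).comp ϖ
  have htr : ∀ g, tr (π g) = tr (ϖ₀ g) := by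
    refine congrFun (hπ.ext (χ' := fun g => tr (ϖ₀ g)) ?_ (fun P g => ?_) fun P g => ?_)
    · have h1 := hcusp.map (res l k _) hres
      convert h1 using 2 with g
      exact tr_map _ _
    · rw [map_mul, map_mul, map_inv, tr_conj]
    · rw [map_mul, map_mul, map_inv, tr_conj]
  obtain ⟨Q, hQ⟩ := exists_conj_of_tr_eq (κ := k) (ϖ := ϖ₀) (π := π)
    (by simpa using hqR.map (res l k _)) (fun a b => by
      rw [← map_affRep (res l k (MonoidAlgebra (WittVector l k) H)), ← h_aff]; rfl) htr
  -- The reduction of `ϖ` is only conjugate to `π`. Lifting `Q` to the group ring turns `ϖ` into a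
  -- lift of `π`; lifting it to `A` turns a lift of `π` into a lift of the reduction of `ϖ`.
  obtain ⟨QR, hQR⟩ := exists_GL_lift (l := l) (A := MonoidAlgebra (WittVector l k) H) Q
  set ρ : Lift l π (MonoidAlgebra (WittVector l k) H) :=
    ⟨(MulAut.conj QR⁻¹).toMonoidHom.comp ϖ, by
      ext1 g
      change Matrix.GeneralLinearGroup.map _ (QR⁻¹ * ϖ g * QR⁻¹⁻¹) = _
      rw [inv_inv, map_mul, map_mul, map_inv, hQR]
      change Q⁻¹ * ϖ₀ g * Q = _
      rw [hQ]
      group⟩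
  have hρ : ∀ g, ρ.1 g = QR⁻¹ * ϖ g * QR⁻¹⁻¹ := fun g => rfl
  have hρtr : ∀ g, tr (ρ.1 g) = tr (ϖ g) := fun g => by rw [hρ, tr_conj]
  have htop : ∀ S : Subalgebra (WittVector l k) (MonoidAlgebra (WittVector l k) H),
      (∀ g, tr (ϖ g) ∈ S) → S = ⊤ := fun S hS =>
    eq_top_of_trace_mem (Fact.out : IsPGroup l H) hp hθ hcusp hS
  refine ⟨ρ, by simpa only [hρtr] using hcusp, fun A _ _ _ d => ?_⟩
  obtain ⟨σ, rfl⟩ := Quotient.exists_rep d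
  obtain ⟨QA, hQA⟩ := exists_GL_lift (l := l) (A := A) Q
  obtain ⟨f, P, hP, hf⟩ := exists_algHom_conj hq h_aff htop
    (card_GL_two_eq (finrank_eq_two b) hp) (Nat.Coprime.mul_right hq hcop)
    ((MulAut.conj QA).toMonoidHom.comp σ.1) (by
      ext1 g
      change Matrix.GeneralLinearGroup.map _ (QA * σ.1 g * QA⁻¹) = ϖ₀ g
      rw [map_mul, map_mul, map_inv, hQA, hQ]
      congr 2
      exact DFunLike.congr_fun σ.2 g)
  have hfd : (ρ.map f).toDeformation = σ.toDeformation := by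
    refine Quotient.sound ⟨QA⁻¹ * P * Matrix.GeneralLinearGroup.map (f : _ →+* A) QR, ?_,
      fun g => ?_⟩
    · rw [map_mul, map_mul, map_inv, hQA, hP, ← MonoidHom.comp_apply (Matrix.GeneralLinearGroup.map _),
        ← Matrix.GeneralLinearGroup.map_comp, res_comp, hQR, mul_one, inv_mul_cancel]
    · have h1 : QA * σ.1 g * QA⁻¹ = P * Matrix.GeneralLinearGroup.map (f : _ →+* A) (ϖ g) * P⁻¹ :=
        hf g
      change σ.1 g = _ * Matrix.GeneralLinearGroup.map (f : _ →+* A) (ρ.1 g) * _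
      rw [hρ, inv_inv QR, map_mul, map_mul, map_inv, ← mul_right_inj QA, ← mul_left_inj QA⁻¹, h1]
      group
  · refine ⟨f, hfd, fun f' hf' => ?_⟩
    -- Equivalent lifts have equal traces, and the traces generate the group ring.
    have h1 : ∀ g, f' (tr (ϖ g)) = f (tr (ϖ g)) := fun g => by
      rw [← hρtr, ← Lift.tr_map, ← Lift.tr_map]
      exact Lift.tr_eq_of_toDeformation_eq (hf'.trans hfd.symm) g
    have h2 := htop (AlgHom.equalizer f' f) h1
    exact AlgHom.ext fun x => (h2 ▸ Algebra.mem_top : x ∈ AlgHom.equalizer f' f)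

end Universal

/-! ### The maps to the product of copies of `K` -/

section Product

set_option linter.unusedSectionVars false

variable {l : ℕ} [Fact l.Prime] {k : Type u} [Field k] [Finite k] [CharP k l]
variable {H : Type} [CommGroup H] [Finite H] [Fact (IsPGroup l H)]
variable {F : Type v} [Field F] [Finite F] {F₂ : Type w} [Field F₂] [Finite F₂]
variable {red : BigInt l k →+* AlgebraicClosure k} {θ : F₂ˣ →* kˣ} {p : F₂ˣ →* H}

/-- The group ring embeds in the product of copies of `K` over the lifts of the character. -/
lemma exists_algHom_charLifts (hp : Function.Surjective p) (hcop : l.Coprime (Nat.card p.ker))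
    (hred : ∀ a : WittVector l k, red (algebraMap (WittVector l k) (BigInt l k) a) =
      algebraMap k (AlgebraicClosure k) (WittVector.constantCoeff a))
    (hθ : θ ^ Nat.card F ≠ θ) :
    ∃ Φ : MonoidAlgebra (WittVector l k) H →ₐ[WittVector l k] (CharLifts F red θ → BigField l k),
      (∀ (θt : CharLifts F red θ) y, Φ (univChar l θ p y).1 θt = (θt.1 y : BigField l k)) ∧
      Function.Injective Φ := by
  choose f hf hf' using fun θt : CharLifts F red θ =>
    existsUnique_algHom_of_mem_charLifts hp hcop hred θt.2
  refine ⟨AlgHom.pi f, hf, (injective_iff_map_eq_zero _).2 fun x hx => ?_⟩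
  refine eq_zero_of_forall_charLifts (p := p) hred hθ x fun θt hθt g hg => ?_
  rw [hf' ⟨θt, hθt⟩ g hg]
  exact congrFun hx ⟨θt, hθt⟩

lemma existsUnique_charDeformation_map (hp : Function.Surjective p)
    (hcop : l.Coprime (Nat.card p.ker)) (A : Type u) [CommRing A] [Algebra (WittVector l k) A]
    [LocalCoeff l k A] (d : CharDeformation l θ A) :
    ∃! f : MonoidAlgebra (WittVector l k) H →ₐ[WittVector l k] A,
      (univCharDeformation θ p).map f = d := by
  simp only [charDeformation_map_eq_iff]
  exact existsUnique_map_univChar hp hcop d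

end Product

lemma algHom_ext_of_adjoin {W : Type*} [CommRing W] {R B : Type*} [CommRing R] [Algebra W R]
    [CommRing B] [Algebra W B] {s : Set R} (hs : ∀ S : Subalgebra W R, s ⊆ S → S = ⊤)
    {f g : R →ₐ[W] B} (h : ∀ x ∈ s, f x = g x) : f = g := by
  have h1 := hs (AlgHom.equalizer f g) h
  exact AlgHom.ext fun x => (h1 ▸ Algebra.mem_top : x ∈ AlgHom.equalizer f g)

lemma range_eq_adjoin_of_forall {W : Type*} [CommRing W] {R B : Type*} [CommRing R] [Algebra W R]
    [CommRing B] [Algebra W B] {s : Set R} (hs : ∀ S : Subalgebra W R, s ⊆ S → S = ⊤)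
    (f : R →ₐ[W] B) : f.range = Algebra.adjoin W (f '' s) := by
  rw [← AlgHom.map_adjoin, hs (Algebra.adjoin W s) Algebra.subset_adjoin, Algebra.map_top]

/-- Only invariance of the trace under conjugation matters, so `f` and `f'` may be arbitrary
functions. -/
lemma IsCuspidalCharacter.tr_ext {C : Type x} [CommRing C] {F : Type v} [Field F] [Finite F]
    {F₂ : Type w} [Field F₂] [Finite F₂] [Algebra F F₂] {b : Module.Basis (Fin 2) F F₂}
    {R : Type*} [CommRing R] {n : ℕ} (ρ : GL (Fin 2) F →* GL (Fin n) R) {θ : F₂ˣ →* Cˣ}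
    {f f' : R → C} (h : IsCuspidalCharacter b θ fun g => f (tr (ρ g)))
    (h' : IsCuspidalCharacter b θ fun g => f' (tr (ρ g))) (g : GL (Fin 2) F) :
    f (tr (ρ g)) = f' (tr (ρ g)) :=
  congrFun (h.ext h' (fun P g => by rw [map_mul, map_mul, map_inv, tr_conj])
    fun P g => by rw [map_mul, map_mul, map_inv, tr_conj]) g

end CuspidalDeformation

end

/-! ### The main theorem -/

open CuspidalDeformation in
theorem mainTheorem4
    (l : ℕ) [Fact l.Prime] (hl : l ≠ 2)
    (k : Type u) [Field k] [Finite k] [CharP k l]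
    (F : Type v) [Field F] [Finite F] (hlq : l.Coprime (Nat.card F))
    (F₂ : Type w) [Field F₂] [Algebra F F₂] (b : Module.Basis (Fin 2) F F₂)
    -- the reduction map from the ring of integers of `K` to the algebraic closure of `k`
    (red : BigInt l k →+* AlgebraicClosure k)
    (hred : ∀ a : WittVector l k, red (algebraMap (WittVector l k) (BigInt l k) a) =
      algebraMap k (AlgebraicClosure k) (WittVector.constantCoeff a))
    (θ : F₂ˣ →* kˣ) (hθ : θ ^ Nat.card F ≠ θ)
    (π : GL (Fin 2) F →* GL (Fin (Nat.card F - 1)) k) (hπ : IsCuspidalModel b red θ π) :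
    -- both universal deformation rings exist
    (∃ (R : Type u) (_ : CommRing R) (_ : Algebra (WittVector l k) R) (_ : CompleteCoeff l k R)
      (ρ : Lift l π R), ρ.IsUniversal) ∧
    (∃ (R : Type u) (_ : CommRing R) (_ : Algebra (WittVector l k) R) (_ : CompleteCoeff l k R)
      (χ : CharDeformation l θ R), χ.IsUniversal) ∧
    ∀ (Rπ : Type u) [CommRing Rπ] [Algebra (WittVector l k) Rπ] [CompleteCoeff l k Rπ]
      (πuniv : Lift l π Rπ) (_ : πuniv.IsUniversal)
      (Rθ : Type u) [CommRing Rθ] [Algebra (WittVector l k) Rθ] [CompleteCoeff l k Rθ]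
      (θuniv : CharDeformation l θ Rθ) (_ : θuniv.IsUniversal),
    -- the maps from the universal deformation rings to the product of copies of `K` over `S_θ`
    ∃ (Φπ : Rπ →ₐ[WittVector l k] (CharLifts F red θ → BigField l k))
      (Φθ : Rθ →ₐ[WittVector l k] (CharLifts F red θ → BigField l k)),
      (∀ Ψ : Rπ →ₐ[WittVector l k] (CharLifts F red θ → BigField l k),
        (∀ θt : CharLifts F red θ, IsCuspidalCharacter b θt.1
          (fun g => Ψ (tr (πuniv.1 g)) θt)) ↔ Ψ = Φπ) ∧
      (∀ Ψ : Rθ →ₐ[WittVector l k] (CharLifts F red θ → BigField l k),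
        (∀ (θt : CharLifts F red θ) (y : F₂ˣ),
          Ψ (θuniv.1 y : Rθ) θt = (θt.1 y : BigField l k)) ↔ Ψ = Φθ) ∧
      -- they identify the rings with the subalgebras generated by the `x_σ` and by the `y_σ`
      Function.Injective Φπ ∧
      Φπ.range = Algebra.adjoin (WittVector l k)
        (Set.range fun g : GL (Fin 2) F => Φπ (tr (πuniv.1 g))) ∧
      Function.Injective Φθ ∧
      Φθ.range = Algebra.adjoin (WittVector l k)
        (Set.range fun (y : F₂ˣ) (θt : CharLifts F red θ) => (θt.1 y : BigField l k)) ∧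
      -- the first subalgebra lies in the second, and the resulting map is an isomorphism
      ∃ φ : Rπ ≃ₐ[WittVector l k] Rθ,
        (∀ a : Rπ, Φθ (φ a) = Φπ a) ∧
        -- the bijection on deformations
        ∃ e : ∀ (A : Type u) [CommRing A] [Algebra (WittVector l k) A] [CompleteCoeff l k A],
            CharDeformation l θ A ≃ Deformation l π A,
          -- it is induced by the isomorphism of universal deformation rings
          (∀ (A : Type u) [CommRing A] [Algebra (WittVector l k) A] [CompleteCoeff l k A]
            (h : Rθ →ₐ[WittVector l k] A),
            e A (θuniv.map h) =
              (πuniv.map (h.comp (φ : Rπ →ₐ[WittVector l k] Rθ))).toDeformation) ∧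
          -- it is natural in the coefficient ring
          (∀ (A : Type u) [CommRing A] [Algebra (WittVector l k) A] [CompleteCoeff l k A]
            (B : Type u) [CommRing B] [Algebra (WittVector l k) B] [CompleteCoeff l k B]
            (f : A →ₐ[WittVector l k] B) (χ : CharDeformation l θ A),
            e B (χ.map f) = (e A χ).map f) ∧
          -- it induces the correspondence between the characters in `S_θ` and their cuspidal
          -- representations
          (∀ (A : Type u) [CommRing A] [Algebra (WittVector l k) A] [CompleteCoeff l k A]
            (χ : CharDeformation l θ A) (ρ : Lift l π A) (j : A →ₐ[WittVector l k] BigField l k)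
            (θt : CharLifts F red θ), e A χ = ρ.toDeformation →
            (∀ y : F₂ˣ, j (χ.1 y : A) = (θt.1 y : BigField l k)) →
            IsCuspidalCharacter b θt.1 (fun g => j (tr (ρ.1 g)))) := by
  classical
  have : Module.Finite F F₂ := Module.Finite.of_basis b
  have : Finite F₂ := Module.finite_of_finite F
  obtain ⟨H, _, _, p, hH, hp, hcop⟩ := exists_pGroup_quotient l F₂ˣ
  have : Fact (IsPGroup l H) := ⟨hH⟩
  obtain ⟨ρ, hρ, huρ⟩ := exists_universal_lift hlq b hθ hp hcop hπ.isCuspidalCharacter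
  set χ : CharDeformation l θ (MonoidAlgebra (WittVector l k) H) := univCharDeformation θ p with hχ
  have huχ : ∀ (A : Type u) [CommRing A] [Algebra (WittVector l k) A] [LocalCoeff l k A]
      (d : CharDeformation l θ A),
      ∃! f : MonoidAlgebra (WittVector l k) H →ₐ[WittVector l k] A, χ.map f = d :=
    fun A _ _ _ d => existsUnique_charDeformation_map hp hcop A d
  refine ⟨⟨_, inferInstance, inferInstance, inferInstance, ρ, fun A _ _ _ _ => huρ A⟩,
    ⟨_, inferInstance, inferInstance, inferInstance, χ, fun A _ _ _ _ => huχ A⟩, ?_⟩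
  intro Rπ _ _ _ πuniv hπuniv Rθ _ _ _ θuniv hθuniv
  -- Arbitrary universal deformations are transported to the group ring, where both maps to the
  -- product are `Φ`.
  obtain ⟨α, hα⟩ := hπuniv.exists_algEquiv ρ huρ
  obtain ⟨β, hβ⟩ := hθuniv.exists_algEquiv χ huχ
  obtain ⟨Φ, hΦ, hΦinj⟩ := exists_algHom_charLifts hp hcop hred hθ
  have htr : ∀ g, tr (πuniv.1 g) = α (tr (ρ.1 g)) := fun g =>
    (Lift.tr_eq_of_toDeformation_eq hα g).symm.trans (Lift.tr_map _ ρ g)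
  have hβy : ∀ y, (θuniv.1 y : Rθ) = β (univChar l θ p y : MonoidAlgebra (WittVector l k) H) :=
    fun y => by rw [← hβ]; rfl
  have hgenπ : ∀ S : Subalgebra (WittVector l k) (MonoidAlgebra (WittVector l k) H),
      Set.range (fun g => tr (ρ.1 g)) ⊆ S → S = ⊤ := fun S hS =>
    eq_top_of_trace_mem hH hp hθ hρ fun g => hS ⟨g, rfl⟩
  have hgenθ : ∀ S : Subalgebra (WittVector l k) (MonoidAlgebra (WittVector l k) H),
      Set.range (fun y => (univChar l θ p y).1) ⊆ S → S = ⊤ := fun S hS =>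
    adjoin_univChar hp fun y => hS ⟨y, rfl⟩
  have hΦρ : ∀ θt : CharLifts F red θ, IsCuspidalCharacter b θt.1
      fun g => Φ (tr (ρ.1 g)) θt := fun θt =>
    hρ.map ((Pi.evalRingHom _ θt).comp (Φ : _ →+* (CharLifts F red θ → BigField l k))) (hΦ θt)
  refine ⟨Φ.comp α.symm, Φ.comp β.symm, fun Ψ => ⟨fun h => ?_, ?_⟩, fun Ψ => ⟨fun h => ?_, ?_⟩,
    hΦinj.comp α.symm.injective, ?_, hΦinj.comp β.symm.injective, ?_, α.symm.trans β, fun a => ?_,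
    ?_⟩
  -- Cuspidality determines `Ψ` on the traces by the classification of conjugacy classes, and the
  -- traces generate.
  · have h1 : Ψ.comp (α : _ →ₐ[WittVector l k] Rπ) = Φ := by
      refine algHom_ext_of_adjoin hgenπ ?_
      rintro _ ⟨g, rfl⟩
      funext θt
      have h2 := h θt
      simp only [htr] at h2
      exact h2.tr_ext (f := fun r => Ψ (α r) θt) (f' := fun r => Φ r θt) ρ.1 (hΦρ θt) g
    rw [← h1]
    ext a
    simp
  · rintro rfl θt
    simpa [htr] using hΦρ θt
  · have h1 : Ψ.comp (β : _ →ₐ[WittVector l k] Rθ) = Φ := by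
      refine algHom_ext_of_adjoin hgenθ ?_
      rintro _ ⟨y, rfl⟩
      funext θt
      rw [hΦ, ← h θt y, hβy]
      rfl
    rw [← h1]
    ext a
    simp
  · rintro rfl θt y
    simpa [hβy] using hΦ θt y
  · rw [AlgHom.range_comp, AlgHom.range_eq_top _ |>.2 α.symm.surjective, Algebra.map_top,
      range_eq_adjoin_of_forall hgenπ,
      ← Set.range_comp]
    simp [htr, Function.comp_def]
  · rw [AlgHom.range_comp, AlgHom.range_eq_top _ |>.2 β.symm.surjective, Algebra.map_top,
      range_eq_adjoin_of_forall hgenθ,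
      ← Set.range_comp]
    congr 2
    ext y θt
    exact hΦ θt y
  · simp
  -- Both deformation functors are represented by the group ring; `e` is the composite of the two
  -- bijections.
  · set eρ : ∀ (A : Type u) [CommRing A] [Algebra (WittVector l k) A] [CompleteCoeff l k A],
        (MonoidAlgebra (WittVector l k) H →ₐ[WittVector l k] A) ≃ Deformation l π A :=
      fun A _ _ _ => Equiv.ofBijective (fun f => (ρ.map f).toDeformation)
        ((Function.bijective_iff_existsUnique _).2 (huρ A)) with heρ
    set eχ : ∀ (A : Type u) [CommRing A] [Algebra (WittVector l k) A] [CompleteCoeff l k A],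
        (MonoidAlgebra (WittVector l k) H →ₐ[WittVector l k] A) ≃ CharDeformation l θ A :=
      fun A _ _ _ => Equiv.ofBijective (fun f => χ.map f)
        ((Function.bijective_iff_existsUnique _).2 (huχ A)) with heχ
    have he : ∀ (A : Type u) [CommRing A] [Algebra (WittVector l k) A] [CompleteCoeff l k A]
        (f : MonoidAlgebra (WittVector l k) H →ₐ[WittVector l k] A),
        eρ A ((eχ A).symm (χ.map f)) = (ρ.map f).toDeformation := fun A _ _ _ f =>
      congrArg (eρ A) ((eχ A).symm_apply_apply f)
    refine ⟨fun A _ _ _ => (eχ A).symm.trans (eρ A), ?_, ?_, ?_⟩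
    · intro A _ _ _ h
      have h1 : θuniv.map h = χ.map (h.comp (β : _ →ₐ[WittVector l k] Rθ)) := by
        rw [← hβ]
        rfl
      have h2 : (πuniv.map (h.comp ((α.symm.trans β : Rπ ≃ₐ[WittVector l k] Rθ) :
          Rπ →ₐ[WittVector l k] Rθ))).toDeformation =
          (ρ.map (h.comp (β : _ →ₐ[WittVector l k] Rθ))).toDeformation := by
        have h3 : (h.comp ((α.symm.trans β : Rπ ≃ₐ[WittVector l k] Rθ) :
            Rπ →ₐ[WittVector l k] Rθ)).comp (α : MonoidAlgebra (WittVector l k) H →ₐ[_] Rπ) =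
            h.comp (β : MonoidAlgebra (WittVector l k) H →ₐ[_] Rθ) := AlgHom.ext fun a => by simp
        rw [← h3]
        exact (congrArg (Deformation.map _) hα).symm
      rw [h1, h2]
      exact he A _
    · intro A _ _ _ B _ _ _ f c
      obtain ⟨g, rfl⟩ := (eχ A).surjective c
      exact (he B (f.comp g)).trans (congrArg (Deformation.map f) (he A g)).symm
    · intro A _ _ _ c σ j θt hc hj
      obtain ⟨g, rfl⟩ := (eχ A).surjective c
      -- Both `c` and `σ` arise from the same `g`, and `j ∘ g` specialises the universal character
      -- to `θt`.
      have h1 : ∀ s, tr (σ.1 s) = g (tr (ρ.1 s)) := fun s =>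
        (Lift.tr_eq_of_toDeformation_eq ((he A g).symm.trans hc) s).symm.trans (Lift.tr_map _ ρ s)
      simp only [h1]
      exact hρ.map ((j : A →+* BigField l k).comp (g : _ →+* A)) hj
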